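/- Let $\pi:\mathbb R^2\times\mathbb R^4\to\mathbb R^2$ be the product bundle whose sections $S=(u^1,u^2,u^3,u^4)=(a^0,a^1,a^2,a^3)$ are identified with the equations $y''=a^3(x,y)y'^3+a^2(x,y)y'^2+a^1(x,y)y'+a^0(x,y)$ (all data $C^\infty$, $x^1=x$, $x^2=y$), and let $J^k\pi$ be the manifold of $k$-jets of its sections. A point transformation $f$ (a diffeomorphism of an open subset of $\mathbb R^2$ onto an open subset of $\mathbb R^2$) takes an equation $S$ to an equation of the same form, with section $f^{(0)}\circ S\circ f^{-1}$, and is lifted to jets by $f^{(k)}(j^k_pS)=j^k_{f(p)}(f^{(0)}\circ S\circ f^{-1})$. With subscripts for partial derivatives put $$F^1=3u^1_{22}-2u^2_{12}+u^3_{11}+3u^4u^1_1-3u^3u^1_2+2u^2u^2_2-u^2u^3_1-3u^1u^3_2+6u^1u^4_1,$$ $$F^2=u^2_{22}-2u^3_{12}+3u^4_{11}-3u^1u^4_2+3u^2u^4_1-2u^3u^3_1+u^3u^2_2+3u^4u^2_1-6u^4u^1_2,$$ $$F^3=F^2(F^1D_1F^2-F^2D_1F^1)-F^1(F^1D_2F^2-F^2D_2F^1)+(F^1)^3u^4-(F^1)^2F^2u^3+F^1(F^2)^2u^2-(F^2)^3u^1,$$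 where $D_1,D_2$ are the total derivatives. The generic part $\mathcal M_k\subset J^k\pi$ is the set of $k$-jets $j^k_pS$ of sections with $F^3(j^3_pS)\neq0$; that is, the inverse image of $\{F^3\ne0\}\subset J^3\pi$ in $J^k\pi$ if $k\ge3$, and its image in $J^k\pi$ if $k\le3$. Let $A_k$ be the $\mathbb R$-algebra of smooth functions $\mathcal M_k\to\mathbb R$ that are invariant under all lifted point transformations $f^{(k)}$ (scalar differential invariants of order $k$). 1. For $0\le k\le3$ the algebra $A_k$ is trivial, that is, it consists of constants. 2. For $k\ge4$ the algebra $A_k$ is generated by $k^2-k-6$ functionally independent invariants: there are $I^1,\dots,I^N\in A_k$, $N=k^2-k-6$, whose differentials are linearly independent at every point of $\mathcal M_k$, such that a function $J:\mathcal M_k\to\mathbb R$ lies in $A_k$ if and only if $J=\varphi(I^1,\dots,I^N)$ for some smooth $\varphi:\mathbb R^N\to\mathbb R$. In particular, $A_4$ is generated by $6$ functionally independent invariants and $A_5$ by $14$. -/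

import Mathlib

open scoped ContDiff

namespace CubicODE

noncomputable section

/-- The base `ℝ²`; coordinate `0` is `x¹ = x`, coordinate `1` is `x² = y`. -/
abbrev Base := Fin 2 → ℝ

/-- The fibre `ℝ⁴` of the product bundle `π : ℝ² × ℝ⁴ → ℝ²`. A section `S : Base → Fib` is
identified with the equation
`y'' = S³(x,y) y'³ + S²(x,y) y'² + S¹(x,y) y' + S⁰(x,y)`. -/
abbrev Fib := Fin 4 → ℝ

/-- Partial derivative `∂g/∂xʲ` of a real function on the base (`j = 0` is `x`, `j = 1` is `y`). -/
def pd (j : Fin 2) (g : Base → ℝ) : Base → ℝ :=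
  fun q => fderiv ℝ g q (Pi.single j 1)

/-! ### Jets of sections -/

/-- Multi-indices of order at most `k` in two variables. -/
abbrev MultiIndex (k : ℕ) := {σ : Fin (k + 1) × Fin (k + 1) // (σ.1 : ℕ) + (σ.2 : ℕ) ≤ k}

/-- The manifold `J^k π` in its (global) standard coordinates `(x, u^i_σ)`, `|σ| ≤ k`. -/
abbrev JetSpace (k : ℕ) := Base × (MultiIndex k → Fib)

/-- The `k`-jet at `p` of the section `S`:
`u^i_(a,b) = ∂^(a+b) S^i / (∂x¹)^a (∂x²)^b` at `p`. -/
def jet (k : ℕ) (S : Base → Fib) (p : Base) : JetSpace k :=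
  (p, fun σ i => ((pd 0)^[(σ.1.1 : ℕ)] ((pd 1)^[(σ.1.2 : ℕ)] (fun q => S q i))) p)

/-! ### The action of point transformations -/

/-- A point transformation of `ℝ²`: a smooth diffeomorphism of an open subset of `ℝ²` onto an open
subset of `ℝ²`. -/
structure PointTransformation where
  toOPH : OpenPartialHomeomorph Base Base
  smooth : ContDiffOn ℝ ∞ toOPH toOPH.source
  smooth_symm : ContDiffOn ℝ ∞ toOPH.symm toOPH.target

/-- The coefficients of the equation which the change of variables `(x, y) = g(x̃, ỹ)` produces from
the equation with coefficients `u` at the point `g q`; they depend on `u` and on the 2-jet of `g`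
at `q`. In terms of `[A, B] = A¹B² - A²B¹` the curves solving the equation with coefficients `u` are
those with `[γ', γ''] = ∑ uⁱ (γ¹')^(3-i) (γ²')^i`; substituting `γ = g ∘ γ̃` one gets
`[γ̃', γ̃''] = (∑ uⁱ ((Dg w)¹)^(3-i) ((Dg w)²)^i - [Dg w, D²g(w, w)]) / det Dg` with `w = γ̃'`.
The four components below are the coefficients of this binary cubic form in `w`
(see `cubic_transformedCoeffs`). -/
def transformedCoeffs (u : Fib) (g : Base → Base) (q : Base) : Fib :=
  let a := pd 0 (fun r => g r 0) q
  let b := pd 1 (fun r => g r 0) q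
  let c := pd 0 (fun r => g r 1) q
  let d := pd 1 (fun r => g r 1) q
  let a₁₁ := pd 0 (pd 0 (fun r => g r 0)) q
  let a₁₂ := pd 0 (pd 1 (fun r => g r 0)) q
  let a₂₂ := pd 1 (pd 1 (fun r => g r 0)) q
  let c₁₁ := pd 0 (pd 0 (fun r => g r 1)) q
  let c₁₂ := pd 0 (pd 1 (fun r => g r 1)) q
  let c₂₂ := pd 1 (pd 1 (fun r => g r 1)) q
  ![(u 0 * a ^ 3 + u 1 * a ^ 2 * c + u 2 * a * c ^ 2 + u 3 * c ^ 3
      - (a * c₁₁ - c * a₁₁)) / (a * d - b * c),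
    (3 * u 0 * a ^ 2 * b + u 1 * (a ^ 2 * d + 2 * a * b * c)
      + u 2 * (b * c ^ 2 + 2 * a * c * d) + 3 * u 3 * c ^ 2 * d
      - (b * c₁₁ + 2 * a * c₁₂ - d * a₁₁ - 2 * c * a₁₂)) / (a * d - b * c),
    (3 * u 0 * a * b ^ 2 + u 1 * (b ^ 2 * c + 2 * a * b * d)
      + u 2 * (a * d ^ 2 + 2 * b * c * d) + 3 * u 3 * c * d ^ 2
      - (a * c₂₂ + 2 * b * c₁₂ - c * a₂₂ - 2 * d * a₁₂)) / (a * d - b * c),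
    (u 0 * b ^ 3 + u 1 * b ^ 2 * d + u 2 * b * d ^ 2 + u 3 * d ^ 3
      - (b * c₂₂ - d * a₂₂)) / (a * d - b * c)]

/-- The binary cubic form `∑ uⁱ v^(3-i) w^i`. -/
def cubic (u : Fib) (v w : ℝ) : ℝ :=
  u 0 * v ^ 3 + u 1 * v ^ 2 * w + u 2 * v * w ^ 2 + u 3 * w ^ 3

/-- `transformedCoeffs` are the coefficients of the transformed equation. -/
theorem cubic_transformedCoeffs (u : Fib) (g : Base → Base) (q : Base) (v w : ℝ) :
    cubic (transformedCoeffs u g q) v w =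
      (cubic u (pd 0 (fun r => g r 0) q * v + pd 1 (fun r => g r 0) q * w)
          (pd 0 (fun r => g r 1) q * v + pd 1 (fun r => g r 1) q * w)
        - ((pd 0 (fun r => g r 0) q * v + pd 1 (fun r => g r 0) q * w)
              * (pd 0 (pd 0 (fun r => g r 1)) q * v ^ 2
                + 2 * pd 0 (pd 1 (fun r => g r 1)) q * v * w
                + pd 1 (pd 1 (fun r => g r 1)) q * w ^ 2)
            - (pd 0 (fun r => g r 1) q * v + pd 1 (fun r => g r 1) q * w)
              * (pd 0 (pd 0 (fun r => g r 0)) q * v ^ 2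
                + 2 * pd 0 (pd 1 (fun r => g r 0)) q * v * w
                + pd 1 (pd 1 (fun r => g r 0)) q * w ^ 2)))
        / (pd 0 (fun r => g r 0) q * pd 1 (fun r => g r 1) q
            - pd 1 (fun r => g r 0) q * pd 0 (fun r => g r 1) q) := by
  simp only [cubic, transformedCoeffs, Matrix.cons_val]
  ring

/-- The section `f^(0) ∘ S ∘ f⁻¹`, that is, the equation obtained from `S` by the point
transformation `f` (meaningful on the range `f.toOPH.target` of `f`). -/
def pushSection (f : PointTransformation) (S : Base → Fib) : Base → Fib :=
  fun q => transformedCoeffs (S (f.toOPH.symm q)) f.toOPH.symm q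

/-! ### The generic part of the jet spaces -/

/-- The function `F¹`, evaluated on the 2-jet at `q` of the section `S = (u¹, u², u³, u⁴)`. -/
def F1 (S : Base → Fib) (q : Base) : ℝ :=
  let u₁ : Base → ℝ := fun r => S r 0
  let u₂ : Base → ℝ := fun r => S r 1
  let u₃ : Base → ℝ := fun r => S r 2
  let u₄ : Base → ℝ := fun r => S r 3
  3 * pd 1 (pd 1 u₁) q - 2 * pd 0 (pd 1 u₂) q + pd 0 (pd 0 u₃) q
    + 3 * u₄ q * pd 0 u₁ q - 3 * u₃ q * pd 1 u₁ q + 2 * u₂ q * pd 1 u₂ q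
    - u₂ q * pd 0 u₃ q - 3 * u₁ q * pd 1 u₃ q + 6 * u₁ q * pd 0 u₄ q

/-- The function `F²`, evaluated on the 2-jet at `q` of the section `S = (u¹, u², u³, u⁴)`. -/
def F2 (S : Base → Fib) (q : Base) : ℝ :=
  let u₁ : Base → ℝ := fun r => S r 0
  let u₂ : Base → ℝ := fun r => S r 1
  let u₃ : Base → ℝ := fun r => S r 2
  let u₄ : Base → ℝ := fun r => S r 3
  pd 1 (pd 1 u₂) q - 2 * pd 0 (pd 1 u₃) q + 3 * pd 0 (pd 0 u₄) q
    - 3 * u₁ q * pd 1 u₄ q + 3 * u₂ q * pd 0 u₄ q - 2 * u₃ q * pd 0 u₃ q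
    + u₃ q * pd 1 u₂ q + 3 * u₄ q * pd 0 u₂ q - 6 * u₄ q * pd 1 u₁ q

/-- The function `F³`, evaluated on the 3-jet at `q` of the section `S = (u¹, u², u³, u⁴)`.
(On the jet of a section the total derivative `D_j` is the partial derivative along `xʲ`.) -/
def F3 (S : Base → Fib) (q : Base) : ℝ :=
  F2 S q * (F1 S q * pd 0 (F2 S) q - F2 S q * pd 0 (F1 S) q)
    - F1 S q * (F1 S q * pd 1 (F2 S) q - F2 S q * pd 1 (F1 S) q)
    + F1 S q ^ 3 * S q 3 - F1 S q ^ 2 * F2 S q * S q 2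
    + F1 S q * F2 S q ^ 2 * S q 1 - F2 S q ^ 3 * S q 0

/-- The generic part of `J^k π`: the jets `j^k_p S` of sections whose 3-jet `j^3_p S` lies in the
generic orbit `{F³ ≠ 0}` of `J^3 π`. For `k ≥ 3` this is the inverse image of that orbit under
`J^k π → J^3 π`, and for `k ≤ 3` it is its image under `J^3 π → J^k π`. -/
def genericPart (k : ℕ) : Set (JetSpace k) :=
  {θ | ∃ (S : Base → Fib) (p : Base), ContDiff ℝ ∞ S ∧ F3 S p ≠ 0 ∧ jet k S p = θ}

/-! ### Scalar differential invariants -/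

/-- A function on the generic part of `J^k π`, extended by `0` to `J^k π`. -/
def extendJet {k : ℕ} (I : genericPart k → ℝ) : JetSpace k → ℝ :=
  Function.extend Subtype.val I 0

theorem extendJet_apply {k : ℕ} (I : genericPart k → ℝ) (θ : genericPart k) :
    extendJet I θ = I θ :=
  Subtype.val_injective.extend_apply I 0 θ

/-- Smoothness of a function on the generic part (an open subset of `J^k π`). -/
def IsSmooth {k : ℕ} (I : genericPart k → ℝ) : Prop :=
  ContDiffOn ℝ ∞ (extendJet I) (genericPart k)

/-- Invariance under all lifted point transformations
`f^(k) : j^k_p S ↦ j^k_(f p) (f^(0) ∘ S ∘ f⁻¹)`. -/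
def IsInvariant {k : ℕ} (I : genericPart k → ℝ) : Prop :=
  ∀ (f : PointTransformation) (S : Base → Fib) (p : Base), ContDiff ℝ ∞ S → p ∈ f.toOPH.source →
    ∀ (h : jet k S p ∈ genericPart k)
      (h' : jet k (pushSection f S) (f.toOPH p) ∈ genericPart k),
      I ⟨jet k (pushSection f S) (f.toOPH p), h'⟩ = I ⟨jet k S p, h⟩

/-- The algebra `A_k` of scalar differential invariants of order `k` on the generic part of
`J^k π`. -/
def scalarInvariants (k : ℕ) : Subalgebra ℝ (genericPart k → ℝ) where
  carrier := {I | IsSmooth I ∧ IsInvariant I}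
  mul_mem' := by
    rintro I J ⟨hI, hI'⟩ ⟨hJ, hJ'⟩
    refine ⟨(hI.mul hJ).congr fun θ hθ => ?_, fun f S p hS hp h h' => ?_⟩
    · have e (K : genericPart k → ℝ) : extendJet K θ = K ⟨θ, hθ⟩ := extendJet_apply K ⟨θ, hθ⟩
      simp [e]
    · simp [hI' f S p hS hp h h', hJ' f S p hS hp h h']
  add_mem' := by
    rintro I J ⟨hI, hI'⟩ ⟨hJ, hJ'⟩
    refine ⟨(hI.add hJ).congr fun θ hθ => ?_, fun f S p hS hp h h' => ?_⟩
    · have e (K : genericPart k → ℝ) : extendJet K θ = K ⟨θ, hθ⟩ := extendJet_apply K ⟨θ, hθ⟩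
      simp [e]
    · simp [hI' f S p hS hp h h', hJ' f S p hS hp h h']
  algebraMap_mem' := by
    intro c
    refine ⟨(contDiffOn_const (c := c)).congr fun θ hθ => ?_, fun f S p hS hp h h' => ?_⟩
    · exact extendJet_apply _ ⟨θ, hθ⟩
    · simp [Pi.algebraMap_apply]

/-- Functional independence: the differentials are linearly independent at every point of the
generic part. -/
def FunctionallyIndependent {k N : ℕ} (I : Fin N → genericPart k → ℝ) : Prop :=
  ∀ θ : genericPart k, LinearIndependent ℝ fun i => fderiv ℝ (extendJet (I i)) (θ : JetSpace k)

/-- The functions `I¹, …, I^N` generate `A_k`: they belong to `A_k`, and `A_k` consists exactly of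
the smooth functions of `I¹, …, I^N`. -/
def Generates {k N : ℕ} (I : Fin N → genericPart k → ℝ) : Prop :=
  (∀ i, I i ∈ scalarInvariants k) ∧
    ∀ J : genericPart k → ℝ, J ∈ scalarInvariants k ↔
      ∃ φ : (Fin N → ℝ) → ℝ, ContDiff ℝ ∞ φ ∧ ∀ θ, J θ = φ fun i => I i θ

/-- `A_k` is generated by `N` functionally independent scalar differential invariants. -/
def GeneratedByIndependent (k N : ℕ) : Prop :=
  ∃ I : Fin N → genericPart k → ℝ, FunctionallyIndependent I ∧ Generates I

end

end CubicODE

/-! The proof is a moving frame argument: every generic jet has a unique normal form under point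
transformations, and the entries left free in it are the invariants.

Three facts make the normal form rigid. First, `F_pullSection` shows that `(F1, F2)` transforms as a
covector of weight one, and `F3_pullSection` shows that `F3` has weight five. Where `F3 ≠ 0`, a
linear change of variables therefore achieves `F1 = 1`, `F2 = 0`, `F3 = 1`. Second, the remaining
linear freedom (a shear) and the quadratic Taylor coefficients of the change of variables are used
up by requiring `u = 0` and fixed first derivatives of `F1` and `F2` (`Calibrated`). Third, for `m ≥
1` the Taylor coefficients of order `m + 2` of a change of variables `(g⁰, g¹)` tangent to the
identity act on the `4(m+1)` coordinates of order `m` by translations: `u⁰` by `-g¹_xx`, `u¹` by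
`g⁰_xx - 2g¹_xy`, `u²` by `2g⁰_xy - g¹_yy`, `u³` by `g⁰_yy`, suitably differentiated. This linear
map on `2(m+3)` coefficients is injective, and `Reduced` singles out a complement of its image of
dimension `2(m-1)`.

Existence of the normal form, with smooth dependence on the jet, is
`normalizable_calibrated_reduced`; uniqueness is `PointEquiv.partials_eq`. Calibration fixes the
free coordinates of orders two and three, so the parameters of the normal form are the free
coordinates of orders `4, …, k`, numbering `∑ 2(m-1) = k² - k - 6`. For `k ≤ 3` none remain and all
generic jets are equivalent, so invariants are constant.

For `k ≥ 4` the sections in normal form give a cross-section diffeomorphic to `ℝ^N`. An invariant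
function is determined by its restriction `φ` to the cross-section, which yields generation
(`generates_invariant`). Transporting the cross-section through a given jet by a fixed change of
variables gives a map on which the invariants are the standard coordinates, which yields
independence (`functionallyIndependent_invariant`). -/

open scoped ContDiff Topology

namespace CubicODE

/-! ### Calculus of partial derivatives of germs of smooth functions -/

/-- `f` is smooth on a neighbourhood of `p`. -/
def SmoothNear (f : Base → ℝ) (p : Base) : Prop := ∀ᶠ x in 𝓝 p, ContDiffAt ℝ ∞ f x

theorem SmoothNear.contDiffAt {f : Base → ℝ} {p : Base} (h : SmoothNear f p) :
    ContDiffAt ℝ ∞ f p := h.self_of_nhds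

theorem SmoothNear.differentiableAt {f : Base → ℝ} {p : Base} (h : SmoothNear f p) :
    DifferentiableAt ℝ f p := h.contDiffAt.differentiableAt (by simp)

/-- This is what a neighbourhood condition buys: `ContDiffAt ℝ ∞` at one point gives `C^n`
regularity only on neighbourhoods that may shrink with `n`, so it need not hold at nearby points. -/
theorem SmoothNear.eventually {f : Base → ℝ} {p : Base} (h : SmoothNear f p) :
    ∀ᶠ x in 𝓝 p, SmoothNear f x := eventually_eventually_nhds.2 h

theorem SmoothNear.congr {f g : Base → ℝ} {p : Base} (h : SmoothNear f p) (e : g =ᶠ[𝓝 p] f) :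
    SmoothNear g p := by
  filter_upwards [h, e.eventuallyEq_nhds] with x hx ex
  exact hx.congr_of_eventuallyEq ex

theorem SmoothNear.of_contDiff {f : Base → ℝ} (h : ContDiff ℝ ∞ f) (p : Base) : SmoothNear f p :=
  Filter.Eventually.of_forall fun _ => h.contDiffAt

theorem SmoothNear.const (c : ℝ) (p : Base) : SmoothNear (fun _ => c) p :=
  .of_contDiff contDiff_const p

theorem SmoothNear.coord (j : Fin 2) (p : Base) : SmoothNear (fun x => x j) p :=
  .of_contDiff (contDiff_apply ℝ ℝ j) p

theorem SmoothNear.add {f g : Base → ℝ} {p : Base} (hf : SmoothNear f p) (hg : SmoothNear g p) :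
    SmoothNear (fun x => f x + g x) p := by
  filter_upwards [hf, hg] with x h1 h2 using h1.add h2

theorem SmoothNear.sub {f g : Base → ℝ} {p : Base} (hf : SmoothNear f p) (hg : SmoothNear g p) :
    SmoothNear (fun x => f x - g x) p := by
  filter_upwards [hf, hg] with x h1 h2 using h1.sub h2

theorem SmoothNear.neg {f : Base → ℝ} {p : Base} (hf : SmoothNear f p) :
    SmoothNear (fun x => -f x) p := by
  filter_upwards [hf] with x h1 using h1.neg

theorem SmoothNear.mul {f g : Base → ℝ} {p : Base} (hf : SmoothNear f p) (hg : SmoothNear g p) :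
    SmoothNear (fun x => f x * g x) p := by
  filter_upwards [hf, hg] with x h1 h2 using h1.mul h2

theorem SmoothNear.pow {f : Base → ℝ} {p : Base} (hf : SmoothNear f p) (n : ℕ) :
    SmoothNear (fun x => f x ^ n) p := by
  filter_upwards [hf] with x h1 using h1.pow n

theorem SmoothNear.div {f g : Base → ℝ} {p : Base} (hf : SmoothNear f p) (hg : SmoothNear g p)
    (h0 : g p ≠ 0) : SmoothNear (fun x => f x / g x) p := by
  filter_upwards [hf, hg, hg.contDiffAt.continuousAt.eventually_ne h0] with x h1 h2 h3
    using h1.div h2 h3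

theorem SmoothNear.sum {ι : Type*} {s : Finset ι} {f : ι → Base → ℝ} {p : Base}
    (hf : ∀ i ∈ s, SmoothNear (f i) p) : SmoothNear (fun x => ∑ i ∈ s, f i x) p := by
  have := (Finset.eventually_all s).2 hf
  filter_upwards [this] with x h1 using ContDiffAt.sum h1

theorem SmoothNear.pd {f : Base → ℝ} {p : Base} (hf : SmoothNear f p) (j : Fin 2) :
    SmoothNear (pd j f) p := by
  filter_upwards [hf] with x h1
  exact (h1.fderiv_right (m := ∞) (by simp)).clm_apply contDiffAt_const

/-- `g` is a germ of a smooth map at `p`. -/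
def SmoothMapNear (g : Base → Base) (p : Base) : Prop := ∀ j, SmoothNear (fun y => g y j) p

theorem SmoothMapNear.continuousAt {g : Base → Base} {p : Base} (h : SmoothMapNear g p) :
    ContinuousAt g p := continuousAt_pi.2 fun j => (h j).contDiffAt.continuousAt

theorem SmoothMapNear.eventually {g : Base → Base} {p : Base} (h : SmoothMapNear g p) :
    ∀ᶠ x in 𝓝 p, SmoothMapNear g x := Filter.eventually_all.2 fun j => (h j).eventually

theorem SmoothNear.comp {f : Base → ℝ} {g : Base → Base} {p : Base} (hf : SmoothNear f (g p))
    (hg : SmoothMapNear g p) : SmoothNear (fun x => f (g x)) p := by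
  filter_upwards [hg.continuousAt.eventually hf, Filter.eventually_all.2 hg] with x h1 h2
  exact ContDiffAt.comp x h1 (contDiffAt_pi.2 h2)

theorem SmoothMapNear.comp {f : Base → Base} {g : Base → Base} {p : Base}
    (hf : SmoothMapNear f (g p)) (hg : SmoothMapNear g p) : SmoothMapNear (fun x => f (g x)) p :=
  fun j => (hf j).comp hg

/-! ### Rules for `pd` -/

theorem pd_congr {f g : Base → ℝ} {p : Base} (e : f =ᶠ[𝓝 p] g) (j : Fin 2) :
    pd j f p = pd j g p := by simp only [pd, e.fderiv_eq]

theorem pd_eventuallyEq {f g : Base → ℝ} {p : Base} (e : f =ᶠ[𝓝 p] g) (j : Fin 2) :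
    pd j f =ᶠ[𝓝 p] pd j g := by
  filter_upwards [e.eventuallyEq_nhds] with x hx using pd_congr hx j

theorem pd_const (c : ℝ) (j : Fin 2) : pd j (fun _ => c) = fun _ => 0 := by
  funext x; simp [pd]

theorem pd_coord (i j : Fin 2) : pd j (fun x => x i) = fun _ => if i = j then 1 else 0 := by
  funext x
  have : HasFDerivAt (fun x : Base => x i) (ContinuousLinearMap.proj i : Base →L[ℝ] ℝ) x :=
    hasFDerivAt_apply i x
  simp only [pd, this.fderiv]
  simp [Pi.single_apply]

theorem pd_add {f g : Base → ℝ} {p : Base} (hf : SmoothNear f p) (hg : SmoothNear g p)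
    (j : Fin 2) : pd j (fun x => f x + g x) p = pd j f p + pd j g p := by
  simp only [pd, fderiv_fun_add hf.differentiableAt hg.differentiableAt]; rfl

theorem pd_sub {f g : Base → ℝ} {p : Base} (hf : SmoothNear f p) (hg : SmoothNear g p)
    (j : Fin 2) : pd j (fun x => f x - g x) p = pd j f p - pd j g p := by
  simp only [pd, fderiv_fun_sub hf.differentiableAt hg.differentiableAt]; rfl

theorem pd_neg (f : Base → ℝ) (j : Fin 2) : pd j (fun x => -f x) = fun x => -pd j f x := by
  funext p; simp only [pd, fderiv_fun_neg]; rfl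

theorem pd_mul {f g : Base → ℝ} {p : Base} (hf : SmoothNear f p) (hg : SmoothNear g p)
    (j : Fin 2) : pd j (fun x => f x * g x) p = pd j f p * g p + f p * pd j g p := by
  simp only [pd, fderiv_fun_mul hf.differentiableAt hg.differentiableAt]
  simp; ring

theorem pd_const_mul {f : Base → ℝ} {p : Base} (hf : SmoothNear f p) (c : ℝ)
    (j : Fin 2) : pd j (fun x => c * f x) p = c * pd j f p := by
  rw [pd_mul (.const c p) hf, pd_const]; ring

theorem pd_comp {f : Base → ℝ} {g : Base → Base} {p : Base} (hf : SmoothNear f (g p))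
    (hg : SmoothMapNear g p) (j : Fin 2) :
    pd j (fun x => f (g x)) p = pd 0 f (g p) * pd j (fun x => g x 0) p
      + pd 1 f (g p) * pd j (fun x => g x 1) p := by
  have hg' : HasFDerivAt g (ContinuousLinearMap.pi fun i => fderiv ℝ (fun x => g x i) p) p :=
    hasFDerivAt_pi.2 fun i => (hg i).differentiableAt.hasFDerivAt
  have := (hf.differentiableAt.hasFDerivAt.comp p hg').fderiv
  have e : (f ∘ g) = fun x => f (g x) := rfl
  rw [e] at this
  simp only [pd, this]
  simp only [ContinuousLinearMap.comp_apply]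
  set v := (ContinuousLinearMap.pi fun i => fderiv ℝ (fun x => g x i) p) (Pi.single j 1) with hv
  have hv' : v = v 0 • Pi.single 0 1 + v 1 • Pi.single 1 1 := by
    funext i; fin_cases i <;> simp
  rw [hv', map_add, map_smul, map_smul]
  simp only [hv, smul_eq_mul]
  simp [mul_comm]

theorem pd_comm {f : Base → ℝ} {p : Base} (hf : SmoothNear f p) :
    pd 1 (pd 0 f) p = pd 0 (pd 1 f) p := by
  have h := hf.contDiffAt.isSymmSndFDerivAt (n := ∞)
    (by simpa using WithTop.coe_le_coe.2 (le_top : (2 : ℕ∞) ≤ ⊤))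
  have hd : DifferentiableAt ℝ (fderiv ℝ f) p :=
    (hf.contDiffAt.fderiv_right (m := ∞) (by simp)).differentiableAt (by simp)
  have key (i j : Fin 2) : pd i (pd j f) p
      = fderiv ℝ (fderiv ℝ f) p (Pi.single i 1) (Pi.single j 1) := by
    have : HasFDerivAt (fun x => fderiv ℝ f x (Pi.single j 1))
      ((fderiv ℝ (fderiv ℝ f) p).flip (Pi.single j 1)) p := by
      exact (ContinuousLinearMap.apply ℝ ℝ (Pi.single j 1 : Base)).hasFDerivAt.comp p hd.hasFDerivAt
    change fderiv ℝ (fun x => fderiv ℝ f x (Pi.single j 1)) p _ = _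
    rw [this.fderiv]; rfl
  rw [key, key]
  exact h.eq _ _

theorem pd_comm_eventually {f : Base → ℝ} {p : Base} (hf : SmoothNear f p) :
    pd 1 (pd 0 f) =ᶠ[𝓝 p] pd 0 (pd 1 f) := by
  filter_upwards [hf.eventually] with x hx using pd_comm hx

/-! ### Order of vanishing -/

/-- All partial derivatives of `f` of order less than `n` vanish at `p`. -/
def VanishesAt : ℕ → (Base → ℝ) → Base → Prop
  | 0, f, p => SmoothNear f p
  | n + 1, f, p => SmoothNear f p ∧ f p = 0 ∧ ∀ j, VanishesAt n (pd j f) p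

namespace VanishesAt

theorem smooth {n : ℕ} {f : Base → ℝ} {p : Base} (h : VanishesAt n f p) : SmoothNear f p := by
  cases n with
  | zero => exact h
  | succ n => exact h.1

theorem congr {n : ℕ} {f g : Base → ℝ} {p : Base} (h : VanishesAt n f p) (e : g =ᶠ[𝓝 p] f) :
    VanishesAt n g p := by
  induction n generalizing f g with
  | zero => exact SmoothNear.congr h e
  | succ n ih =>
    exact ⟨h.1.congr e, e.self_of_nhds.trans h.2.1, fun j => ih (h.2.2 j) (pd_eventuallyEq e j)⟩

theorem pred {n : ℕ} {f : Base → ℝ} {p : Base} (h : VanishesAt (n + 1) f p) :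
    VanishesAt n f p := by
  induction n generalizing f with
  | zero => exact h.1
  | succ n ih => exact ⟨h.1, h.2.1, fun j => ih (h.2.2 j)⟩

theorem mono {n m : ℕ} {f : Base → ℝ} {p : Base} (h : VanishesAt n f p) (hm : m ≤ n) :
    VanishesAt m f p := by
  induction n, hm using Nat.le_induction with
  | base => exact h
  | succ n _ ih => exact ih h.pred

theorem pd {n : ℕ} {f : Base → ℝ} {p : Base} (h : VanishesAt n f p) (j : Fin 2) :
    VanishesAt (n - 1) (pd j f) p := by
  cases n with
  | zero => exact SmoothNear.pd h j
  | succ n => exact h.2.2 j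

theorem zero (n : ℕ) (p : Base) : VanishesAt n (fun _ => 0) p := by
  induction n with
  | zero => exact .const 0 p
  | succ n ih => exact ⟨.const 0 p, rfl, fun j => by rwa [pd_const]⟩

theorem add {n : ℕ} {f g : Base → ℝ} {p : Base} (hf : VanishesAt n f p) (hg : VanishesAt n g p) :
    VanishesAt n (fun x => f x + g x) p := by
  induction n generalizing f g with
  | zero => exact SmoothNear.add hf hg
  | succ n ih =>
    refine ⟨hf.1.add hg.1, by simp [hf.2.1, hg.2.1], fun j => ?_⟩
    refine (ih (hf.2.2 j) (hg.2.2 j)).congr ?_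
    filter_upwards [hf.1.eventually, hg.1.eventually] with x h1 h2 using pd_add h1 h2 j

theorem neg {n : ℕ} {f : Base → ℝ} {p : Base} (hf : VanishesAt n f p) :
    VanishesAt n (fun x => -f x) p := by
  induction n generalizing f with
  | zero => exact SmoothNear.neg hf
  | succ n ih => exact ⟨hf.1.neg, by simp [hf.2.1], fun j => by
      rw [pd_neg]; exact ih (hf.2.2 j)⟩

theorem sub {n : ℕ} {f g : Base → ℝ} {p : Base} (hf : VanishesAt n f p) (hg : VanishesAt n g p) :
    VanishesAt n (fun x => f x - g x) p := by
  simpa only [sub_eq_add_neg] using hf.add hg.neg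

/-- Leibniz' rule lowers the total order by one but distributes it differently over the two factors,
so the induction runs on a bound `N` for the sum. -/
theorem mul_aux {N m n : ℕ} (hN : m + n ≤ N) {f g : Base → ℝ} {p : Base} (hf : VanishesAt m f p)
    (hg : VanishesAt n g p) : VanishesAt (m + n) (fun x => f x * g x) p := by
  induction N generalizing m n f g with
  | zero =>
    obtain ⟨rfl, rfl⟩ : m = 0 ∧ n = 0 := by omega
    exact SmoothNear.mul hf hg
  | succ N ih =>
    rcases Nat.eq_zero_or_pos (m + n) with h0 | h0
    · obtain ⟨rfl, rfl⟩ : m = 0 ∧ n = 0 := by omega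
      exact SmoothNear.mul hf hg
    obtain ⟨k, hk⟩ : ∃ k, m + n = k + 1 := ⟨m + n - 1, by omega⟩
    rw [hk]
    refine ⟨hf.smooth.mul hg.smooth, ?_, fun j => ?_⟩
    · rcases Nat.eq_zero_or_pos m with rfl | hm
      · obtain ⟨l, rfl⟩ : ∃ l, n = l + 1 := ⟨n - 1, by omega⟩
        simp [hg.2.1]
      · obtain ⟨l, rfl⟩ : ∃ l, m = l + 1 := ⟨m - 1, by omega⟩
        simp [hf.2.1]
    · have e : CubicODE.pd j (fun x => f x * g x) =ᶠ[𝓝 p]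
          fun x => CubicODE.pd j f x * g x + f x * CubicODE.pd j g x := by
        filter_upwards [hf.smooth.eventually, hg.smooth.eventually] with x h1 h2
          using pd_mul h1 h2 j
      refine (VanishesAt.add ?_ ?_).congr e
      · rcases Nat.eq_zero_or_pos m with rfl | hm
        -- A factor of order zero cannot lose an order, since `0 - 1 = 0`; the other factor is
        -- weakened instead to stay within the induction bound.
        · exact (ih (m := 0) (n := n - 1) (by omega) (hf.pd j) (hg.mono (by omega))).mono (by omega)
        · exact (ih (by omega) (hf.pd j) hg).mono (by omega)
      · rcases Nat.eq_zero_or_pos n with rfl | hm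
        · exact (ih (m := m - 1) (n := 0) (by omega) (hf.mono (by omega)) (hg.pd j)).mono (by omega)
        · exact (ih (by omega) hf (hg.pd j)).mono (by omega)

theorem mul {m n : ℕ} {f g : Base → ℝ} {p : Base} (hf : VanishesAt m f p)
    (hg : VanishesAt n g p) : VanishesAt (m + n) (fun x => f x * g x) p :=
  mul_aux le_rfl hf hg

theorem mul_smooth {n : ℕ} {f g : Base → ℝ} {p : Base} (hf : VanishesAt n f p)
    (hg : SmoothNear g p) : VanishesAt n (fun x => f x * g x) p :=
  hf.mul (n := 0) hg

theorem smooth_mul {n : ℕ} {f g : Base → ℝ} {p : Base} (hf : SmoothNear f p)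
    (hg : VanishesAt n g p) : VanishesAt n (fun x => f x * g x) p := by
  have := VanishesAt.mul (m := 0) (f := f) hf hg
  rwa [zero_add] at this

theorem comp {n : ℕ} {f : Base → ℝ} {g : Base → Base} {p : Base} (hf : VanishesAt n f (g p))
    (hg : SmoothMapNear g p) : VanishesAt n (fun x => f (g x)) p := by
  induction n generalizing f with
  | zero => exact SmoothNear.comp hf hg
  | succ n ih =>
    refine ⟨hf.1.comp hg, hf.2.1, fun j => ?_⟩
    refine (((ih (hf.2.2 0)).mul_smooth ((hg 0).pd j)).add
      ((ih (hf.2.2 1)).mul_smooth ((hg 1).pd j))).congr ?_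
    filter_upwards [hg.continuousAt.eventually hf.1.eventually, hg.eventually] with x h1 h2
      using pd_comp h1 h2 j

/-- Composing with a map which agrees with the identity up to order `n` changes a function only in
order `n`. -/
theorem comp_sub_self {n : ℕ} {f : Base → ℝ} {g : Base → Base} {p : Base} (hp : g p = p)
    (hf : SmoothNear f p) (hg : ∀ i, VanishesAt n (fun x => g x i - x i) p) :
    VanishesAt n (fun x => f (g x) - f x) p := by
  have hgs : SmoothMapNear g p := fun i => ((hg i).smooth.add (.coord i p)).congr
    (Filter.Eventually.of_forall fun x => by simp)
  induction n generalizing f with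
  | zero => exact (SmoothNear.comp (by rwa [hp]) hgs).sub hf
  | succ n ih =>
    have hf' : SmoothNear f (g p) := by rwa [hp]
    refine ⟨(hf'.comp hgs).sub hf, by simp [hp], fun j => ?_⟩
    -- The derivative of `f ∘ g - f` splits into `∂ⱼf ∘ g - ∂ⱼf`, covered by the induction
    -- hypothesis, and the terms `(∂ᵢf ∘ g) · ∂ⱼ(gⁱ - xⁱ)`, whose second factor vanishes to order
    -- `n`.
    have h1 (i : Fin 2) : VanishesAt n (fun x => CubicODE.pd i f (g x) - CubicODE.pd i f x) p :=
      ih (hf.pd i) fun i => (hg i).pred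
    have h2 (i : Fin 2) : VanishesAt n (fun x => CubicODE.pd i f (g x) *
        CubicODE.pd j (fun x => g x i - x i) x) p :=
      smooth_mul ((hf'.pd i).comp hgs) ((hg i).2.2 j)
    refine (((h1 j).add (h2 0)).add (h2 1)).congr ?_
    filter_upwards [hgs.continuousAt.eventually hf'.eventually, hgs.eventually,
      hf.eventually] with x h1 h2 h3
    rw [pd_sub (h1.comp h2) h3, pd_comp h1 h2, pd_sub (h2 0) (.coord 0 x),
      pd_sub (h2 1) (.coord 1 x), pd_coord, pd_coord]
    fin_cases j <;> simp <;> ring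

end VanishesAt

/-! ### Iterated partial derivatives -/

/-- The partial derivative `∂^(a+b) f / (∂x¹)^a (∂x²)^b`. -/
noncomputable def partials (a b : ℕ) (f : Base → ℝ) : Base → ℝ := (pd 0)^[a] ((pd 1)^[b] f)

theorem partials_succ_left (a b : ℕ) (f : Base → ℝ) :
    partials (a + 1) b f = pd 0 (partials a b f) := by
  simp only [partials, Function.iterate_succ_apply']

theorem partials_pd_one (a b : ℕ) (f : Base → ℝ) :
    partials a b (pd 1 f) = partials a (b + 1) f := rfl

theorem partials_smooth {f : Base → ℝ} {p : Base} (hf : SmoothNear f p) (a b : ℕ) :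
    SmoothNear (partials a b f) p := by
  have h1 : SmoothNear ((pd 1)^[b] f) p := by
    induction b with
    | zero => exact hf
    | succ b ih => rw [Function.iterate_succ_apply']; exact ih.pd 1
  induction a with
  | zero => exact h1
  | succ a ih => rw [partials_succ_left]; exact ih.pd 0

theorem partials_eventuallyEq {f g : Base → ℝ} {p : Base} (e : f =ᶠ[𝓝 p] g) (a b : ℕ) :
    partials a b f =ᶠ[𝓝 p] partials a b g := by
  have h1 : (pd 1)^[b] f =ᶠ[𝓝 p] (pd 1)^[b] g := by
    induction b with
    | zero => exact e
    | succ b ih => simp only [Function.iterate_succ_apply']; exact pd_eventuallyEq ih 1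
  induction a with
  | zero => exact h1
  | succ a ih => simp only [partials_succ_left]; exact pd_eventuallyEq ih 0

theorem partials_congr {f g : Base → ℝ} {p : Base} (e : f =ᶠ[𝓝 p] g) (a b : ℕ) :
    partials a b f p = partials a b g p := (partials_eventuallyEq e a b).self_of_nhds

/-- In `partials` the `x`-derivatives are outermost, so an inner `x`-derivative has to be carried
past each `y`-derivative by symmetry of second derivatives. -/
theorem pd_partials_zero (b : ℕ) {f : Base → ℝ} {p : Base} (hf : SmoothNear f p) :
    partials 0 b (pd 0 f) =ᶠ[𝓝 p] partials 1 b f := by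
  induction b generalizing f with
  | zero => rfl
  | succ b ih =>
    rw [← partials_pd_one, ← partials_pd_one]
    exact (partials_eventuallyEq (pd_comm_eventually hf) 0 b).trans (ih (hf.pd 1))

theorem partials_pd_zero_eventually (a b : ℕ) {f : Base → ℝ} {p : Base} (hf : SmoothNear f p) :
    partials a b (pd 0 f) =ᶠ[𝓝 p] partials (a + 1) b f := by
  induction a with
  | zero => exact pd_partials_zero b hf
  | succ a ih => rw [partials_succ_left, partials_succ_left]; exact pd_eventuallyEq ih 0

theorem partials_pd_zero (a b : ℕ) {f : Base → ℝ} {p : Base} (hf : SmoothNear f p) :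
    partials a b (pd 0 f) p = partials (a + 1) b f p :=
  (partials_pd_zero_eventually a b hf).self_of_nhds

/-- The recursive definition ranges over derivatives in every order; by symmetry the sorted ones
suffice. This links orders of vanishing to jet coordinates. -/
theorem vanishesAt_iff {n : ℕ} {f : Base → ℝ} {p : Base} (hf : SmoothNear f p) :
    VanishesAt n f p ↔ ∀ a b, a + b < n → partials a b f p = 0 := by
  induction n generalizing f with
  | zero => exact ⟨fun _ _ _ h => absurd h (by omega), fun _ => hf⟩
  | succ n ih =>
    constructor
    · rintro ⟨-, h0, h⟩ a b hab
      rcases a with _ | a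
      · rcases b with _ | b
        · exact h0
        · rw [← partials_pd_one]; exact (ih (hf.pd 1)).1 (h 1) 0 b (by omega)
      · rw [← partials_pd_zero a b hf]; exact (ih (hf.pd 0)).1 (h 0) a b (by omega)
    · intro h
      refine ⟨hf, h 0 0 (by omega), fun j => (ih (hf.pd j)).2 fun a b hab => ?_⟩
      fin_cases j
      · exact (partials_pd_zero a b hf).trans (h _ _ (by omega))
      · exact h a (b + 1) (by omega)

theorem VanishesAt.partials_eq {n : ℕ} {f : Base → ℝ} {p : Base} (hf : VanishesAt n f p) {a b : ℕ}
    (h : a + b < n) : partials a b f p = 0 := (vanishesAt_iff hf.smooth).1 hf a b h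

theorem VanishesAt.succ {n : ℕ} {f : Base → ℝ} {p : Base} (hf : VanishesAt n f p)
    (h : ∀ a b, a + b = n → partials a b f p = 0) : VanishesAt (n + 1) f p :=
  (vanishesAt_iff hf.smooth).2 fun a b hab => by
    rcases Nat.lt_or_ge (a + b) n with h' | h'
    · exact hf.partials_eq h'
    · exact h a b (by omega)

theorem partials_add {f g : Base → ℝ} {p : Base} (hf : SmoothNear f p) (hg : SmoothNear g p)
    (a b : ℕ) : partials a b (fun x => f x + g x) p = partials a b f p + partials a b g p := by
  have h1 : partials 0 b (fun x => f x + g x) =ᶠ[𝓝 p]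
      fun x => partials 0 b f x + partials 0 b g x := by
    induction b generalizing f g with
    | zero => rfl
    | succ b ih =>
      simp only [← partials_pd_one]
      refine (partials_eventuallyEq (g := fun x => pd 1 f x + pd 1 g x) ?_ 0 b).trans
        (ih (hf.pd 1) (hg.pd 1))
      filter_upwards [hf.eventually, hg.eventually] with x h1 h2 using pd_add h1 h2 1
  suffices partials a b (fun x => f x + g x) =ᶠ[𝓝 p]
      fun x => partials a b f x + partials a b g x from this.self_of_nhds
  induction a with
  | zero => exact h1
  | succ a ih =>
    simp only [partials_succ_left]
    refine (pd_eventuallyEq ih 0).trans ?_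
    filter_upwards [hf.eventually, hg.eventually] with x h1 h2
      using pd_add (partials_smooth h1 a b) (partials_smooth h2 a b) 0

theorem partials_const_mul {f : Base → ℝ} {p : Base} (hf : SmoothNear f p) (c : ℝ)
    (a b : ℕ) : partials a b (fun x => c * f x) p = c * partials a b f p := by
  have h1 : partials 0 b (fun x => c * f x) =ᶠ[𝓝 p] fun x => c * partials 0 b f x := by
    induction b generalizing f with
    | zero => rfl
    | succ b ih =>
      simp only [← partials_pd_one]
      refine (partials_eventuallyEq (g := fun x => c * pd 1 f x) ?_ 0 b).trans (ih (hf.pd 1))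
      filter_upwards [hf.eventually] with x h1 using pd_const_mul h1 c 1
  suffices partials a b (fun x => c * f x) =ᶠ[𝓝 p]
      fun x => c * partials a b f x from this.self_of_nhds
  induction a with
  | zero => exact h1
  | succ a ih =>
    simp only [partials_succ_left]
    refine (pd_eventuallyEq ih 0).trans ?_
    filter_upwards [hf.eventually] with x h1 using pd_const_mul (partials_smooth h1 a b) c 0

theorem partials_sub {f g : Base → ℝ} {p : Base} (hf : SmoothNear f p) (hg : SmoothNear g p)
    (a b : ℕ) : partials a b (fun x => f x - g x) p = partials a b f p - partials a b g p := by
  have h := partials_add hf ((SmoothNear.const (-1) p).mul hg) a b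
  rw [partials_const_mul hg] at h
  have e : (fun x => f x - g x) = fun x => f x + -1 * g x := by funext x; ring
  rw [e, h]; ring

theorem partials_sum {ι : Type*} {s : Finset ι} {f : ι → Base → ℝ} {p : Base}
    (hf : ∀ i ∈ s, SmoothNear (f i) p) (a b : ℕ) :
    partials a b (fun x => ∑ i ∈ s, f i x) p = ∑ i ∈ s, partials a b (f i) p := by
  classical
  induction s using Finset.induction_on with
  | empty => simpa using (VanishesAt.zero (a + b + 1) p).partials_eq (by omega)
  | insert i s hi ih =>
    simp only [Finset.sum_insert hi]
    rw [partials_add (hf i (by simp)) (.sum fun j hj => hf j (by simp [hj])),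
      ih fun j hj => hf j (by simp [hj])]

theorem VanishesAt.partials_eq_of_sub {n : ℕ} {f g : Base → ℝ} {p : Base} (hf : SmoothNear f p)
    (hg : SmoothNear g p) (h : VanishesAt n (fun x => f x - g x) p) {a b : ℕ} (hab : a + b < n) :
    partials a b f p = partials a b g p :=
  sub_eq_zero.1 <| by rw [← partials_sub hf hg]; exact h.partials_eq hab

theorem vanishesAt_sub {n : ℕ} {f g : Base → ℝ} {p : Base} (hf : SmoothNear f p)
    (hg : SmoothNear g p) (h : ∀ a b, a + b < n → partials a b f p = partials a b g p) :
    VanishesAt n (fun x => f x - g x) p :=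
  (vanishesAt_iff (hf.sub hg)).2 fun a b hab => by
    rw [partials_sub hf hg, h a b hab, sub_self]

/-! ### Monomials -/

/-- The monomial `(x¹)^a (x²)^b / (a! b!)`. -/
noncomputable def mono (a b : ℕ) (x : Base) : ℝ :=
  (x 0 ^ a / a.factorial) * (x 1 ^ b / b.factorial)

theorem mono_contDiff (a b : ℕ) : ContDiff ℝ ∞ (mono a b) := by
  unfold mono; fun_prop

theorem mono_smooth (a b : ℕ) (p : Base) : SmoothNear (mono a b) p := .of_contDiff (mono_contDiff a b) p

theorem hasFDerivAt_mono (a b : ℕ) (x : Base) : HasFDerivAt (mono a b)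
    ((x 1 ^ b / b.factorial * (a * x 0 ^ (a - 1) / a.factorial)) •
        (ContinuousLinearMap.proj 0 : Base →L[ℝ] ℝ)
      + (x 0 ^ a / a.factorial * (b * x 1 ^ (b - 1) / b.factorial)) •
        (ContinuousLinearMap.proj 1 : Base →L[ℝ] ℝ)) x := by
  have h (j : Fin 2) (n : ℕ) : HasFDerivAt (fun x : Base => x j ^ n / n.factorial)
      ((n * x j ^ (n - 1) / n.factorial) • (ContinuousLinearMap.proj j : Base →L[ℝ] ℝ)) x := by
    exact ((hasDerivAt_pow (𝕜 := ℝ) n (x j)).div_const (n.factorial : ℝ)).comp_hasFDerivAt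
      (h₂ := fun t : ℝ => t ^ n / n.factorial) (f := fun x : Base => x j) x
      (hasFDerivAt_apply (𝕜 := ℝ) j x)
  refine ((h 0 a).mul (h 1 b)).congr_fderiv ?_
  rw [smul_smul, smul_smul, add_comm]

theorem pd_zero_mono (a b : ℕ) : pd 0 (mono a b) = if a = 0 then fun _ => 0 else mono (a - 1) b := by
  funext x
  simp only [pd, (hasFDerivAt_mono a b x).fderiv]
  rcases a with _ | a
  · simp
  · have : (a.factorial : ℝ) ≠ 0 := by positivity
    simp [mono, Nat.factorial_succ, -mul_eq_mul_left_iff, -mul_eq_mul_right_iff]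
    field_simp

theorem pd_one_mono (a b : ℕ) : pd 1 (mono a b) = if b = 0 then fun _ => 0 else mono a (b - 1) := by
  funext x
  simp only [pd, (hasFDerivAt_mono a b x).fderiv]
  rcases b with _ | b
  · simp
  · have : (b.factorial : ℝ) ≠ 0 := by positivity
    simp [mono, Nat.factorial_succ, -mul_eq_mul_left_iff, -mul_eq_mul_right_iff]
    field_simp

theorem partials_zero_fun (a b : ℕ) (p : Base) : partials a b (fun _ => 0) p = 0 :=
  (VanishesAt.zero (a + b + 1) p).partials_eq (by omega)

/-- The divided monomials are dual to the partial derivatives at the origin, so Taylor coefficients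
can be prescribed freely. -/
theorem partials_mono (a b c d : ℕ) :
    partials a b (mono c d) 0 = if a = c ∧ b = d then 1 else 0 := by
  induction b generalizing d with
  | zero =>
    induction a generalizing c with
    | zero =>
      rcases c with _ | c <;> rcases d with _ | d <;> simp [partials, mono]
    | succ a ih =>
      rw [← partials_pd_zero _ _ (mono_smooth c d 0), pd_zero_mono]
      rcases c with _ | c
      · simp [partials_zero_fun]
      · simp [ih]
  | succ b ih =>
    rw [← partials_pd_one, pd_one_mono]
    rcases d with _ | d
    · simp [partials_zero_fun]
    · simp [ih]

/-! ### Pullback of sections along germs of maps -/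

/-- The coefficients which the change of variables `g` produces from the section `S`. -/
noncomputable def pullSection (S : Base → Fib) (g : Base → Base) : Base → Fib :=
  fun q => transformedCoeffs (S (g q)) g q

/-- The Jacobian determinant. -/
noncomputable def jac (g : Base → Base) (q : Base) : ℝ :=
  pd 0 (fun r => g r 0) q * pd 1 (fun r => g r 1) q
    - pd 1 (fun r => g r 0) q * pd 0 (fun r => g r 1) q

/-- `S` is a germ of a smooth section at `p`. -/
def SmoothSectionNear (S : Base → Fib) (p : Base) : Prop := ∀ i, SmoothNear (fun q => S q i) p

theorem SmoothSectionNear.of_contDiff {S : Base → Fib} (h : ContDiff ℝ ∞ S) (p : Base) :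
    SmoothSectionNear S p := fun i => .of_contDiff (contDiff_pi.1 h i) p

theorem SmoothSectionNear.congr {S T : Base → Fib} {p : Base} (h : SmoothSectionNear S p)
    (e : T =ᶠ[𝓝 p] S) : SmoothSectionNear T p := fun i => (h i).congr (e.fun_comp fun u => u i)

theorem SmoothSectionNear.eventually {S : Base → Fib} {p : Base} (h : SmoothSectionNear S p) :
    ∀ᶠ x in 𝓝 p, SmoothSectionNear S x := Filter.eventually_all.2 fun i => (h i).eventually

/-- The coefficients of the transformed equation as functions of the coefficients and the
derivatives of the change of variables. -/
noncomputable def coeffs (u : Fib) (a b c d a₁₁ a₁₂ a₂₂ c₁₁ c₁₂ c₂₂ : ℝ) : Fib :=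
  ![(u 0 * a ^ 3 + u 1 * a ^ 2 * c + u 2 * a * c ^ 2 + u 3 * c ^ 3
      - (a * c₁₁ - c * a₁₁)) / (a * d - b * c),
    (3 * u 0 * a ^ 2 * b + u 1 * (a ^ 2 * d + 2 * a * b * c)
      + u 2 * (b * c ^ 2 + 2 * a * c * d) + 3 * u 3 * c ^ 2 * d
      - (b * c₁₁ + 2 * a * c₁₂ - d * a₁₁ - 2 * c * a₁₂)) / (a * d - b * c),
    (3 * u 0 * a * b ^ 2 + u 1 * (b ^ 2 * c + 2 * a * b * d)
      + u 2 * (a * d ^ 2 + 2 * b * c * d) + 3 * u 3 * c * d ^ 2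
      - (a * c₂₂ + 2 * b * c₁₂ - c * a₂₂ - 2 * d * a₁₂)) / (a * d - b * c),
    (u 0 * b ^ 3 + u 1 * b ^ 2 * d + u 2 * b * d ^ 2 + u 3 * d ^ 3
      - (b * c₂₂ - d * a₂₂)) / (a * d - b * c)]

theorem pullSection_eq (S : Base → Fib) (g : Base → Base) (q : Base) :
    pullSection S g q = coeffs (S (g q)) (pd 0 (fun r => g r 0) q) (pd 1 (fun r => g r 0) q)
      (pd 0 (fun r => g r 1) q) (pd 1 (fun r => g r 1) q)
      (pd 0 (pd 0 (fun r => g r 0)) q) (pd 0 (pd 1 (fun r => g r 0)) q)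
      (pd 1 (pd 1 (fun r => g r 0)) q) (pd 0 (pd 0 (fun r => g r 1)) q)
      (pd 0 (pd 1 (fun r => g r 1)) q) (pd 1 (pd 1 (fun r => g r 1)) q) := rfl

theorem SmoothMapNear.jac {g : Base → Base} {q : Base} (h : SmoothMapNear g q) :
    SmoothNear (jac g) q :=
  (((h 0).pd 0).mul ((h 1).pd 1)).sub (((h 0).pd 1).mul ((h 1).pd 0))

theorem SmoothMapNear.eventually_jac_ne {g : Base → Base} {q : Base} (h : SmoothMapNear g q)
    (hj : CubicODE.jac g q ≠ 0) : ∀ᶠ x in 𝓝 q, CubicODE.jac g x ≠ 0 :=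
  h.jac.contDiffAt.continuousAt.eventually_ne hj

theorem SmoothSectionNear.pullSection {S : Base → Fib} {g : Base → Base} {q : Base}
    (hS : SmoothSectionNear S (g q)) (hg : SmoothMapNear g q) (hj : CubicODE.jac g q ≠ 0) :
    SmoothSectionNear (pullSection S g) q := by
  have hu (i : Fin 4) : SmoothNear (fun x => S (g x) i) q := (hS i).comp hg
  have h1 (i j : Fin 2) : SmoothNear (CubicODE.pd j (fun r => g r i)) q := (hg i).pd j
  have h2 (i j k : Fin 2) : SmoothNear (CubicODE.pd k (CubicODE.pd j (fun r => g r i))) q :=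
    (h1 i j).pd k
  intro i
  fin_cases i <;>
  · refine SmoothNear.div ?_ hg.jac hj
    repeat first
      | exact hu _ | exact h1 _ _ | exact h2 _ _ _ | exact SmoothNear.const _ _
      | with_reducible apply SmoothNear.sub | with_reducible apply SmoothNear.add
      | with_reducible apply SmoothNear.mul | with_reducible apply SmoothNear.pow

/-- The action of 2-jets of changes of variables on the fibre is compatible with composition: the
arguments on the right are those which the first and second order chain rules give for the
composite. -/
theorem coeffs_coeffs (u : Fib) (a b c d a₁₁ a₁₂ a₂₂ c₁₁ c₁₂ c₂₂ α β γ δ α₁₁ α₁₂ α₂₂ γ₁₁ γ₁₂ γ₂₂ : ℝ)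
    (h : a * d - b * c ≠ 0) :
    coeffs (coeffs u a b c d a₁₁ a₁₂ a₂₂ c₁₁ c₁₂ c₂₂) α β γ δ α₁₁ α₁₂ α₂₂ γ₁₁ γ₁₂ γ₂₂ =
    coeffs u (a * α + b * γ) (a * β + b * δ) (c * α + d * γ) (c * β + d * δ)
      ((a₁₁ * α + a₁₂ * γ) * α + a * α₁₁ + ((a₁₂ * α + a₂₂ * γ) * γ + b * γ₁₁))
      ((a₁₁ * α + a₁₂ * γ) * β + a * α₁₂ + ((a₁₂ * α + a₂₂ * γ) * δ + b * γ₁₂))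
      ((a₁₁ * β + a₁₂ * δ) * β + a * α₂₂ + ((a₁₂ * β + a₂₂ * δ) * δ + b * γ₂₂))
      ((c₁₁ * α + c₁₂ * γ) * α + c * α₁₁ + ((c₁₂ * α + c₂₂ * γ) * γ + d * γ₁₁))
      ((c₁₁ * α + c₁₂ * γ) * β + c * α₁₂ + ((c₁₂ * α + c₂₂ * γ) * δ + d * γ₁₂))
      ((c₁₁ * β + c₁₂ * δ) * β + c * α₂₂ + ((c₁₂ * β + c₂₂ * δ) * δ + d * γ₂₂)) := by
  have hd : (a * α + b * γ) * (c * β + d * δ) - (a * β + b * δ) * (c * α + d * γ)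
      = (a * d - b * c) * (α * δ - β * γ) := by ring
  funext i
  fin_cases i <;>
  · simp only [coeffs, Fin.zero_eta, Fin.mk_one, Fin.reduceFinMk, Matrix.cons_val, hd]
    generalize hD : a * d - b * c = D at h
    rw [← div_div]
    congr 1
    rw [eq_div_iff h]
    field_simp
    rw [← hD]
    ring

theorem pd_map_comp {g h : Base → Base} {q : Base} (hg : SmoothMapNear g (h q))
    (hh : SmoothMapNear h q) (i j : Fin 2) :
    pd j (fun r => g (h r) i) =ᶠ[𝓝 q] fun x => pd 0 (fun r => g r i) (h x) * pd j (fun r => h r 0) x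
      + pd 1 (fun r => g r i) (h x) * pd j (fun r => h r 1) x := by
  filter_upwards [hh.continuousAt.eventually hg.eventually, hh.eventually] with x h1 h2
    using pd_comp (h1 i) h2 j

theorem pd_pd_map_comp {g h : Base → Base} {q : Base} (hg : SmoothMapNear g (h q))
    (hh : SmoothMapNear h q) (i j k : Fin 2) :
    pd k (pd j (fun r => g (h r) i)) q =
      (pd 0 (pd 0 (fun r => g r i)) (h q) * pd k (fun r => h r 0) q
        + pd 1 (pd 0 (fun r => g r i)) (h q) * pd k (fun r => h r 1) q) * pd j (fun r => h r 0) q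
      + pd 0 (fun r => g r i) (h q) * pd k (pd j (fun r => h r 0)) q
      + ((pd 0 (pd 1 (fun r => g r i)) (h q) * pd k (fun r => h r 0) q
        + pd 1 (pd 1 (fun r => g r i)) (h q) * pd k (fun r => h r 1) q) * pd j (fun r => h r 1) q
      + pd 1 (fun r => g r i) (h q) * pd k (pd j (fun r => h r 1)) q) := by
  rw [pd_congr (pd_map_comp hg hh i j) k,
    pd_add ((((hg i).pd 0).comp hh).mul ((hh 0).pd j)) ((((hg i).pd 1).comp hh).mul ((hh 1).pd j)),
    pd_mul (((hg i).pd 0).comp hh) ((hh 0).pd j), pd_mul (((hg i).pd 1).comp hh) ((hh 1).pd j),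
    pd_comp ((hg i).pd 0) hh, pd_comp ((hg i).pd 1) hh]

theorem jac_comp {g h : Base → Base} {q : Base} (hg : SmoothMapNear g (h q))
    (hh : SmoothMapNear h q) : jac (fun x => g (h x)) q = jac g (h q) * jac h q := by
  simp only [jac, pd_comp (hg _) hh]
  ring

theorem pullSection_pullSection (S : Base → Fib) {g h : Base → Base} {q : Base}
    (hg : SmoothMapNear g (h q)) (hh : SmoothMapNear h q) (jg : jac g (h q) ≠ 0) :
    pullSection (pullSection S g) h q = pullSection S (fun x => g (h x)) q := by
  rw [pullSection_eq (pullSection S g), pullSection_eq S g, pullSection_eq S (fun x => g (h x)),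
    coeffs_coeffs _ _ _ _ _ _ _ _ _ _ _ _ _ _ _ _ _ _ _ _ _ jg]
  simp only [pd_pd_map_comp hg hh, pd_comp (hg _) hh, pd_comm (hg _)]

theorem pullSection_congr {S T : Base → Fib} {g : Base → Base} {q : Base}
    (hg : ContinuousAt g q) (e : S =ᶠ[𝓝 (g q)] T) : pullSection S g =ᶠ[𝓝 q] pullSection T g := by
  filter_upwards [hg.eventually e] with x hx
  simp only [pullSection, hx]

theorem pullSection_congr_map (S : Base → Fib) {g h : Base → Base} {q : Base}
    (e : g =ᶠ[𝓝 q] h) : pullSection S g =ᶠ[𝓝 q] pullSection S h := by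
  have e' (i : Fin 2) : (fun r => g r i) =ᶠ[𝓝 q] fun r => h r i := e.fun_comp fun y => y i
  have e1 (i j : Fin 2) := pd_eventuallyEq (e' i) j
  have e2 (i j k : Fin 2) := pd_eventuallyEq (e1 i j) k
  filter_upwards [e, Filter.eventually_all.2 fun i => Filter.eventually_all.2 (e1 i),
    Filter.eventually_all.2 fun i => Filter.eventually_all.2 fun j =>
      Filter.eventually_all.2 (e2 i j)] with x h0 h1 h2
  simp only [pullSection_eq, h0, h1, h2]

theorem pullSection_id (S : Base → Fib) (q : Base) : pullSection S (fun x => x) q = S q := by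
  rw [pullSection_eq]
  funext i
  fin_cases i <;> simp [coeffs, pd_coord, pd_const]

theorem jac_id (q : Base) : jac (fun x => x) q = 1 := by
  simp [jac, pd_coord]

/-! ### Equivalence of germs of sections under point transformations -/

/-- The germ of `T` at `q` is obtained from the germ of `S` at `p` by a smooth change of
variables. -/
def PointEquiv (S : Base → Fib) (p : Base) (T : Base → Fib) (q : Base) : Prop :=
  ∃ g : Base → Base, SmoothMapNear g q ∧ g q = p ∧ jac g q ≠ 0 ∧ T =ᶠ[𝓝 q] pullSection S g

namespace PointEquiv

theorem trans {S T U : Base → Fib} {p q r : Base} (h₁ : PointEquiv S p T q)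
    (h₂ : PointEquiv T q U r) : PointEquiv S p U r := by
  obtain ⟨g, hg, rfl, jg, eg⟩ := h₁
  obtain ⟨h, hh, rfl, jh, eh⟩ := h₂
  refine ⟨fun x => g (h x), hg.comp hh, rfl, by rw [jac_comp hg hh]; exact mul_ne_zero jg jh, ?_⟩
  refine (eh.trans (pullSection_congr hh.continuousAt eg)).trans ?_
  filter_upwards [hh.continuousAt.eventually hg.eventually, hh.eventually,
    hh.continuousAt.eventually (hg.eventually_jac_ne jg)] with x h1 h2 h3
    using pullSection_pullSection S h1 h2 h3

theorem smooth {S T : Base → Fib} {p q : Base} (h : PointEquiv S p T q)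
    (hS : SmoothSectionNear S p) : SmoothSectionNear T q := by
  obtain ⟨g, hg, rfl, jg, eg⟩ := h
  exact (hS.pullSection hg jg).congr eg

end PointEquiv

theorem fderiv_det_eq_jac {g : Base → Base} {q : Base} (hg : SmoothMapNear g q) :
    (fderiv ℝ g q).det = jac g q := by
  have hg' : HasFDerivAt g (ContinuousLinearMap.pi fun i => fderiv ℝ (fun x => g x i) q) q :=
    hasFDerivAt_pi.2 fun i => (hg i).differentiableAt.hasFDerivAt
  rw [hg'.fderiv, ContinuousLinearMap.det, ← LinearMap.det_toMatrix', Matrix.det_fin_two]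
  simp only [LinearMap.toMatrix'_apply]
  rfl

/-- The inverse function theorem: a germ of a smooth map with nonzero Jacobian is the inverse of a
point transformation. -/
theorem exists_pointTransformation {g : Base → Base} {q : Base} (hg : SmoothMapNear g q)
    (jg : jac g q ≠ 0) : ∃ f : PointTransformation, q ∈ f.toOPH.target ∧
      (f.toOPH.symm : Base → Base) =ᶠ[𝓝 q] g ∧ g q ∈ f.toOPH.source ∧ f.toOPH (g q) = q := by
  have inv {x : Base} (hx : SmoothMapNear g x) (jx : jac g x ≠ 0) :
      ∃ A : Base ≃L[ℝ] Base, HasFDerivAt g (A : Base →L[ℝ] Base) x := by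
    refine ⟨(fderiv ℝ g x).toContinuousLinearEquivOfDetNeZero (by rwa [fderiv_det_eq_jac hx]), ?_⟩
    rw [ContinuousLinearMap.coe_toContinuousLinearEquivOfDetNeZero]
    exact (differentiableAt_pi.2 fun i => (hx i).differentiableAt).hasFDerivAt
  have cd {x : Base} (hx : SmoothMapNear g x) : ContDiffAt ℝ ∞ g x :=
    contDiffAt_pi.2 fun i => (hx i).contDiffAt
  obtain ⟨A, hA⟩ := inv hg jg
  -- The local inverse must be smooth on the whole domain, not only at one point, so the source is
  -- cut down to a set where `g` is smooth with nonzero Jacobian.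
  obtain ⟨U, hU, hUo, hqU⟩ := eventually_nhds_iff.1 (hg.eventually.and (hg.eventually_jac_ne jg))
  let e := ((cd hg).toOpenPartialHomeomorph g hA (by simp)).restrOpen U hUo
  have he : (e : Base → Base) = g := rfl
  have hs {x : Base} (hx : x ∈ e.source) : SmoothMapNear g x ∧ jac g x ≠ 0 := hU x hx.2
  have hqs : q ∈ e.source := ⟨(cd hg).mem_toOpenPartialHomeomorph_source hA (by simp), hqU⟩
  refine ⟨⟨e.symm, fun y hy => ?_, fun x hx => ?_⟩, hqs, Filter.EventuallyEq.rfl,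
    e.map_source hqs, e.left_inv hqs⟩
  · have hy' : e.symm y ∈ e.source := e.map_target hy
    obtain ⟨B, hB⟩ := inv (hs hy').1 (hs hy').2
    exact (e.contDiffAt_symm hy hB (cd (hs hy').1)).contDiffWithinAt
  · exact (cd (hs hx).1).contDiffWithinAt

theorem PointTransformation.smoothMapNear_symm (f : PointTransformation) {q : Base}
    (hq : q ∈ f.toOPH.target) : SmoothMapNear f.toOPH.symm q := fun j => by
  filter_upwards [f.toOPH.open_target.mem_nhds hq] with x hx
  exact contDiffAt_pi.1 (f.smooth_symm.contDiffAt (f.toOPH.open_target.mem_nhds hx)) j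

theorem PointTransformation.smoothMapNear (f : PointTransformation) {p : Base}
    (hp : p ∈ f.toOPH.source) : SmoothMapNear f.toOPH p := fun j => by
  filter_upwards [f.toOPH.open_source.mem_nhds hp] with x hx
  exact contDiffAt_pi.1 (f.smooth.contDiffAt (f.toOPH.open_source.mem_nhds hx)) j

theorem jac_congr {g h : Base → Base} {q : Base} (e : g =ᶠ[𝓝 q] h) : jac g q = jac h q := by
  have e' (i : Fin 2) : (fun r => g r i) =ᶠ[𝓝 q] fun r => h r i := e.fun_comp fun y => y i
  simp only [jac, pd_congr (e' _)]

theorem PointTransformation.jac_symm_ne (f : PointTransformation) {q : Base}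
    (hq : q ∈ f.toOPH.target) : jac f.toOPH.symm q ≠ 0 := by
  have h := jac_comp (f.smoothMapNear (f.toOPH.map_target hq)) (f.smoothMapNear_symm hq)
  have e : (fun x => f.toOPH (f.toOPH.symm x)) =ᶠ[𝓝 q] fun x => x := by
    filter_upwards [f.toOPH.open_target.mem_nhds hq] with x hx using f.toOPH.right_inv hx
  rw [jac_congr e, jac_id] at h
  exact right_ne_zero_of_mul (h ▸ one_ne_zero)

theorem PointTransformation.jac_ne (f : PointTransformation) {p : Base}
    (hp : p ∈ f.toOPH.source) : jac f.toOPH p ≠ 0 :=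
  PointTransformation.jac_symm_ne ⟨f.toOPH.symm, f.smooth_symm, f.smooth⟩ (q := p) hp

theorem pointEquiv_pushSection (f : PointTransformation) (S : Base → Fib) {p : Base}
    (hp : p ∈ f.toOPH.source) : PointEquiv S p (pushSection f S) (f.toOPH p) :=
  ⟨f.toOPH.symm, f.smoothMapNear_symm (f.toOPH.map_source hp), f.toOPH.left_inv hp,
    f.jac_symm_ne (f.toOPH.map_source hp), Filter.EventuallyEq.rfl⟩

namespace PointEquiv

theorem exists_pushSection {S T : Base → Fib} {p q : Base} (h : PointEquiv S p T q) :
    ∃ f : PointTransformation, p ∈ f.toOPH.source ∧ f.toOPH p = q ∧ T =ᶠ[𝓝 q] pushSection f S := by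
  obtain ⟨g, hg, rfl, jg, eg⟩ := h
  obtain ⟨f, -, e, hs, hf⟩ := exists_pointTransformation hg jg
  exact ⟨f, hs, hf, eg.trans (pullSection_congr_map S e.symm)⟩

/-- Once the germ is realized by an invertible point transformation, pulling back along its forward
map undoes the pullback along its inverse. -/
theorem symm {S T : Base → Fib} {p q : Base} (h : PointEquiv S p T q) : PointEquiv T q S p := by
  obtain ⟨f, hp, rfl, e⟩ := h.exists_pushSection
  refine ⟨f.toOPH, f.smoothMapNear hp, rfl, f.jac_ne hp, ?_⟩
  have h1 := pullSection_congr (f.smoothMapNear hp).continuousAt e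
  refine (h1.trans ?_).symm
  filter_upwards [f.toOPH.open_source.mem_nhds hp] with x hx
  have hx' := f.toOPH.map_source hx
  have hl : (fun y => f.toOPH.symm (f.toOPH y)) =ᶠ[𝓝 x] fun y => y := by
    filter_upwards [f.toOPH.open_source.mem_nhds hx] with y hy using f.toOPH.left_inv hy
  have := pullSection_pullSection S (f.smoothMapNear_symm hx') (f.smoothMapNear hx)
    (f.jac_symm_ne hx')
  refine this.trans ?_
  rw [(pullSection_congr_map S hl).self_of_nhds, pullSection_id]

end PointEquiv

/-! ### Second order jets of functions -/

theorem pd_one_partials (a b : ℕ) {f : Base → ℝ} {p : Base} (hf : SmoothNear f p) :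
    pd 1 (partials a b f) =ᶠ[𝓝 p] partials a (b + 1) f := by
  induction a with
  | zero =>
    simp only [partials, Function.iterate_zero, id, Function.iterate_succ_apply']
    rfl
  | succ a ih =>
    rw [partials_succ_left, partials_succ_left]
    exact (pd_comm_eventually (partials_smooth hf a b)).trans (pd_eventuallyEq ih 0)

/-- Values of a function and of its first and second partial derivatives at a point. -/
structure TwoJet where
  v : ℝ
  x : ℝ
  y : ℝ
  xx : ℝ
  xy : ℝ
  yy : ℝ

/-- The germ of the smooth function `f` at `p` has the second order jet `j`. -/
structure HasTwoJet (f : Base → ℝ) (p : Base) (j : TwoJet) : Prop where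
  smooth : SmoothNear f p
  v : f p = j.v
  x : pd 0 f p = j.x
  y : pd 1 f p = j.y
  xx : pd 0 (pd 0 f) p = j.xx
  xy : pd 0 (pd 1 f) p = j.xy
  yy : pd 1 (pd 1 f) p = j.yy

namespace TwoJet

/-- The jet of a sum. -/
def add (j k : TwoJet) : TwoJet :=
  ⟨j.v + k.v, j.x + k.x, j.y + k.y, j.xx + k.xx, j.xy + k.xy, j.yy + k.yy⟩

/-- The jet of a difference. -/
def sub (j k : TwoJet) : TwoJet :=
  ⟨j.v - k.v, j.x - k.x, j.y - k.y, j.xx - k.xx, j.xy - k.xy, j.yy - k.yy⟩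

/-- The jet of a product. -/
def mul (j k : TwoJet) : TwoJet :=
  ⟨j.v * k.v, j.x * k.v + j.v * k.x, j.y * k.v + j.v * k.y,
    j.xx * k.v + 2 * j.x * k.x + j.v * k.xx,
    j.xy * k.v + j.y * k.x + j.x * k.y + j.v * k.xy,
    j.yy * k.v + 2 * j.y * k.y + j.v * k.yy⟩

/-- The jet of a constant. -/
def const (c : ℝ) : TwoJet := ⟨c, 0, 0, 0, 0, 0⟩

/-- The jet of a composition of a function with jet `j` with a map whose components have the jets
`k` and `l`. -/
def comp (j k l : TwoJet) : TwoJet :=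
  ⟨j.v, j.x * k.x + j.y * l.x, j.x * k.y + j.y * l.y,
    (j.xx * k.x + j.xy * l.x) * k.x + j.x * k.xx + ((j.xy * k.x + j.yy * l.x) * l.x + j.y * l.xx),
    (j.xx * k.x + j.xy * l.x) * k.y + j.x * k.xy + ((j.xy * k.x + j.yy * l.x) * l.y + j.y * l.xy),
    (j.xx * k.y + j.xy * l.y) * k.y + j.x * k.yy + ((j.xy * k.y + j.yy * l.y) * l.y + j.y * l.yy)⟩

/-- The jet of a quotient with a denominator whose value is `1`. -/
def div (n d : TwoJet) : TwoJet :=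
  ⟨n.v, n.x - n.v * d.x, n.y - n.v * d.y,
    n.xx - 2 * (n.x - n.v * d.x) * d.x - n.v * d.xx,
    n.xy - (n.x - n.v * d.x) * d.y - (n.y - n.v * d.y) * d.x - n.v * d.xy,
    n.yy - 2 * (n.y - n.v * d.y) * d.y - n.v * d.yy⟩

end TwoJet

namespace HasTwoJet

theorem const (c : ℝ) (p : Base) : HasTwoJet (fun _ => c) p (.const c) := by
  constructor <;> simp [pd_const, TwoJet.const, SmoothNear.const]

theorem congr {f g : Base → ℝ} {p : Base} {j : TwoJet} (h : HasTwoJet f p j) (e : g =ᶠ[𝓝 p] f) :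
    HasTwoJet g p j :=
  ⟨h.smooth.congr e, e.self_of_nhds.trans h.v, (pd_congr e 0).trans h.x, (pd_congr e 1).trans h.y,
    (pd_congr (pd_eventuallyEq e 0) 0).trans h.xx, (pd_congr (pd_eventuallyEq e 1) 0).trans h.xy,
    (pd_congr (pd_eventuallyEq e 1) 1).trans h.yy⟩

theorem add {f g : Base → ℝ} {p : Base} {j k : TwoJet} (hf : HasTwoJet f p j)
    (hg : HasTwoJet g p k) : HasTwoJet (fun x => f x + g x) p (j.add k) := by
  have h1 (i : Fin 2) : pd i (fun x => f x + g x) =ᶠ[𝓝 p] fun x => pd i f x + pd i g x := by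
    filter_upwards [hf.smooth.eventually, hg.smooth.eventually] with x h1 h2 using pd_add h1 h2 i
  have h2 (i i' : Fin 2) : pd i (pd i' (fun x => f x + g x)) p
      = pd i (pd i' f) p + pd i (pd i' g) p :=
    (pd_congr (h1 i') i).trans (pd_add (hf.smooth.pd i') (hg.smooth.pd i') i)
  constructor <;>
    simp only [h2, (h1 _).self_of_nhds, hf.v, hf.x, hf.y, hf.xx, hf.xy, hf.yy, hg.v, hg.x, hg.y,
      hg.xx, hg.xy, hg.yy, TwoJet.add, hf.smooth.add hg.smooth]

theorem sub {f g : Base → ℝ} {p : Base} {j k : TwoJet} (hf : HasTwoJet f p j)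
    (hg : HasTwoJet g p k) : HasTwoJet (fun x => f x - g x) p (j.sub k) := by
  have h1 (i : Fin 2) : pd i (fun x => f x - g x) =ᶠ[𝓝 p] fun x => pd i f x - pd i g x := by
    filter_upwards [hf.smooth.eventually, hg.smooth.eventually] with x h1 h2 using pd_sub h1 h2 i
  have h2 (i i' : Fin 2) : pd i (pd i' (fun x => f x - g x)) p
      = pd i (pd i' f) p - pd i (pd i' g) p :=
    (pd_congr (h1 i') i).trans (pd_sub (hf.smooth.pd i') (hg.smooth.pd i') i)
  constructor <;>
    simp only [h2, (h1 _).self_of_nhds, hf.v, hf.x, hf.y, hf.xx, hf.xy, hf.yy, hg.v, hg.x, hg.y,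
      hg.xx, hg.xy, hg.yy, TwoJet.sub, hf.smooth.sub hg.smooth]

theorem mul {f g : Base → ℝ} {p : Base} {j k : TwoJet} (hf : HasTwoJet f p j)
    (hg : HasTwoJet g p k) : HasTwoJet (fun x => f x * g x) p (j.mul k) := by
  have h1 (i : Fin 2) : pd i (fun x => f x * g x) =ᶠ[𝓝 p] fun x => pd i f x * g x + f x * pd i g x := by
    filter_upwards [hf.smooth.eventually, hg.smooth.eventually] with x h1 h2 using pd_mul h1 h2 i
  have h2 (i i' : Fin 2) : pd i (pd i' (fun x => f x * g x)) p
      = pd i (pd i' f) p * g p + pd i' f p * pd i g p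
        + (pd i f p * pd i' g p + f p * pd i (pd i' g) p) := by
    rw [pd_congr (h1 i') i, pd_add ((hf.smooth.pd i').mul hg.smooth) (hf.smooth.mul (hg.smooth.pd i')),
      pd_mul (hf.smooth.pd i') hg.smooth, pd_mul hf.smooth (hg.smooth.pd i')]
  constructor
  · exact hf.smooth.mul hg.smooth
  all_goals
    simp only [h2, (h1 _).self_of_nhds, hf.v, hf.x, hf.y, hf.xx, hf.xy, hf.yy, hg.v, hg.x, hg.y,
      hg.xx, hg.xy, hg.yy, TwoJet.mul]
  all_goals ring

theorem comp {f : Base → ℝ} {g : Base → Base} {p : Base} {j k l : TwoJet}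
    (hf : HasTwoJet f (g p) j) (hg : HasTwoJet (fun x => g x 0) p k)
    (hg' : HasTwoJet (fun x => g x 1) p l) : HasTwoJet (fun x => f (g x)) p (j.comp k l) := by
  have hgs : SmoothMapNear g p := fun i => by fin_cases i; exacts [hg.smooth, hg'.smooth]
  have h1 (i : Fin 2) : pd i (fun x => f (g x)) =ᶠ[𝓝 p] fun x =>
      pd 0 f (g x) * pd i (fun x => g x 0) x + pd 1 f (g x) * pd i (fun x => g x 1) x := by
    filter_upwards [hgs.continuousAt.eventually hf.smooth.eventually, hgs.eventually] with x h1 h2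
      using pd_comp h1 h2 i
  have c (i' : Fin 2) : SmoothNear (fun x => pd i' f (g x)) p := (hf.smooth.pd i').comp hgs
  have h2 (i i' : Fin 2) : pd i (pd i' (fun x => f (g x))) p
      = (pd 0 (pd 0 f) (g p) * pd i (fun x => g x 0) p + pd 0 (pd 1 f) (g p) * pd i (fun x => g x 1) p)
          * pd i' (fun x => g x 0) p + pd 0 f (g p) * pd i (pd i' (fun x => g x 0)) p
        + ((pd 0 (pd 1 f) (g p) * pd i (fun x => g x 0) p
            + pd 1 (pd 1 f) (g p) * pd i (fun x => g x 1) p) * pd i' (fun x => g x 1) p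
          + pd 1 f (g p) * pd i (pd i' (fun x => g x 1)) p) := by
    rw [pd_congr (h1 i') i, pd_add ((c 0).mul ((hgs 0).pd i')) ((c 1).mul ((hgs 1).pd i')),
      pd_mul (c 0) ((hgs 0).pd i'), pd_mul (c 1) ((hgs 1).pd i'), pd_comp (hf.smooth.pd 0) hgs,
      pd_comp (hf.smooth.pd 1) hgs, pd_comm hf.smooth]
  constructor
  · exact hf.smooth.comp hgs
  all_goals
    simp only [h2, (h1 _).self_of_nhds, hf.v, hf.x, hf.y, hf.xx, hf.xy, hf.yy, hg.x, hg.y,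
      hg.xx, hg.xy, hg.yy, hg'.x, hg'.y, hg'.xx, hg'.xy, hg'.yy, TwoJet.comp]

theorem self {f : Base → ℝ} {p : Base} (hf : SmoothNear f p) :
    HasTwoJet f p ⟨f p, pd 0 f p, pd 1 f p, pd 0 (pd 0 f) p, pd 0 (pd 1 f) p, pd 1 (pd 1 f) p⟩ :=
  ⟨hf, rfl, rfl, rfl, rfl, rfl, rfl⟩

theorem partials {f : Base → ℝ} {p : Base} (hf : SmoothNear f p) (a b : ℕ) :
    HasTwoJet (CubicODE.partials a b f) p
      ⟨CubicODE.partials a b f p, CubicODE.partials (a + 1) b f p, CubicODE.partials a (b + 1) f p,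
        CubicODE.partials (a + 2) b f p, CubicODE.partials (a + 1) (b + 1) f p,
        CubicODE.partials a (b + 2) f p⟩ := by
  have h1 (a b : ℕ) := pd_one_partials a b hf
  refine ⟨partials_smooth hf a b, rfl, ?_, (h1 a b).self_of_nhds, ?_, ?_, ?_⟩
  · exact (congrFun (partials_succ_left a b f) p).symm
  · simp only [partials_succ_left]
  · rw [pd_congr (h1 a b) 0, ← partials_succ_left]
  · rw [pd_congr (h1 a b) 1, (h1 a (b + 1)).self_of_nhds]

/-- The quotient `w` satisfies `f = w g`; the product rule gives a triangular system for the jet of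
`w`, solved without division because `g` has value one. -/
theorem div {f g : Base → ℝ} {p : Base} {j k : TwoJet} (hf : HasTwoJet f p j)
    (hg : HasTwoJet g p k) (h1 : k.v = 1) : HasTwoJet (fun x => f x / g x) p (j.div k) := by
  have h0 : g p ≠ 0 := by rw [hg.v, h1]; exact one_ne_zero
  have hs := hf.smooth.div hg.smooth h0
  obtain ⟨w, hw⟩ : ∃ w : Base → ℝ, w = fun x => f x / g x := ⟨_, rfl⟩
  have e : f =ᶠ[𝓝 p] fun x => w x * g x := by
    filter_upwards [hg.smooth.contDiffAt.continuousAt.eventually_ne h0] with x hx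
    rw [hw]
    field_simp
  rw [← hw] at hs ⊢
  obtain ⟨-, ev, ex, ey, exx, exy, eyy⟩ := ((self hs).mul hg).congr e
  rw [hf.v] at ev
  rw [hf.x] at ex
  rw [hf.y] at ey
  rw [hf.xx] at exx
  rw [hf.xy] at exy
  rw [hf.yy] at eyy
  simp only [TwoJet.mul, h1, mul_one] at ev ex ey exx exy eyy
  refine ⟨hs, ?_, ?_, ?_, ?_, ?_, ?_⟩ <;> simp only [TwoJet.div, ev, ex, ey, exx, exy, eyy] <;> ring

end HasTwoJet

/-! ### Transformation of the relative invariants -/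

/-- The expression of `F1` in terms of the second order jets of the components of a section. -/
def F1Jet (j : Fin 4 → TwoJet) : ℝ :=
  3 * (j 0).yy - 2 * (j 1).xy + (j 2).xx
    + 3 * (j 3).v * (j 0).x - 3 * (j 2).v * (j 0).y + 2 * (j 1).v * (j 1).y
    - (j 1).v * (j 2).x - 3 * (j 0).v * (j 2).y + 6 * (j 0).v * (j 3).x

/-- The expression of `F2` in terms of the second order jets of the components of a section. -/
def F2Jet (j : Fin 4 → TwoJet) : ℝ :=
  (j 1).yy - 2 * (j 2).xy + 3 * (j 3).xx
    - 3 * (j 0).v * (j 3).y + 3 * (j 1).v * (j 3).x - 2 * (j 2).v * (j 2).x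
    + (j 2).v * (j 1).y + 3 * (j 3).v * (j 1).x - 6 * (j 3).v * (j 0).y

theorem F1_eq_of_hasTwoJet {S : Base → Fib} {p : Base} {j : Fin 4 → TwoJet}
    (h : ∀ i, HasTwoJet (fun x => S x i) p (j i)) : F1 S p = F1Jet j := by
  simp only [F1, F1Jet, (h _).v, (h _).x, (h _).y, (h _).xx, (h _).xy, (h _).yy]

theorem F2_eq_of_hasTwoJet {S : Base → Fib} {p : Base} {j : Fin 4 → TwoJet}
    (h : ∀ i, HasTwoJet (fun x => S x i) p (j i)) : F2 S p = F2Jet j := by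
  simp only [F2, F2Jet, (h _).v, (h _).x, (h _).y, (h _).xx, (h _).xy, (h _).yy]

/-- The two-jets of the transformed coefficients for a change of variables whose derivative is the
identity at the point under consideration. -/
def coeffsJet (u : Fin 4 → TwoJet) (a b c d a₁₁ a₁₂ a₂₂ c₁₁ c₁₂ c₂₂ : TwoJet) : Fin 4 → TwoJet :=
  let D := (a.mul d).sub (b.mul c)
  let t (n : ℝ) := TwoJet.const n
  ![((((((u 0).mul (a.mul (a.mul a))).add ((u 1).mul ((a.mul a).mul c))).add
        ((u 2).mul (a.mul (c.mul c)))).add ((u 3).mul (c.mul (c.mul c)))).sub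
        ((a.mul c₁₁).sub (c.mul a₁₁))).div D,
    ((((((t 3).mul ((u 0).mul ((a.mul a).mul b))).add
        ((u 1).mul (((a.mul a).mul d).add ((t 2).mul (a.mul (b.mul c)))))).add
        ((u 2).mul ((b.mul (c.mul c)).add ((t 2).mul (a.mul (c.mul d)))))).add
        ((t 3).mul ((u 3).mul ((c.mul c).mul d)))).sub
        ((((b.mul c₁₁).add ((t 2).mul (a.mul c₁₂))).sub (d.mul a₁₁)).sub
          ((t 2).mul (c.mul a₁₂)))).div D,
    ((((((t 3).mul ((u 0).mul (a.mul (b.mul b)))).add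
        ((u 1).mul (((b.mul b).mul c).add ((t 2).mul (a.mul (b.mul d)))))).add
        ((u 2).mul ((a.mul (d.mul d)).add ((t 2).mul (b.mul (c.mul d)))))).add
        ((t 3).mul ((u 3).mul (c.mul (d.mul d))))).sub
        ((((a.mul c₂₂).add ((t 2).mul (b.mul c₁₂))).sub (c.mul a₂₂)).sub
          ((t 2).mul (d.mul a₁₂)))).div D,
    ((((((u 0).mul (b.mul (b.mul b))).add ((u 1).mul ((b.mul b).mul d))).add
        ((u 2).mul (b.mul (d.mul d)))).add ((u 3).mul (d.mul (d.mul d)))).sub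
        ((b.mul c₂₂).sub (d.mul a₂₂))).div D]

theorem hasTwoJet_coeffs {u : Base → Fib} {a b c d a₁₁ a₁₂ a₂₂ c₁₁ c₁₂ c₂₂ : Base → ℝ} {p : Base}
    {U : Fin 4 → TwoJet} {A B C D A₁₁ A₁₂ A₂₂ C₁₁ C₁₂ C₂₂ : TwoJet}
    (hu : ∀ i, HasTwoJet (fun x => u x i) p (U i)) (ha : HasTwoJet a p A) (hb : HasTwoJet b p B)
    (hc : HasTwoJet c p C) (hd : HasTwoJet d p D) (ha₁₁ : HasTwoJet a₁₁ p A₁₁)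
    (ha₁₂ : HasTwoJet a₁₂ p A₁₂) (ha₂₂ : HasTwoJet a₂₂ p A₂₂) (hc₁₁ : HasTwoJet c₁₁ p C₁₁)
    (hc₁₂ : HasTwoJet c₁₂ p C₁₂) (hc₂₂ : HasTwoJet c₂₂ p C₂₂) (h1 : A.v * D.v - B.v * C.v = 1)
    (i : Fin 4) :
    HasTwoJet (fun x => coeffs (u x) (a x) (b x) (c x) (d x) (a₁₁ x) (a₁₂ x) (a₂₂ x) (c₁₁ x)
      (c₁₂ x) (c₂₂ x) i) p (coeffsJet U A B C D A₁₁ A₁₂ A₂₂ C₁₁ C₁₂ C₂₂ i) := by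
  have hD := (ha.mul hd).sub (hb.mul hc)
  fin_cases i
  · refine HasTwoJet.congr (HasTwoJet.div ((((((hu 0).mul (ha.mul (ha.mul ha))).add
      ((hu 1).mul ((ha.mul ha).mul hc))).add ((hu 2).mul (ha.mul (hc.mul hc)))).add
      ((hu 3).mul (hc.mul (hc.mul hc)))).sub ((ha.mul hc₁₁).sub (hc.mul ha₁₁))) hD h1)
      (.of_forall fun x => ?_)
    simp only [coeffs, Fin.zero_eta, Matrix.cons_val]
    ring
  · refine HasTwoJet.congr (HasTwoJet.div ((((((HasTwoJet.const 3 p).mul ((hu 0).mul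
      ((ha.mul ha).mul hb))).add ((hu 1).mul (((ha.mul ha).mul hd).add
      ((HasTwoJet.const 2 p).mul (ha.mul (hb.mul hc)))))).add
      ((hu 2).mul ((hb.mul (hc.mul hc)).add ((HasTwoJet.const 2 p).mul (ha.mul (hc.mul hd)))))).add
      ((HasTwoJet.const 3 p).mul ((hu 3).mul ((hc.mul hc).mul hd)))).sub
      ((((hb.mul hc₁₁).add ((HasTwoJet.const 2 p).mul (ha.mul hc₁₂))).sub (hd.mul ha₁₁)).sub
      ((HasTwoJet.const 2 p).mul (hc.mul ha₁₂)))) hD h1) (.of_forall fun x => ?_)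
    simp only [coeffs, Fin.mk_one, Matrix.cons_val]
    ring
  · refine HasTwoJet.congr (HasTwoJet.div ((((((HasTwoJet.const 3 p).mul ((hu 0).mul
      (ha.mul (hb.mul hb)))).add ((hu 1).mul (((hb.mul hb).mul hc).add
      ((HasTwoJet.const 2 p).mul (ha.mul (hb.mul hd)))))).add
      ((hu 2).mul ((ha.mul (hd.mul hd)).add ((HasTwoJet.const 2 p).mul (hb.mul (hc.mul hd)))))).add
      ((HasTwoJet.const 3 p).mul ((hu 3).mul (hc.mul (hd.mul hd))))).sub
      ((((ha.mul hc₂₂).add ((HasTwoJet.const 2 p).mul (hb.mul hc₁₂))).sub (hc.mul ha₂₂)).sub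
      ((HasTwoJet.const 2 p).mul (hd.mul ha₁₂)))) hD h1) (.of_forall fun x => ?_)
    simp only [coeffs, Fin.reduceFinMk, Matrix.cons_val]
    ring
  · refine HasTwoJet.congr (HasTwoJet.div ((((((hu 0).mul (hb.mul (hb.mul hb))).add
      ((hu 1).mul ((hb.mul hb).mul hd))).add ((hu 2).mul (hb.mul (hd.mul hd)))).add
      ((hu 3).mul (hd.mul (hd.mul hd)))).sub ((hb.mul hc₂₂).sub (hd.mul ha₂₂))) hD h1)
      (.of_forall fun x => ?_)
    simp only [coeffs, Fin.reduceFinMk, Matrix.cons_val]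
    ring

section identityDerivative

variable {S : Base → Fib} {g : Base → Base} {q : Base}

/-- `F1` and `F2` need the 2-jet of the pullback, which involves derivatives of `g` up to order
four. With unit Jacobian at `q` everything is polynomial, so their transformation can be verified by
algebra. -/
theorem hasTwoJet_pullSection (hS : SmoothSectionNear S (g q)) (hg : SmoothMapNear g q)
    (h1 : partials 1 0 (fun r => g r 0) q * partials 0 1 (fun r => g r 1) q
      - partials 0 1 (fun r => g r 0) q * partials 1 0 (fun r => g r 1) q = 1) :
    ∀ i, HasTwoJet (fun x => pullSection S g x i) q
      (coeffsJet (fun i => TwoJet.comp ⟨S (g q) i, pd 0 (fun x => S x i) (g q),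
          pd 1 (fun x => S x i) (g q), pd 0 (pd 0 (fun x => S x i)) (g q),
          pd 0 (pd 1 (fun x => S x i)) (g q), pd 1 (pd 1 (fun x => S x i)) (g q)⟩
          ⟨partials 0 0 (fun r => g r 0) q, partials 1 0 (fun r => g r 0) q,
            partials 0 1 (fun r => g r 0) q, partials 2 0 (fun r => g r 0) q,
            partials 1 1 (fun r => g r 0) q, partials 0 2 (fun r => g r 0) q⟩
          ⟨partials 0 0 (fun r => g r 1) q, partials 1 0 (fun r => g r 1) q,
            partials 0 1 (fun r => g r 1) q, partials 2 0 (fun r => g r 1) q,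
            partials 1 1 (fun r => g r 1) q, partials 0 2 (fun r => g r 1) q⟩)
        ⟨partials 1 0 (fun r => g r 0) q, partials 2 0 (fun r => g r 0) q,
          partials 1 1 (fun r => g r 0) q, partials 3 0 (fun r => g r 0) q,
          partials 2 1 (fun r => g r 0) q, partials 1 2 (fun r => g r 0) q⟩
        ⟨partials 0 1 (fun r => g r 0) q, partials 1 1 (fun r => g r 0) q,
          partials 0 2 (fun r => g r 0) q, partials 2 1 (fun r => g r 0) q,
          partials 1 2 (fun r => g r 0) q, partials 0 3 (fun r => g r 0) q⟩
        ⟨partials 1 0 (fun r => g r 1) q, partials 2 0 (fun r => g r 1) q,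
          partials 1 1 (fun r => g r 1) q, partials 3 0 (fun r => g r 1) q,
          partials 2 1 (fun r => g r 1) q, partials 1 2 (fun r => g r 1) q⟩
        ⟨partials 0 1 (fun r => g r 1) q, partials 1 1 (fun r => g r 1) q,
          partials 0 2 (fun r => g r 1) q, partials 2 1 (fun r => g r 1) q,
          partials 1 2 (fun r => g r 1) q, partials 0 3 (fun r => g r 1) q⟩
        ⟨partials 2 0 (fun r => g r 0) q, partials 3 0 (fun r => g r 0) q,
          partials 2 1 (fun r => g r 0) q, partials 4 0 (fun r => g r 0) q,
          partials 3 1 (fun r => g r 0) q, partials 2 2 (fun r => g r 0) q⟩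
        ⟨partials 1 1 (fun r => g r 0) q, partials 2 1 (fun r => g r 0) q,
          partials 1 2 (fun r => g r 0) q, partials 3 1 (fun r => g r 0) q,
          partials 2 2 (fun r => g r 0) q, partials 1 3 (fun r => g r 0) q⟩
        ⟨partials 0 2 (fun r => g r 0) q, partials 1 2 (fun r => g r 0) q,
          partials 0 3 (fun r => g r 0) q, partials 2 2 (fun r => g r 0) q,
          partials 1 3 (fun r => g r 0) q, partials 0 4 (fun r => g r 0) q⟩
        ⟨partials 2 0 (fun r => g r 1) q, partials 3 0 (fun r => g r 1) q,
          partials 2 1 (fun r => g r 1) q, partials 4 0 (fun r => g r 1) q,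
          partials 3 1 (fun r => g r 1) q, partials 2 2 (fun r => g r 1) q⟩
        ⟨partials 1 1 (fun r => g r 1) q, partials 2 1 (fun r => g r 1) q,
          partials 1 2 (fun r => g r 1) q, partials 3 1 (fun r => g r 1) q,
          partials 2 2 (fun r => g r 1) q, partials 1 3 (fun r => g r 1) q⟩
        ⟨partials 0 2 (fun r => g r 1) q, partials 1 2 (fun r => g r 1) q,
          partials 0 3 (fun r => g r 1) q, partials 2 2 (fun r => g r 1) q,
          partials 1 3 (fun r => g r 1) q, partials 0 4 (fun r => g r 1) q⟩ i) :=
  hasTwoJet_coeffs (u := fun x => S (g x))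
    (fun i => HasTwoJet.comp (.self (hS i)) (.partials (hg 0) 0 0) (.partials (hg 1) 0 0))
    (.partials (hg 0) 1 0) (.partials (hg 0) 0 1) (.partials (hg 1) 1 0) (.partials (hg 1) 0 1)
    (.partials (hg 0) 2 0) (.partials (hg 0) 1 1) (.partials (hg 0) 0 2) (.partials (hg 1) 2 0)
    (.partials (hg 1) 1 1) (.partials (hg 1) 0 2) h1

/-- All derivatives of `g` of orders two to four cancel: this is the reason why `F1` and `F2` depend
tensorially on the section. -/
theorem F_pullSection_of_unipotent (hS : SmoothSectionNear S (g q)) (hg : SmoothMapNear g q)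
    (ha : partials 1 0 (fun r => g r 0) q = 1) (hb : partials 0 1 (fun r => g r 0) q = 0)
    (hc : partials 1 0 (fun r => g r 1) q = 0) (hd : partials 0 1 (fun r => g r 1) q = 1) :
    F1 (pullSection S g) q = F1 S (g q) ∧ F2 (pullSection S g) q = F2 S (g q) := by
  have h := hasTwoJet_pullSection hS hg (by rw [ha, hb, hc, hd]; norm_num)
  rw [F1_eq_of_hasTwoJet h, F2_eq_of_hasTwoJet h]
  simp only [ha, hb, hc, hd]
  constructor
  · simp only [F1Jet, coeffsJet, TwoJet.comp, TwoJet.mul, TwoJet.add, TwoJet.sub, TwoJet.div,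
      TwoJet.const, Matrix.cons_val, F1, mul_zero, zero_mul, add_zero, zero_add, mul_one, one_mul, sub_zero,
      zero_sub]
    ring
  · simp only [F2Jet, coeffsJet, TwoJet.comp, TwoJet.mul, TwoJet.add, TwoJet.sub, TwoJet.div,
      TwoJet.const, Matrix.cons_val, F2, mul_zero, zero_mul, add_zero, zero_add, mul_one, one_mul, sub_zero,
      zero_sub]
    ring

end identityDerivative

/-! ### Affine changes of variables and the general law for `F1` and `F2`. -/

/-- The affine map with value `p` at `q` and with the linear part `(a, b; c, d)`. -/
noncomputable def affineMap (p q : Base) (a b c d : ℝ) (x : Base) : Base :=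
  ![p 0 + (a * (x 0 - q 0) + b * (x 1 - q 1)), p 1 + (c * (x 0 - q 0) + d * (x 1 - q 1))]

theorem pd_affine (s α β : ℝ) (q : Base) (j : Fin 2) :
    pd j (fun x => s + (α * (x 0 - q 0) + β * (x 1 - q 1))) = fun _ => if j = 0 then α else β := by
  funext x
  have h (i : Fin 2) : SmoothNear (fun x : Base => x i - q i) x := (SmoothNear.coord i x).sub (.const _ x)
  have e (i : Fin 2) : pd j (fun x : Base => x i - q i) x = if i = j then 1 else 0 := by
    rw [pd_sub (.coord i x) (.const _ x), pd_coord, pd_const, sub_zero]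
  rw [pd_add (.const s x) (((SmoothNear.const α x).mul (h 0)).add ((SmoothNear.const β x).mul (h 1))),
    pd_add ((SmoothNear.const α x).mul (h 0)) ((SmoothNear.const β x).mul (h 1)),
    pd_const_mul (h 0), pd_const_mul (h 1), e, e, pd_const]
  fin_cases j <;> simp

theorem affineMap_smooth (p q : Base) (a b c d : ℝ) (x : Base) :
    SmoothMapNear (affineMap p q a b c d) x := by
  refine fun i => .of_contDiff ?_ x
  fin_cases i
  · change ContDiff ℝ ∞ fun x : Base => p 0 + (a * (x 0 - q 0) + b * (x 1 - q 1)); fun_prop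
  · change ContDiff ℝ ∞ fun x : Base => p 1 + (c * (x 0 - q 0) + d * (x 1 - q 1)); fun_prop

theorem affineMap_self (p q : Base) (a b c d : ℝ) : affineMap p q a b c d q = p := by
  funext i; fin_cases i <;> simp [affineMap]

theorem pd_affineMap_zero (p q : Base) (a b c d : ℝ) (j : Fin 2) :
    pd j (fun x => affineMap p q a b c d x 0) = fun _ => if j = 0 then a else b :=
  pd_affine (p 0) a b q j

theorem pd_affineMap_one (p q : Base) (a b c d : ℝ) (j : Fin 2) :
    pd j (fun x => affineMap p q a b c d x 1) = fun _ => if j = 0 then c else d :=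
  pd_affine (p 1) c d q j

theorem jac_affineMap (p q : Base) (a b c d : ℝ) (x : Base) :
    jac (affineMap p q a b c d) x = a * d - b * c := by
  simp [jac, pd_affineMap_zero, pd_affineMap_one]

theorem pullSection_affineMap (S : Base → Fib) (p q : Base) (a b c d : ℝ) (x : Base) :
    pullSection S (affineMap p q a b c d) x =
      coeffs (S (affineMap p q a b c d x)) a b c d 0 0 0 0 0 0 := by
  simp [pullSection_eq, pd_affineMap_zero, pd_affineMap_one, pd_const]

/-- Without second derivatives the inhomogeneous terms disappear: the section undergoes a constant
linear map, the action on binary cubics divided by the determinant. -/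
theorem F_pullSection_affineMap {S : Base → Fib} {p q : Base} (a b c d : ℝ)
    (h : a * d - b * c ≠ 0) (hS : SmoothSectionNear S p) :
    F1 (pullSection S (affineMap p q a b c d)) q
        = (a * d - b * c) * (a * F1 S p + c * F2 S p) ∧
      F2 (pullSection S (affineMap p q a b c d)) q
        = (a * d - b * c) * (b * F1 S p + d * F2 S p) := by
  have h0 : HasTwoJet (fun x => affineMap p q a b c d x 0) q ⟨p 0, a, b, 0, 0, 0⟩ := by
    constructor <;> simp [pd_affineMap_zero, pd_const, affineMap_self, affineMap_smooth p q a b c d q 0]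
  have h1 : HasTwoJet (fun x => affineMap p q a b c d x 1) q ⟨p 1, c, d, 0, 0, 0⟩ := by
    constructor <;> simp [pd_affineMap_one, pd_const, affineMap_self, affineMap_smooth p q a b c d q 1]
  have hu (i : Fin 4) : HasTwoJet (fun x => S (affineMap p q a b c d x) i) q _ :=
    HasTwoJet.comp (f := fun x => S x i) (g := affineMap p q a b c d) (.self (by
      rw [affineMap_self]; exact hS i)) h0 h1
  simp only [affineMap_self] at hu
  obtain ⟨e, he⟩ : ∃ e, e = (a * d - b * c)⁻¹ := ⟨_, rfl⟩
  -- The matrix of that action on cubic coefficients, with `e` the inverse determinant.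
  let C : Fin 4 → Fin 4 → ℝ := ![![a ^ 3 * e, a ^ 2 * c * e, a * c ^ 2 * e, c ^ 3 * e],
    ![3 * a ^ 2 * b * e, (a ^ 2 * d + 2 * a * b * c) * e, (b * c ^ 2 + 2 * a * c * d) * e,
      3 * c ^ 2 * d * e],
    ![3 * a * b ^ 2 * e, (b ^ 2 * c + 2 * a * b * d) * e, (a * d ^ 2 + 2 * b * c * d) * e,
      3 * c * d ^ 2 * e],
    ![b ^ 3 * e, b ^ 2 * d * e, b * d ^ 2 * e, d ^ 3 * e]]
  have hw (i : Fin 4) : HasTwoJet (fun x => pullSection S (affineMap p q a b c d) x i) q _ :=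
    HasTwoJet.congr (((((HasTwoJet.const (C i 0) q).mul (hu 0)).add
      ((HasTwoJet.const (C i 1) q).mul (hu 1))).add ((HasTwoJet.const (C i 2) q).mul (hu 2))).add
      ((HasTwoJet.const (C i 3) q).mul (hu 3))) (.of_forall fun x => by
        simp only [pullSection_affineMap, coeffs, div_eq_mul_inv, ← he, C]
        fin_cases i <;>
        · simp only [Fin.zero_eta, Fin.mk_one, Fin.reduceFinMk, Matrix.cons_val]
          ring)
  have hΔ : e * (a * d - b * c) = 1 := by rw [he, inv_mul_cancel₀ h]
  rw [F1_eq_of_hasTwoJet hw, F2_eq_of_hasTwoJet hw]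
  simp only [F1Jet, F2Jet, TwoJet.comp, TwoJet.mul, TwoJet.add, TwoJet.const, mul_zero, zero_mul,
    add_zero, zero_add, C, Matrix.cons_val, F1, F2]
  generalize hD : a * d - b * c = D at h he
  subst he
  constructor <;>
  · field_simp
    rw [← hD]
    ring


theorem F_congr {S T : Base → Fib} {p : Base} (e : S =ᶠ[𝓝 p] T) :
    F1 S p = F1 T p ∧ F2 S p = F2 T p := by
  have e1 (i : Fin 4) : (fun x => S x i) =ᶠ[𝓝 p] fun x => T x i := e.fun_comp fun u => u i
  have e2 (i : Fin 4) (j : Fin 2) : pd j (fun x => S x i) =ᶠ[𝓝 p] pd j fun x => T x i :=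
    pd_eventuallyEq (e1 i) j
  have e3 (i : Fin 4) (j k : Fin 2) := pd_congr (e2 i j) k
  simp only [F1, F2, e.self_of_nhds, (e2 _ _).self_of_nhds, e3, and_self]

theorem F1_congr {S T : Base → Fib} {p : Base} (e : S =ᶠ[𝓝 p] T) : F1 S =ᶠ[𝓝 p] F1 T := by
  filter_upwards [e.eventuallyEq_nhds] with x hx using (F_congr hx).1

theorem F2_congr {S T : Base → Fib} {p : Base} (e : S =ᶠ[𝓝 p] T) : F2 S =ᶠ[𝓝 p] F2 T := by
  filter_upwards [e.eventuallyEq_nhds] with x hx using (F_congr hx).2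

/-- The relative invariants `F1`, `F2` are transformed like the components of a covector of
weight one. -/
theorem F_pullSection {S : Base → Fib} {g : Base → Base} {q : Base}
    (hS : SmoothSectionNear S (g q)) (hg : SmoothMapNear g q) (hj : jac g q ≠ 0) :
    F1 (pullSection S g) q = jac g q * (pd 0 (fun r => g r 0) q * F1 S (g q)
        + pd 0 (fun r => g r 1) q * F2 S (g q)) ∧
      F2 (pullSection S g) q = jac g q * (pd 1 (fun r => g r 0) q * F1 S (g q)
        + pd 1 (fun r => g r 1) q * F2 S (g q)) := by
  obtain ⟨p, hp⟩ : ∃ p, p = g q := ⟨_, rfl⟩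
  obtain ⟨a, ha⟩ : ∃ a, a = pd 0 (fun r => g r 0) q := ⟨_, rfl⟩
  obtain ⟨b, hb⟩ : ∃ b, b = pd 1 (fun r => g r 0) q := ⟨_, rfl⟩
  obtain ⟨c, hc⟩ : ∃ c, c = pd 0 (fun r => g r 1) q := ⟨_, rfl⟩
  obtain ⟨d, hd⟩ : ∃ d, d = pd 1 (fun r => g r 1) q := ⟨_, rfl⟩
  have hD : jac g q = a * d - b * c := by rw [ha, hb, hc, hd, jac]
  rw [hD, ← ha, ← hb, ← hc, ← hd, ← hp]
  rw [hD] at hj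
  rw [← hp] at hS
  obtain ⟨e, he⟩ : ∃ e, e = (a * d - b * c)⁻¹ := ⟨_, rfl⟩
  have hΔ : e * (a * d - b * c) = 1 := by rw [he, inv_mul_cancel₀ hj]
  -- `A` has the same 1-jet as `g` at `q` and `B` is its inverse, so `g = A ∘ (B ∘ g)` where `B ∘ g`
  -- fixes `q` with identity derivative. This separates the affine case from the unipotent one.
  let A := affineMap p q a b c d
  let B := affineMap q p (d * e) (-(b * e)) (-(c * e)) (a * e)
  have hBA (x : Base) : A (B x) = x := by
    funext i
    fin_cases i
    · simp only [A, B, affineMap, Matrix.cons_val, Fin.zero_eta]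
      linear_combination (x 0 - p 0) * hΔ
    · simp only [A, B, affineMap, Matrix.cons_val, Fin.mk_one]
      linear_combination (x 1 - p 1) * hΔ
  have hB : SmoothMapNear B (g q) := affineMap_smooth _ _ _ _ _ _ _
  have hBq : B (g q) = q := by rw [← hp]; exact affineMap_self _ _ _ _ _ _
  have hA (x : Base) : SmoothMapNear A x := affineMap_smooth _ _ _ _ _ _ _
  have hAq : A q = p := affineMap_self _ _ _ _ _ _
  have hg₀ : SmoothMapNear (fun x => B (g x)) q := hB.comp hg
  have e0 : pullSection S g =ᶠ[𝓝 q] pullSection (pullSection S A) fun x => B (g x) := by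
    filter_upwards [hg₀.eventually] with x hx
    rw [pullSection_pullSection S (hA _) hx (by rw [jac_affineMap]; exact hj)]
    simp only [hBA]
  have eF := F_congr e0
  have hd0 (j : Fin 2) : pd j (fun x => B (g x) 0) q
      = d * e * pd j (fun r => g r 0) q + -(b * e) * pd j (fun r => g r 1) q := by
    rw [pd_comp (hB 0) hg, pd_affineMap_zero, pd_affineMap_zero]; simp
  have hd1 (j : Fin 2) : pd j (fun x => B (g x) 1) q
      = -(c * e) * pd j (fun r => g r 0) q + a * e * pd j (fun r => g r 1) q := by
    rw [pd_comp (hB 1) hg, pd_affineMap_one, pd_affineMap_one]; simp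
  have key := F_pullSection_of_unipotent (S := pullSection S A) (g := fun x => B (g x)) (q := q)
    (by
      rw [hBq]
      exact SmoothSectionNear.pullSection (by rwa [hAq]) (hA q) (by rw [jac_affineMap]; exact hj))
    hg₀ ((hd0 0).trans <| by rw [← ha, ← hc]; linear_combination hΔ)
    ((hd0 1).trans <| by rw [← hb, ← hd]; ring)
    ((hd1 0).trans <| by rw [← ha, ← hc]; ring)
    ((hd1 1).trans <| by rw [← hb, ← hd]; linear_combination hΔ)
  simp only [hBq] at key
  have key' := F_pullSection_affineMap a b c d hj hS (q := q)
  exact ⟨eF.1.trans (key.1.trans key'.1), eF.2.trans (key.2.trans key'.2)⟩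


/-! ### First derivatives of `F1` and `F2`, and the weight of `F3`. -/

theorem SmoothSectionNear.F {S : Base → Fib} {p : Base} (h : SmoothSectionNear S p) :
    SmoothNear (F1 S) p ∧ SmoothNear (F2 S) p := by
  have h1 (i : Fin 4) (j : Fin 2) : SmoothNear (pd j fun x => S x i) p := (h i).pd j
  have h2 (i : Fin 4) (j k : Fin 2) : SmoothNear (pd k (pd j fun x => S x i)) p := (h1 i j).pd k
  constructor
  on_goal 1 => change SmoothNear (fun x => F1 S x) p; simp only [F1]
  on_goal 2 => change SmoothNear (fun x => F2 S x) p; simp only [F2]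
  all_goals
    repeat first
      | exact h _ | exact h1 _ _ | exact h2 _ _ _ | exact SmoothNear.const _ _
      | with_reducible apply SmoothNear.sub | with_reducible apply SmoothNear.add
      | with_reducible apply SmoothNear.mul

theorem pd_jac {g : Base → Base} {q : Base} (hg : SmoothMapNear g q) (k : Fin 2) :
    pd k (jac g) q = pd k (pd 0 (fun r => g r 0)) q * pd 1 (fun r => g r 1) q
      + pd 0 (fun r => g r 0) q * pd k (pd 1 (fun r => g r 1)) q
      - (pd k (pd 1 (fun r => g r 0)) q * pd 0 (fun r => g r 1) q
        + pd 1 (fun r => g r 0) q * pd k (pd 0 (fun r => g r 1)) q) := by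
  unfold jac
  rw [pd_sub (((hg 0).pd 0).mul ((hg 1).pd 1)) (((hg 0).pd 1).mul ((hg 1).pd 0)),
    pd_mul ((hg 0).pd 0) ((hg 1).pd 1), pd_mul ((hg 0).pd 1) ((hg 1).pd 0)]

theorem pd_weighted_covector {S : Base → Fib} {g : Base → Base} {q : Base}
    (hS : SmoothSectionNear S (g q)) (hg : SmoothMapNear g q)
    (k j : Fin 2) :
    pd k (fun x => jac g x * (pd j (fun r => g r 0) x * F1 S (g x)
      + pd j (fun r => g r 1) x * F2 S (g x))) q
    = pd k (jac g) q * (pd j (fun r => g r 0) q * F1 S (g q) + pd j (fun r => g r 1) q * F2 S (g q))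
      + jac g q * (pd k (pd j (fun r => g r 0)) q * F1 S (g q) + pd j (fun r => g r 0) q *
          (pd 0 (F1 S) (g q) * pd k (fun r => g r 0) q + pd 1 (F1 S) (g q) * pd k (fun r => g r 1) q)
        + (pd k (pd j (fun r => g r 1)) q * F2 S (g q) + pd j (fun r => g r 1) q *
          (pd 0 (F2 S) (g q) * pd k (fun r => g r 0) q
            + pd 1 (F2 S) (g q) * pd k (fun r => g r 1) q))) := by
  have c1 := hS.F.1.comp hg
  have c2 := hS.F.2.comp hg
  have d (i j : Fin 2) := (hg i).pd j
  rw [pd_mul hg.jac (((d 0 j).mul c1).add ((d 1 j).mul c2)), pd_add ((d 0 j).mul c1) ((d 1 j).mul c2),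
    pd_mul (d 0 j) c1, pd_mul (d 1 j) c2, pd_comp hS.F.1 hg, pd_comp hS.F.2 hg]

theorem F_pullSection_eventually {S : Base → Fib} {g : Base → Base} {q : Base}
    (hS : SmoothSectionNear S (g q)) (hg : SmoothMapNear g q) (hj : jac g q ≠ 0) :
    (∀ᶠ x in 𝓝 q, F1 (pullSection S g) x =
      jac g x * (pd 0 (fun r => g r 0) x * F1 S (g x) + pd 0 (fun r => g r 1) x * F2 S (g x))) ∧
    ∀ᶠ x in 𝓝 q, F2 (pullSection S g) x =
      jac g x * (pd 1 (fun r => g r 0) x * F1 S (g x) + pd 1 (fun r => g r 1) x * F2 S (g x)) := by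
  rw [← Filter.eventually_and]
  filter_upwards [hg.continuousAt.eventually hS.eventually, hg.eventually,
    hg.eventually_jac_ne hj] with x h1 h2 h3 using F_pullSection h1 h2 h3

theorem pd_F1_pullSection {S : Base → Fib} {g : Base → Base} {q : Base}
    (hS : SmoothSectionNear S (g q)) (hg : SmoothMapNear g q) (hj : jac g q ≠ 0)
    (k : Fin 2) : pd k (F1 (pullSection S g)) q
    = pd k (jac g) q * (pd 0 (fun r => g r 0) q * F1 S (g q) + pd 0 (fun r => g r 1) q * F2 S (g q))
      + jac g q * (pd k (pd 0 (fun r => g r 0)) q * F1 S (g q) + pd 0 (fun r => g r 0) q *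
          (pd 0 (F1 S) (g q) * pd k (fun r => g r 0) q + pd 1 (F1 S) (g q) * pd k (fun r => g r 1) q)
        + (pd k (pd 0 (fun r => g r 1)) q * F2 S (g q) + pd 0 (fun r => g r 1) q *
          (pd 0 (F2 S) (g q) * pd k (fun r => g r 0) q
            + pd 1 (F2 S) (g q) * pd k (fun r => g r 1) q))) :=
  (pd_congr (F_pullSection_eventually hS hg hj).1 k).trans (pd_weighted_covector hS hg k 0)

theorem pd_F2_pullSection {S : Base → Fib} {g : Base → Base} {q : Base}
    (hS : SmoothSectionNear S (g q)) (hg : SmoothMapNear g q) (hj : jac g q ≠ 0)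
    (k : Fin 2) : pd k (F2 (pullSection S g)) q
    = pd k (jac g) q * (pd 1 (fun r => g r 0) q * F1 S (g q) + pd 1 (fun r => g r 1) q * F2 S (g q))
      + jac g q * (pd k (pd 1 (fun r => g r 0)) q * F1 S (g q) + pd 1 (fun r => g r 0) q *
          (pd 0 (F1 S) (g q) * pd k (fun r => g r 0) q + pd 1 (F1 S) (g q) * pd k (fun r => g r 1) q)
        + (pd k (pd 1 (fun r => g r 1)) q * F2 S (g q) + pd 1 (fun r => g r 1) q *
          (pd 0 (F2 S) (g q) * pd k (fun r => g r 0) q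
            + pd 1 (F2 S) (g q) * pd k (fun r => g r 1) q))) :=
  (pd_congr (F_pullSection_eventually hS hg hj).2 k).trans (pd_weighted_covector hS hg k 1)

/-- `F3` is a relative invariant of weight five. -/
theorem F3_pullSection {S : Base → Fib} {g : Base → Base} {q : Base}
    (hS : SmoothSectionNear S (g q)) (hg : SmoothMapNear g q) (hj : jac g q ≠ 0) :
    F3 (pullSection S g) q = jac g q ^ 5 * F3 S (g q) := by
  have hF := F_pullSection hS hg hj
  unfold F3
  rw [pd_F1_pullSection hS hg hj, pd_F1_pullSection hS hg hj, pd_F2_pullSection hS hg hj,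
    pd_F2_pullSection hS hg hj, hF.1, hF.2, pullSection_eq]
  simp only [pd_comm (hg _)]
  simp only [coeffs, Matrix.cons_val]
  have hD : jac g q = pd 0 (fun r => g r 0) q * pd 1 (fun r => g r 1) q
    - pd 1 (fun r => g r 0) q * pd 0 (fun r => g r 1) q := rfl
  rw [← hD]
  generalize jac g q = D at hD hj ⊢
  -- The derivatives of the Jacobian may stay arbitrary: they multiply a common factor of `F1` and
  -- `F2` and cancel in the combinations `F1 DF2 - F2 DF1`. The second derivatives of `g` cancel
  -- against the inhomogeneous terms of the transformed coefficients.
  generalize pd 0 (jac g) q = D₀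
  generalize pd 1 (jac g) q = D₁
  field_simp
  rw [hD]
  ring

/-! ### Congruence of germs up to a given order -/

/-- The germs of `f` and `g` at `p` are smooth and agree up to order `n`. -/
structure AgreeAt (n : ℕ) (p : Base) (f g : Base → ℝ) : Prop where
  left : SmoothNear f p
  right : SmoothNear g p
  sub : VanishesAt n (fun x => f x - g x) p

namespace AgreeAt

variable {n : ℕ} {p : Base} {f g f' g' : Base → ℝ}

theorem refl (n : ℕ) (h : SmoothNear f p) : AgreeAt n p f f :=
  ⟨h, h, (VanishesAt.zero n p).congr (.of_forall fun x => by simp)⟩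

theorem add (h : AgreeAt n p f g) (h' : AgreeAt n p f' g') :
    AgreeAt n p (fun x => f x + f' x) (fun x => g x + g' x) :=
  ⟨h.left.add h'.left, h.right.add h'.right,
    (h.sub.add h'.sub).congr (.of_forall fun x => by ring)⟩

theorem minus (h : AgreeAt n p f g) (h' : AgreeAt n p f' g') :
    AgreeAt n p (fun x => f x - f' x) (fun x => g x - g' x) :=
  ⟨h.left.sub h'.left, h.right.sub h'.right,
    (h.sub.sub h'.sub).congr (.of_forall fun x => by ring)⟩

theorem mul (h : AgreeAt n p f g) (h' : AgreeAt n p f' g') :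
    AgreeAt n p (fun x => f x * f' x) (fun x => g x * g' x) :=
  ⟨h.left.mul h'.left, h.right.mul h'.right,
    ((h.sub.mul_smooth h'.left).add (.smooth_mul h.right h'.sub)).congr
      (.of_forall fun x => by ring)⟩

theorem pow (h : AgreeAt n p f g) (k : ℕ) :
    AgreeAt n p (fun x => f x ^ k) (fun x => g x ^ k) := by
  induction k with
  | zero => simpa using refl n (SmoothNear.const 1 p)
  | succ k ih => simpa only [pow_succ] using ih.mul h

/-- The difference is `(f - g f') / f'`, whose numerator vanishes to order `n` since `g f'` agrees
with `g`. -/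
theorem div_of_one (h : AgreeAt n p f g) (h' : AgreeAt n p f' fun _ => 1) (h0 : f' p ≠ 0) :
    AgreeAt n p (fun x => f x / f' x) g := by
  refine ⟨h.left.div h'.left h0, h.right, ?_⟩
  have h1 := (h.minus ((refl n h.right).mul h')).sub
  have h2 := h1.mul_smooth ((SmoothNear.const 1 p).div h'.left h0)
  refine h2.congr ?_
  filter_upwards [h'.left.contDiffAt.continuousAt.eventually_ne h0] with x hx
  field_simp
  ring

theorem congr_right (h : AgreeAt n p f g) (e : ∀ x, g x = g' x) : AgreeAt n p f g' := by
  rwa [← funext e]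

theorem partials_eq (h : AgreeAt n p f g) {a b : ℕ} (hab : a + b < n) :
    partials a b f p = partials a b g p :=
  h.sub.partials_eq_of_sub h.left h.right hab

end AgreeAt

/-! ### Changes of variables tangent to the identity -/

section tangent

variable {S : Base → Fib} {g : Base → Base} {p : Base} {m : ℕ}

theorem smoothMapNear_of_tangent (hg : ∀ i, VanishesAt m (fun x => g x i - x i) p) :
    SmoothMapNear g p := fun i => ((hg i).smooth.add (.coord i p)).congr
  (.of_forall fun x => by simp)

theorem agreeAt_pd_of_tangent (hg : ∀ i, VanishesAt (m + 2) (fun x => g x i - x i) p)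
    (i j : Fin 2) :
    AgreeAt (m + 1) p (pd j fun x => g x i) (fun _ => if i = j then 1 else 0) := by
  have hs := smoothMapNear_of_tangent hg
  refine ⟨(hs i).pd j, .const _ p, ((hg i).pd j).congr ?_⟩
  filter_upwards [(hs i).eventually] with x hx
  rw [pd_sub hx (.coord i x), pd_coord]

theorem jac_of_tangent (hg : ∀ i, VanishesAt (m + 2) (fun x => g x i - x i) p) : jac g p = 1 := by
  have h (i j : Fin 2) := (agreeAt_pd_of_tangent hg i j).partials_eq (a := 0) (b := 0) (by omega)
  simp only [partials, Function.iterate_zero, id] at h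
  simp [jac, h]

/-- The change of the section to first order under an infinitesimal change of variables of high
order. -/
theorem agreeAt_pullSection_of_tangent (hp : g p = p) (hS : SmoothSectionNear S p)
    (hg : ∀ i, VanishesAt (m + 2) (fun x => g x i - x i) p) :
    AgreeAt (m + 1) p (fun x => pullSection S g x 0)
        (fun x => S x 0 - pd 0 (pd 0 fun r => g r 1) x) ∧
    AgreeAt (m + 1) p (fun x => pullSection S g x 1)
        (fun x => S x 1 + (pd 0 (pd 0 fun r => g r 0) x - 2 * pd 0 (pd 1 fun r => g r 1) x)) ∧
    AgreeAt (m + 1) p (fun x => pullSection S g x 2)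
        (fun x => S x 2 + (2 * pd 0 (pd 1 fun r => g r 0) x - pd 1 (pd 1 fun r => g r 1) x)) ∧
    AgreeAt (m + 1) p (fun x => pullSection S g x 3)
        (fun x => S x 3 + pd 1 (pd 1 fun r => g r 0) x) := by
  have hs := smoothMapNear_of_tangent hg
  have ha : AgreeAt (m + 1) p (pd 0 fun x => g x 0) (fun _ => 1) := agreeAt_pd_of_tangent hg 0 0
  have hb : AgreeAt (m + 1) p (pd 1 fun x => g x 0) (fun _ => 0) := agreeAt_pd_of_tangent hg 0 1
  have hc : AgreeAt (m + 1) p (pd 0 fun x => g x 1) (fun _ => 0) := agreeAt_pd_of_tangent hg 1 0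
  have hd : AgreeAt (m + 1) p (pd 1 fun x => g x 1) (fun _ => 1) := agreeAt_pd_of_tangent hg 1 1
  -- Composition with `g` disturbs `S` only in order `m + 2`. One order is given up because the
  -- first derivatives of `g` match those of the identity only to order `m + 1`; then only the
  -- undifferentiated section and the second derivatives of `g` survive.
  have hu (i : Fin 4) : AgreeAt (m + 1) p (fun x => S (g x) i) (fun x => S x i) :=
    ⟨SmoothNear.comp (by rw [hp]; exact hS i) hs, hS i,
      (VanishesAt.comp_sub_self hp (hS i) hg).pred⟩
  have h2 (i j k : Fin 2) := AgreeAt.refl (m + 1) (((hs i).pd j).pd k)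
  have hk (c : ℝ) := AgreeAt.refl (m + 1) (SmoothNear.const c p)
  have hj : AgreeAt (m + 1) p (fun x => pd 0 (fun r => g r 0) x * pd 1 (fun r => g r 1) x
      - pd 1 (fun r => g r 0) x * pd 0 (fun r => g r 1) x) (fun _ => 1) :=
    ((ha.mul hd).minus (hb.mul hc)).congr_right fun x => by norm_num
  have h0 : pd 0 (fun r => g r 0) p * pd 1 (fun r => g r 1) p
      - pd 1 (fun r => g r 0) p * pd 0 (fun r => g r 1) p ≠ 0 := by
    have : jac g p ≠ 0 := by rw [jac_of_tangent hg]; exact one_ne_zero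
    exact this
  refine ⟨?_, ?_, ?_, ?_⟩
  · exact AgreeAt.div_of_one ((((((hu 0).mul (ha.pow 3)).add (((hu 1).mul (ha.pow 2)).mul hc)).add
      (((hu 2).mul ha).mul (hc.pow 2))).add ((hu 3).mul (hc.pow 3))).minus
      ((ha.mul (h2 1 0 0)).minus (hc.mul (h2 0 0 0)))|>.congr_right fun x => by ring) hj h0
  · exact AgreeAt.div_of_one ((((((((hk 3).mul (hu 0)).mul (ha.pow 2)).mul hb).add
      ((hu 1).mul (((ha.pow 2).mul hd).add ((((hk 2).mul ha).mul hb).mul hc)))).add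
      ((hu 2).mul ((hb.mul (hc.pow 2)).add ((((hk 2).mul ha).mul hc).mul hd)))).add
      ((((hk 3).mul (hu 3)).mul (hc.pow 2)).mul hd)).minus
      ((((hb.mul (h2 1 0 0)).add (((hk 2).mul ha).mul (h2 1 1 0))).minus
      (hd.mul (h2 0 0 0))).minus (((hk 2).mul hc).mul (h2 0 1 0)))|>.congr_right
      fun x => by ring) hj h0
  · exact AgreeAt.div_of_one ((((((((hk 3).mul (hu 0)).mul ha).mul (hb.pow 2)).add
      ((hu 1).mul (((hb.pow 2).mul hc).add ((((hk 2).mul ha).mul hb).mul hd)))).add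
      ((hu 2).mul ((ha.mul (hd.pow 2)).add ((((hk 2).mul hb).mul hc).mul hd)))).add
      ((((hk 3).mul (hu 3)).mul hc).mul (hd.pow 2))).minus
      ((((ha.mul (h2 1 1 1)).add (((hk 2).mul hb).mul (h2 1 1 0))).minus
      (hc.mul (h2 0 1 1))).minus (((hk 2).mul hd).mul (h2 0 1 0)))|>.congr_right
      fun x => by ring) hj h0
  · exact AgreeAt.div_of_one ((((((hu 0).mul (hb.pow 3)).add (((hu 1).mul (hb.pow 2)).mul hd)).add
      (((hu 2).mul hb).mul (hd.pow 2))).add ((hu 3).mul (hd.pow 3))).minus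
      ((hb.mul (h2 1 1 1)).minus (hd.mul (h2 0 1 1)))|>.congr_right fun x => by ring) hj h0

/-- The action of the Taylor coefficients of `g` on the coordinates of the section is by
translations, independent of the section itself. Both uniqueness and existence of the normal form
come down to this linear system. -/
theorem partials_pullSection_of_tangent (hp : g p = p) (hS : SmoothSectionNear S p)
    (hg : ∀ i, VanishesAt (m + 2) (fun x => g x i - x i) p) {a b : ℕ} (hab : a + b ≤ m) :
    partials a b (fun x => pullSection S g x 0) p
        = partials a b (fun x => S x 0) p - partials (a + 2) b (fun x => g x 1) p ∧
    partials a b (fun x => pullSection S g x 1) p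
        = partials a b (fun x => S x 1) p + (partials (a + 2) b (fun x => g x 0) p
          - 2 * partials (a + 1) (b + 1) (fun x => g x 1) p) ∧
    partials a b (fun x => pullSection S g x 2) p
        = partials a b (fun x => S x 2) p + (2 * partials (a + 1) (b + 1) (fun x => g x 0) p
          - partials a (b + 2) (fun x => g x 1) p) ∧
    partials a b (fun x => pullSection S g x 3) p
        = partials a b (fun x => S x 3) p + partials a (b + 2) (fun x => g x 0) p := by
  have hs := smoothMapNear_of_tangent hg
  obtain ⟨h0, h1, h2, h3⟩ := agreeAt_pullSection_of_tangent hp hS hg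
  have s (i j k : Fin 2) : SmoothNear (pd k (pd j fun r => g r i)) p := ((hs i).pd j).pd k
  have s' (i j k : Fin 2) : SmoothNear (fun x => 2 * pd k (pd j fun r => g r i) x) p :=
    (SmoothNear.const 2 p).mul (s i j k)
  have e00 (i : Fin 2) : partials a b (pd 0 (pd 0 fun r => g r i)) p
      = partials (a + 2) b (fun x => g x i) p := by
    rw [partials_pd_zero a b ((hs i).pd 0), partials_pd_zero (a + 1) b (hs i)]
  have e01 (i : Fin 2) : partials a b (pd 0 (pd 1 fun r => g r i)) p
      = partials (a + 1) (b + 1) (fun x => g x i) p := by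
    rw [partials_pd_zero a b ((hs i).pd 1), partials_pd_one]
  have e11 (i : Fin 2) : partials a b (pd 1 (pd 1 fun r => g r i)) p
      = partials a (b + 2) (fun x => g x i) p := by
    rw [partials_pd_one, partials_pd_one]
  have hab' : a + b < m + 1 := by omega
  refine ⟨(h0.partials_eq hab').trans ?_, (h1.partials_eq hab').trans ?_,
    (h2.partials_eq hab').trans ?_, (h3.partials_eq hab').trans ?_⟩
  · rw [partials_sub (hS 0) (s 1 0 0), e00]
  · rw [partials_add (hS 1) ((s 0 0 0).sub (s' 1 1 0)), partials_sub (s 0 0 0) (s' 1 1 0),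
      partials_const_mul (s 1 1 0), e00, e01]
  · rw [partials_add (hS 2) ((s' 0 1 0).sub (s 1 1 1)), partials_sub (s' 0 1 0) (s 1 1 1),
      partials_const_mul (s 0 1 0), e01, e11]
  · rw [partials_add (hS 3) (s 0 1 1), e11]

theorem partials_coord {i : Fin 2} {a b : ℕ} (hab : 2 ≤ a + b) (p : Base) :
    partials a b (fun x => x i) p = 0 := by
  have h1 (j : Fin 2) : pd j (fun x => x i) = fun _ => if i = j then 1 else 0 := pd_coord i j
  have h2 (c : ℝ) {a b : ℕ} (h : 1 ≤ a + b) : partials a b (fun _ => c) p = 0 := by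
    rcases a with _ | a
    · obtain ⟨b, rfl⟩ : ∃ d, b = d + 1 := ⟨b - 1, by omega⟩
      rw [← partials_pd_one, pd_const, partials_zero_fun]
    · rw [← partials_pd_zero a b (.const c p), pd_const, partials_zero_fun]
  rcases a with _ | a
  · obtain ⟨b, rfl⟩ : ∃ d, b = d + 1 := ⟨b - 1, by omega⟩
    rw [← partials_pd_one, h1, h2 _ (by omega)]
  · rw [← partials_pd_zero a b (.coord i p), h1, h2 _ (by omega)]

theorem partials_of_tangent (hg : ∀ i, VanishesAt (m + 2) (fun x => g x i - x i) p) (i : Fin 2)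
    {a b : ℕ} (h2 : 2 ≤ a + b) (hab : a + b < m + 2) : partials a b (fun x => g x i) p = 0 := by
  rw [(hg i).partials_eq_of_sub (smoothMapNear_of_tangent hg i) (.coord i p) hab,
    partials_coord h2]

theorem tangent_succ (hg : ∀ i, VanishesAt (m + 2) (fun x => g x i - x i) p)
    (h : ∀ i a b, a + b = m + 2 → partials a b (fun x => g x i) p = 0) :
    ∀ i, VanishesAt (m + 3) (fun x => g x i - x i) p := fun i =>
  (hg i).succ fun a b hab => by
    rw [partials_sub (smoothMapNear_of_tangent hg i) (.coord i p), h i a b hab,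
      partials_coord (by omega), sub_zero]

end tangent

/-! ### Normal forms of jets -/

/-- The coordinates `u^i_(a,b)` which are not normalized to zero by the choice of the independent
variables. -/
def IsFree (i : Fin 4) (a b : ℕ) : Prop := i = 1 ∧ 2 ≤ b ∨ i = 2 ∧ 2 ≤ a

/-- The jet of order less than `n` at the origin is reduced: all coordinates which are not free
vanish. -/
def Reduced (n : ℕ) (T : Base → Fib) : Prop :=
  ∀ i a b, a + b < n → ¬IsFree i a b → partials a b (fun x => T x i) 0 = 0

/-- Normalization of the relative invariants and of their first derivatives at the origin. -/
structure Calibrated (T : Base → Fib) : Prop where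
  F1 : F1 T 0 = 1
  F2 : F2 T 0 = 0
  F1x : pd 0 (CubicODE.F1 T) 0 = 0
  F1y : pd 1 (CubicODE.F1 T) 0 = 0
  F2x : pd 0 (CubicODE.F2 T) 0 = 0
  F2y : pd 1 (CubicODE.F2 T) 0 = -1

theorem Reduced.mono {n m : ℕ} {T : Base → Fib} (h : Reduced n T) (hm : m ≤ n) : Reduced m T :=
  fun i a b hab hi => h i a b (by omega) hi

theorem Reduced.value {T : Base → Fib} (h : Reduced 1 T) (i : Fin 4) : T 0 i = 0 :=
  h i 0 0 (by omega) (by simp [IsFree])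

theorem Calibrated.F3_eq {T : Base → Fib} (h : Calibrated T) (h0 : Reduced 1 T) : F3 T 0 = 1 := by
  simp [F3, h.F1, h.F2, h.F1x, h.F1y, h.F2x, h.F2y, h0.value]

section uniqueness

variable {T : Base → Fib} {g : Base → Base}

/-- The calibration has trivial stabilizer among 2-jets. The weight of `F3` forces Jacobian one, the
covector `(F1, F2) = (1, 0)` leaves only a shear, and the vanishing of the section together with the
derivatives of `F1` and `F2` removes the shear and all second derivatives. -/
theorem tangent_of_calibrated (hT : SmoothSectionNear T 0) (h : Calibrated T) (h0 : Reduced 1 T)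
    (h' : Calibrated (pullSection T g)) (h0' : Reduced 1 (pullSection T g))
    (hg : SmoothMapNear g 0) (g0 : g 0 = 0) (hj : jac g 0 ≠ 0) :
    ∀ i, VanishesAt 3 (fun x => g x i - x i) 0 := by
  have hT' : SmoothSectionNear T (g 0) := by rwa [g0]
  have e := F_pullSection hT' hg hj
  have e3 := F3_pullSection hT' hg hj
  have e1x := pd_F1_pullSection hT' hg hj 0
  have e1y := pd_F1_pullSection hT' hg hj 1
  have e2x := pd_F2_pullSection hT' hg hj 0
  have hu := h0'.value
  rw [pullSection_eq] at hu
  rw [pd_jac hg] at e1x e1y e2x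
  have hjd : jac g 0 = pd 0 (fun r => g r 0) 0 * pd 1 (fun r => g r 1) 0
    - pd 1 (fun r => g r 0) 0 * pd 0 (fun r => g r 1) 0 := rfl
  simp only [g0, h.F1, h.F2, h.F1x, h.F1y, h.F2x, h.F2y, h'.F1, h'.F2, h'.F1x, h'.F1y, h'.F2x,
    h.F3_eq h0, h'.F3_eq h0', pd_comm (hg _)] at e e3 e1x e1y e2x
  -- Both values of `F3` are one, so the fifth power of the Jacobian is one; odd powers are
  -- injective on `ℝ`, hence negative Jacobians are excluded too.
  have j1 : jac g 0 = 1 := by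
    have h5 : Odd 5 := by decide
    exact h5.pow_injective (R := ℝ) (by simpa using e3.symm)
  rw [j1] at e hjd e1x e1y e2x
  have hu0 := hu 0
  have hu1 := hu 1
  have hu2 := hu 2
  have hu3 := hu 3
  simp only [coeffs, Matrix.cons_val, ← hjd, g0, h0.value] at hu0 hu1 hu2 hu3
  have ea : pd 0 (fun r => g r 0) 0 = 1 := by linarith [e.1]
  have eb : pd 1 (fun r => g r 0) 0 = 0 := by linarith [e.2]
  have ed : pd 1 (fun r => g r 1) 0 = 1 := by rw [ea, eb] at hjd; linarith
  simp only [ea, eb, ed] at hu0 hu1 hu2 hu3 e1x e1y e2x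
  have a22 : pd 1 (pd 1 (fun r => g r 0)) 0 = 0 := by linarith
  have a12 : pd 0 (pd 1 (fun r => g r 0)) 0 = pd 0 (fun r => g r 1) 0 := by linarith
  simp only [a22, a12] at hu0 hu1 hu2 hu3 e1x e1y e2x
  -- Let `c` be the shear. The `x`-derivative of `F2` gives `g⁰_xy = c`, the vanishing of `u²` gives
  -- `g¹_yy = 2c`, and the `y`-derivative of `F1` gives `2g⁰_xy + g¹_yy - c = 0`, so `3c = 0`.
  have ec : pd 0 (fun r => g r 1) 0 = 0 := by linarith
  simp only [ec] at hu0 hu1 hu2 hu3 e1x e1y e2x a12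
  have a11 : pd 0 (pd 0 (fun r => g r 0)) 0 = 0 := by linarith
  have c11 : pd 0 (pd 0 (fun r => g r 1)) 0 = 0 := by linarith
  have c12 : pd 0 (pd 1 (fun r => g r 1)) 0 = 0 := by linarith
  have c22 : pd 1 (pd 1 (fun r => g r 1)) 0 = 0 := by linarith
  have hz (i : Fin 2) : g 0 i - 0 = 0 := by rw [g0]; simp
  have key (i : Fin 2) (h1 : ∀ j, pd j (fun r => g r i) 0 = if i = j then 1 else 0)
      (h2 : ∀ j k, pd k (pd j fun r => g r i) 0 = 0) : VanishesAt 3 (fun x => g x i - x i) 0 := by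
    have q (j : Fin 2) : pd j (fun x => g x i - x i) =ᶠ[𝓝 0]
        fun x => pd j (fun x => g x i) x - if i = j then 1 else 0 := by
      filter_upwards [hg.eventually] with x hx
      rw [pd_sub (hx i) (.coord i x), pd_coord]
    refine ⟨(hg i).sub (.coord i 0), hz i, fun j => VanishesAt.congr ?_ (q j)⟩
    refine ⟨((hg i).pd j).sub (.const _ 0), by simp [h1 j], fun k => ?_⟩
    have q' : pd k (fun x => pd j (fun x => g x i) x - if i = j then 1 else 0) =ᶠ[𝓝 0]
        pd k (pd j fun x => g x i) := by
      filter_upwards [hg.eventually] with x hx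
      rw [pd_sub ((hx i).pd j) (.const _ x), pd_const, sub_zero]
    refine VanishesAt.congr ?_ q'
    exact ⟨((hg i).pd j).pd k, h2 j k, fun l => (((hg i).pd j).pd k).pd l⟩
  intro i
  fin_cases i
  · refine key 0 (fun j => ?_) fun j k => ?_
    · fin_cases j
      exacts [ea, eb]
    · fin_cases j <;> fin_cases k
      exacts [a11, (pd_comm (hg 0)).trans a12, a12, a22]
  · refine key 1 (fun j => ?_) fun j k => ?_
    · fin_cases j
      exacts [ec, ed]
    · fin_cases j <;> fin_cases k
      exacts [c11, (pd_comm (hg 1)).trans c12, c12, c22]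

/-- Injectivity of the translation action in order `m`. Components `0` and `3` kill all but two
coefficients of each component of `g`; the non-free coordinates of components `1` and `2` kill the
rest. For `m = 0` this fails, the kernel being the quadratic parts of projective maps, so
calibration must deal with that order. -/
theorem tangent_succ_of_reduced {m : ℕ} (hm : 1 ≤ m) (hT : SmoothSectionNear T 0)
    (h : Reduced (m + 1) T) (h' : Reduced (m + 1) (pullSection T g)) (g0 : g 0 = 0)
    (hg : ∀ i, VanishesAt (m + 2) (fun x => g x i - x i) 0) :
    ∀ i, VanishesAt (m + 3) (fun x => g x i - x i) 0 := by
  have key {a b : ℕ} (hab : a + b = m) := partials_pullSection_of_tangent g0 hT hg hab.le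
  have k0 {a b : ℕ} (hab : a + b = m) : partials (a + 2) b (fun x => g x 1) 0 = 0 := by
    have := (key hab).1
    rw [h 0 a b (by omega) (by simp [IsFree]), h' 0 a b (by omega) (by simp [IsFree])] at this
    linarith
  have k3 {a b : ℕ} (hab : a + b = m) : partials a (b + 2) (fun x => g x 0) 0 = 0 := by
    have := (key hab).2.2.2
    rw [h 3 a b (by omega) (by simp [IsFree]), h' 3 a b (by omega) (by simp [IsFree])] at this
    linarith
  have k1 {a b : ℕ} (hab : a + b = m) (hb : b < 2) : partials (a + 2) b (fun x => g x 0) 0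
      = 2 * partials (a + 1) (b + 1) (fun x => g x 1) 0 := by
    have := (key hab).2.1
    rw [h 1 a b (by omega) (by simp [IsFree, hb]), h' 1 a b (by omega) (by simp [IsFree, hb])]
      at this
    linarith
  have k2 {a b : ℕ} (hab : a + b = m) (ha : a < 2) : partials a (b + 2) (fun x => g x 1) 0
      = 2 * partials (a + 1) (b + 1) (fun x => g x 0) 0 := by
    have := (key hab).2.2.1
    rw [h 2 a b (by omega) (by simp [IsFree, ha]), h' 2 a b (by omega) (by simp [IsFree, ha])]
      at this
    linarith
  obtain ⟨l, rfl⟩ : ∃ l, m = l + 1 := ⟨m - 1, by omega⟩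
  have p12 : partials 1 (l + 2) (fun x => g x 1) 0 = 0 ∧
      partials (l + 2) 1 (fun x => g x 0) 0 = 0 := by
    have e1 := k1 (a := l) (b := 1) rfl (by omega)
    have e2 := k2 (a := 1) (b := l) (by omega) (by omega)
    -- For `m = 1` the two mixed coefficients satisfy `X = 2Y` and `Y = 2X`, hence vanish. For
    -- larger `m` the equations decouple, their right-hand sides being already known to be zero.
    rcases l with _ | l
    · simp only [zero_add] at e1 e2 ⊢
      constructor <;> linarith
    · have e3 := k0 (a := l) (b := 2) (by omega)
      have e4 := k3 (a := 2) (b := l) (by omega)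
      rw [e3] at e1
      rw [e4] at e2
      exact ⟨by linarith, by linarith⟩
  refine tangent_succ hg fun i a b hab => ?_
  fin_cases i
  · simp only [Fin.zero_eta]
    rcases b with _ | _ | b
    · obtain rfl : a = l + 1 + 2 := by omega
      rw [k1 (a := l + 1) (b := 0) rfl (by omega), k0 (a := l) (b := 1) rfl, mul_zero]
    · obtain rfl : a = l + 2 := by omega
      exact p12.2
    · exact k3 (by omega)
  · simp only [Fin.mk_one]
    rcases a with _ | _ | a
    · obtain rfl : b = l + 1 + 2 := by omega
      rw [k2 (a := 0) (b := l + 1) (by omega) (by omega), k3 (a := 1) (b := l) (by omega), mul_zero]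
    · obtain rfl : b = l + 2 := by omega
      exact p12.1
    · exact k0 (by omega)

/-- Jets in normal form which are equivalent under point transformations coincide. -/
theorem PointEquiv.partials_eq {T' : Base → Fib} (hTT' : PointEquiv T 0 T' 0)
    (hT : SmoothSectionNear T 0) {n : ℕ} (h : Reduced (n + 1) T) (h' : Reduced (n + 1) T')
    (c : Calibrated T) (c' : Calibrated T') (i : Fin 4) {a b : ℕ} (hab : a + b ≤ n) :
    partials a b (fun x => T' x i) 0 = partials a b (fun x => T x i) 0 := by
  obtain ⟨g, hg, g0, hj, e⟩ := hTT'
  have ei (i : Fin 4) : (fun x => T' x i) =ᶠ[𝓝 0] fun x => pullSection T g x i :=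
    e.fun_comp fun u => u i
  have hR : Reduced (n + 1) (pullSection T g) := fun i a b hab hi => by
    rw [← partials_congr (ei i)]; exact h' i a b hab hi
  have hC : Calibrated (pullSection T g) :=
    ⟨(F_congr e).1 ▸ c'.F1, (F_congr e).2 ▸ c'.F2, pd_congr (F1_congr e) 0 ▸ c'.F1x,
      pd_congr (F1_congr e) 1 ▸ c'.F1y, pd_congr (F2_congr e) 0 ▸ c'.F2x,
      pd_congr (F2_congr e) 1 ▸ c'.F2y⟩
  have h3 := tangent_of_calibrated hT c (h.mono (by omega)) hC (hR.mono (by omega)) hg g0 hj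
  have hm (m : ℕ) (hm : m ≤ n) : ∀ i, VanishesAt (m + 3) (fun x => g x i - x i) 0 := by
    induction m with
    | zero => exact h3
    | succ m ih =>
      exact tangent_succ_of_reduced (by omega) hT (h.mono (by omega)) (hR.mono (by omega)) g0
        (ih (by omega))
  -- Coordinates of order `n` feel Taylor coefficients of `g` up to order `n + 2`, so agreement with
  -- the identity through that order makes the two jets equal.
  have ht := hm n le_rfl
  have z (i : Fin 2) {c d : ℕ} (h2 : 2 ≤ c + d) (hcd : c + d < n + 3) :
      partials c d (fun x => g x i) 0 = 0 := partials_of_tangent (m := n + 1) ht i h2 hcd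
  obtain ⟨e0, e1, e2, e3⟩ := partials_pullSection_of_tangent (m := n + 1) g0 hT ht
    (a := a) (b := b) (by omega)
  simp only [z _ (show 2 ≤ a + 2 + b by omega) (by omega),
    z _ (show 2 ≤ a + 1 + (b + 1) by omega) (by omega),
    z _ (show 2 ≤ a + (b + 2) by omega) (by omega), sub_zero, mul_zero, add_zero] at e0 e1 e2 e3
  rw [partials_congr (ei i)]
  fin_cases i
  exacts [e0, e1, e2, e3]

end uniqueness

/-! ### Polynomial changes of variables -/

/-- The polynomial with Taylor coefficients `c a b`, `a, b ≤ n`, at the origin. -/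
noncomputable def polyFun (n : ℕ) (c : ℕ → ℕ → ℝ) (x : Base) : ℝ :=
  ∑ ab ∈ Finset.range (n + 1) ×ˢ Finset.range (n + 1), c ab.1 ab.2 * mono ab.1 ab.2 x

theorem polyFun_smooth (n : ℕ) (c : ℕ → ℕ → ℝ) (p : Base) : SmoothNear (polyFun n c) p :=
  .sum fun _ _ => (SmoothNear.const _ p).mul (mono_smooth _ _ p)

theorem partials_polyFun {n : ℕ} {c : ℕ → ℕ → ℝ} {a b : ℕ} (ha : a ≤ n) (hb : b ≤ n) :
    partials a b (polyFun n c) 0 = c a b := by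
  have h := partials_sum (s := Finset.range (n + 1) ×ˢ Finset.range (n + 1))
    (f := fun ab x => c ab.1 ab.2 * mono ab.1 ab.2 x) (p := 0)
    (fun _ _ => (SmoothNear.const _ 0).mul (mono_smooth _ _ 0)) a b
  refine Eq.trans h ?_
  simp only [partials_const_mul (mono_smooth _ _ _), partials_mono]
  rw [Finset.sum_eq_single (a, b)]
  · simp
  · rintro ⟨a', b'⟩ - hne
    rw [if_neg, mul_zero]
    rintro ⟨rfl, rfl⟩
    exact hne rfl
  · intro h
    simp at h
    omega

/-- The polynomial map with the given Taylor coefficients at the origin. -/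
noncomputable def polyMap (n : ℕ) (φ ψ : ℕ → ℕ → ℝ) (x : Base) : Base :=
  ![polyFun n φ x, polyFun n ψ x]

theorem polyMap_smooth (n : ℕ) (φ ψ : ℕ → ℕ → ℝ) (p : Base) : SmoothMapNear (polyMap n φ ψ) p := by
  intro i
  fin_cases i
  exacts [polyFun_smooth n φ p, polyFun_smooth n ψ p]

theorem polyMap_zero {n : ℕ} {φ ψ : ℕ → ℕ → ℝ} (hφ : φ 0 0 = 0) (hψ : ψ 0 0 = 0) :
    polyMap n φ ψ 0 = 0 := by
  funext i
  fin_cases i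
  exacts [(partials_polyFun (a := 0) (b := 0) (Nat.zero_le n) (Nat.zero_le n)).trans hφ,
    (partials_polyFun (a := 0) (b := 0) (Nat.zero_le n) (Nat.zero_le n)).trans hψ]

theorem jac_polyMap {n : ℕ} (hn : 1 ≤ n) (φ ψ : ℕ → ℕ → ℝ) :
    jac (polyMap n φ ψ) 0 = φ 1 0 * ψ 0 1 - φ 0 1 * ψ 1 0 := by
  have h (c : ℕ → ℕ → ℝ) : pd 0 (polyFun n c) 0 = c 1 0 ∧ pd 1 (polyFun n c) 0 = c 0 1 :=
    ⟨partials_polyFun (a := 1) (b := 0) hn (Nat.zero_le n),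
      partials_polyFun (a := 0) (b := 1) (Nat.zero_le n) hn⟩
  change pd 0 (polyFun n φ) 0 * pd 1 (polyFun n ψ) 0
    - pd 1 (polyFun n φ) 0 * pd 0 (polyFun n ψ) 0 = _
  rw [(h φ).1, (h φ).2, (h ψ).1, (h ψ).2]

/-! ### Smooth families of germs -/

section families

variable {E : Type*} [NormedAddCommGroup E] [NormedSpace ℝ E]

/-- The family `f` of functions is jointly smooth at `(θ, 0)`. -/
def SmoothFamilyAt (f : E → Base → ℝ) (θ : E) : Prop :=
  ContDiffAt ℝ ∞ (fun z : E × Base => f z.1 z.2) (θ, 0)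

namespace SmoothFamilyAt

variable {f g : E → Base → ℝ} {θ : E}

theorem of_param {c : E → ℝ} (h : ContDiffAt ℝ ∞ c θ) : SmoothFamilyAt (fun θ _ => c θ) θ :=
  ContDiffAt.comp (θ, (0 : Base)) h contDiffAt_fst

theorem of_fun {c : Base → ℝ} (h : ContDiffAt ℝ ∞ c 0) : SmoothFamilyAt (fun _ x => c x) θ :=
  ContDiffAt.comp (θ, (0 : Base)) h contDiffAt_snd

theorem const (c : ℝ) : SmoothFamilyAt (fun _ _ => c) θ := contDiffAt_const

theorem add (hf : SmoothFamilyAt f θ) (hg : SmoothFamilyAt g θ) :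
    SmoothFamilyAt (fun θ x => f θ x + g θ x) θ := ContDiffAt.add hf hg

theorem sub (hf : SmoothFamilyAt f θ) (hg : SmoothFamilyAt g θ) :
    SmoothFamilyAt (fun θ x => f θ x - g θ x) θ := ContDiffAt.sub hf hg

theorem mul (hf : SmoothFamilyAt f θ) (hg : SmoothFamilyAt g θ) :
    SmoothFamilyAt (fun θ x => f θ x * g θ x) θ := ContDiffAt.mul hf hg

theorem pow (hf : SmoothFamilyAt f θ) (n : ℕ) :
    SmoothFamilyAt (fun θ x => f θ x ^ n) θ := ContDiffAt.pow hf n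

theorem div (hf : SmoothFamilyAt f θ) (hg : SmoothFamilyAt g θ) (h0 : g θ 0 ≠ 0) :
    SmoothFamilyAt (fun θ x => f θ x / g θ x) θ := ContDiffAt.div hf hg h0

theorem pd (hf : SmoothFamilyAt f θ) (j : Fin 2) : SmoothFamilyAt (fun θ => pd j (f θ)) θ := by
  have h : ContDiffAt ℝ ∞ (fun z : E × Base => fderiv ℝ (f z.1) z.2) (θ, 0) := by
    refine ContDiffAt.fderiv (f := fun (z : E × Base) y => f z.1 y) (n := ∞) ?_ contDiffAt_snd
      (by simp)
    have e : Function.uncurry (fun (z : E × Base) y => f z.1 y)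
        = (fun z : E × Base => f z.1 z.2) ∘ fun w : (E × Base) × Base => (w.1.1, w.2) := rfl
    rw [e]
    exact ContDiffAt.comp ((θ, (0 : Base)), (0 : Base)) hf
      ((contDiffAt_fst.fst).prodMk contDiffAt_snd)
  exact h.clm_apply contDiffAt_const

theorem partials (hf : SmoothFamilyAt f θ) (a b : ℕ) :
    SmoothFamilyAt (fun θ => partials a b (f θ)) θ := by
  have h1 : SmoothFamilyAt (fun θ => CubicODE.partials 0 b (f θ)) θ := by
    induction b generalizing f with
    | zero => exact hf
    | succ b ih => exact ih (hf.pd 1)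
  induction a with
  | zero => exact h1
  | succ a ih => simp only [partials_succ_left]; exact ih.pd 0

theorem eval (hf : SmoothFamilyAt f θ) : ContDiffAt ℝ ∞ (fun θ => f θ 0) θ :=
  ContDiffAt.comp θ (g := fun z : E × Base => f z.1 z.2) (f := fun θ => (θ, (0 : Base))) hf
    (contDiffAt_id.prodMk contDiffAt_const)

theorem comp (hf : SmoothFamilyAt f θ) {g : E → Base → Base}
    (hg : ∀ i, SmoothFamilyAt (fun θ x => g θ x i) θ) (h0 : g θ 0 = 0) :
    SmoothFamilyAt (fun θ x => f θ (g θ x)) θ := by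
  have hg' : ContDiffAt ℝ ∞ (fun z : E × Base => (z.1, g z.1 z.2)) (θ, 0) :=
    contDiffAt_fst.prodMk (contDiffAt_pi.2 hg)
  have hf' : ContDiffAt ℝ ∞ (fun z : E × Base => f z.1 z.2) (θ, g θ 0) := by rw [h0]; exact hf
  exact ContDiffAt.comp (θ, (0 : Base)) hf' hg'

theorem sum {ι : Type*} {s : Finset ι} {f : ι → E → Base → ℝ}
    (hf : ∀ i ∈ s, SmoothFamilyAt (f i) θ) : SmoothFamilyAt (fun θ x => ∑ i ∈ s, f i θ x) θ :=
  ContDiffAt.sum hf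

end SmoothFamilyAt

/-- The family `T` of sections is jointly smooth at `(θ, 0)` and its member `T θ` is smooth
near `0`. -/
structure SmoothSectionFamilyAt (T : E → Base → Fib) (θ : E) : Prop where
  family : ∀ i, SmoothFamilyAt (fun θ x => T θ x i) θ
  smooth : SmoothSectionNear (T θ) 0

variable {T : E → Base → Fib} {θ : E}

theorem SmoothSectionFamilyAt.F1 (h : SmoothSectionFamilyAt T θ) :
    SmoothFamilyAt (fun θ => F1 (T θ)) θ := by
  have h1 (i : Fin 4) (j : Fin 2) : SmoothFamilyAt (fun θ => pd j fun x => T θ x i) θ :=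
    (h.family i).pd j
  have h2 (i : Fin 4) (j k : Fin 2) :
      SmoothFamilyAt (fun θ => pd k (pd j fun x => T θ x i)) θ := (h1 i j).pd k
  change SmoothFamilyAt (fun θ x => CubicODE.F1 (T θ) x) θ
  simp only [CubicODE.F1]
  repeat first
    | exact h.family _ | exact h1 _ _ | exact h2 _ _ _ | exact SmoothFamilyAt.const _
    | with_reducible apply SmoothFamilyAt.sub | with_reducible apply SmoothFamilyAt.add
    | with_reducible apply SmoothFamilyAt.mul

theorem SmoothSectionFamilyAt.F2 (h : SmoothSectionFamilyAt T θ) :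
    SmoothFamilyAt (fun θ => F2 (T θ)) θ := by
  have h1 (i : Fin 4) (j : Fin 2) : SmoothFamilyAt (fun θ => pd j fun x => T θ x i) θ :=
    (h.family i).pd j
  have h2 (i : Fin 4) (j k : Fin 2) :
      SmoothFamilyAt (fun θ => pd k (pd j fun x => T θ x i)) θ := (h1 i j).pd k
  change SmoothFamilyAt (fun θ x => CubicODE.F2 (T θ) x) θ
  simp only [CubicODE.F2]
  repeat first
    | exact h.family _ | exact h1 _ _ | exact h2 _ _ _ | exact SmoothFamilyAt.const _
    | with_reducible apply SmoothFamilyAt.sub | with_reducible apply SmoothFamilyAt.add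
    | with_reducible apply SmoothFamilyAt.mul

theorem SmoothSectionFamilyAt.F3 (h : SmoothSectionFamilyAt T θ) :
    SmoothFamilyAt (fun θ => F3 (T θ)) θ := by
  have h1 := h.F1
  have h2 := h.F2
  have d1 (j : Fin 2) := h1.pd j
  have d2 (j : Fin 2) := h2.pd j
  change SmoothFamilyAt (fun θ x => CubicODE.F3 (T θ) x) θ
  simp only [CubicODE.F3]
  repeat first
    | exact h.family _ | exact h1 | exact h2 | exact d1 _ | exact d2 _
    | with_reducible apply SmoothFamilyAt.sub | with_reducible apply SmoothFamilyAt.add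
    | with_reducible apply SmoothFamilyAt.mul | with_reducible apply SmoothFamilyAt.pow

theorem smoothFamilyAt_polyFun {n : ℕ} {c : E → ℕ → ℕ → ℝ}
    (hc : ∀ a b, ContDiffAt ℝ ∞ (fun θ => c θ a b) θ) :
    SmoothFamilyAt (fun θ => polyFun n (c θ)) θ :=
  SmoothFamilyAt.sum fun _ _ => (SmoothFamilyAt.of_param (hc _ _)).mul
    (.of_fun (mono_contDiff _ _).contDiffAt)

/-- Pulling back a smooth family of sections along a smooth family of maps fixing the origin. -/
theorem SmoothSectionFamilyAt.pullSection_map (h : SmoothSectionFamilyAt T θ) {g : E → Base → Base}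
    (hgf : ∀ i, SmoothFamilyAt (fun θ x => g θ x i) θ) (hg : SmoothMapNear (g θ) 0)
    (g0 : g θ 0 = 0) (hj : jac (g θ) 0 ≠ 0) :
    SmoothSectionFamilyAt (fun θ => pullSection (T θ) (g θ)) θ := by
  refine ⟨?_, SmoothSectionNear.pullSection (by rw [g0]; exact h.smooth) hg hj⟩
  have hu (i : Fin 4) : SmoothFamilyAt (fun θ x => T θ (g θ x) i) θ := (h.family i).comp hgf g0
  have h1 (i j : Fin 2) : SmoothFamilyAt (fun θ => pd j fun x => g θ x i) θ := (hgf i).pd j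
  have h2 (i j k : Fin 2) :
      SmoothFamilyAt (fun θ => pd k (pd j fun x => g θ x i)) θ := (h1 i j).pd k
  intro i
  fin_cases i <;>
  · refine SmoothFamilyAt.div ?_ (((h1 0 0).mul (h1 1 1)).sub ((h1 0 1).mul (h1 1 0))) hj
    repeat first
      | exact hu _ | exact h1 _ _ | exact h2 _ _ _ | exact SmoothFamilyAt.const _
      | with_reducible apply SmoothFamilyAt.sub | with_reducible apply SmoothFamilyAt.add
      | with_reducible apply SmoothFamilyAt.mul | with_reducible apply SmoothFamilyAt.pow

/-- Pulling back a smooth family of sections along a smooth family of polynomial maps. -/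
theorem SmoothSectionFamilyAt.pullSection (h : SmoothSectionFamilyAt T θ) {n : ℕ} (hn : 1 ≤ n)
    {φ ψ : E → ℕ → ℕ → ℝ} (hφ : ∀ a b, ContDiffAt ℝ ∞ (fun θ => φ θ a b) θ)
    (hψ : ∀ a b, ContDiffAt ℝ ∞ (fun θ => ψ θ a b) θ) (φ0 : φ θ 0 0 = 0) (ψ0 : ψ θ 0 0 = 0)
    (hj : φ θ 1 0 * ψ θ 0 1 - φ θ 0 1 * ψ θ 1 0 ≠ 0) :
    SmoothSectionFamilyAt (fun θ => pullSection (T θ) (polyMap n (φ θ) (ψ θ))) θ ∧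
      PointEquiv (T θ) 0 (CubicODE.pullSection (T θ) (polyMap n (φ θ) (ψ θ))) 0 := by
  have g0 := polyMap_zero (n := n) φ0 ψ0
  have hg := polyMap_smooth n (φ θ) (ψ θ) 0
  rw [← jac_polyMap hn] at hj
  refine ⟨h.pullSection_map (fun i => ?_) hg g0 hj, _, hg, g0, hj, Filter.EventuallyEq.rfl⟩
  fin_cases i
  exacts [smoothFamilyAt_polyFun hφ, smoothFamilyAt_polyFun hψ]

end families

/-! ### Quadratic changes of variables -/

/-- Taylor coefficients of a quadratic function vanishing at the origin. -/
def quadCoef (a b α β γ : ℝ) : ℕ → ℕ → ℝ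
  | 1, 0 => a
  | 0, 1 => b
  | 2, 0 => α
  | 1, 1 => β
  | 0, 2 => γ
  | _, _ => 0

/-- A quadratic change of variables with fixed origin. -/
noncomputable def quadMap (a b α β γ c d κ μ ν : ℝ) : Base → Base :=
  polyMap 2 (quadCoef a b α β γ) (quadCoef c d κ μ ν)

section quadratic

variable (a b α β γ c d κ μ ν : ℝ)

theorem quadMap_zero : quadMap a b α β γ c d κ μ ν 0 = 0 := polyMap_zero rfl rfl

theorem quadMap_smooth (p : Base) : SmoothMapNear (quadMap a b α β γ c d κ μ ν) p :=
  polyMap_smooth _ _ _ p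

theorem jac_quadMap : jac (quadMap a b α β γ c d κ μ ν) 0 = a * d - b * c :=
  jac_polyMap (by norm_num) _ _

theorem pd_polyFun_quadCoef : pd 0 (polyFun 2 (quadCoef a b α β γ)) 0 = a ∧
    pd 1 (polyFun 2 (quadCoef a b α β γ)) 0 = b ∧
    pd 0 (pd 0 (polyFun 2 (quadCoef a b α β γ))) 0 = α ∧
    pd 0 (pd 1 (polyFun 2 (quadCoef a b α β γ))) 0 = β ∧
    pd 1 (pd 0 (polyFun 2 (quadCoef a b α β γ))) 0 = β ∧
    pd 1 (pd 1 (polyFun 2 (quadCoef a b α β γ))) 0 = γ := by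
  have h (i j : ℕ) (hi : i ≤ 2) (hj : j ≤ 2) :=
    partials_polyFun (c := quadCoef a b α β γ) hi hj
  refine ⟨h 1 0 ?_ ?_, h 0 1 ?_ ?_, h 2 0 ?_ ?_, h 1 1 ?_ ?_,
    (pd_comm (polyFun_smooth _ _ 0)).trans (h 1 1 ?_ ?_), h 0 2 ?_ ?_⟩ <;> norm_num

variable {T : Base → Fib}

theorem pullSection_quadMap :
    pullSection T (quadMap a b α β γ c d κ μ ν) 0 = coeffs (T 0) a b c d α β γ κ μ ν := by
  obtain ⟨h1, h2, h3, h4, h5, h6⟩ := pd_polyFun_quadCoef a b α β γ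
  obtain ⟨k1, k2, k3, k4, k5, k6⟩ := pd_polyFun_quadCoef c d κ μ ν
  have e0 : (fun r => quadMap a b α β γ c d κ μ ν r 0) = polyFun 2 (quadCoef a b α β γ) := rfl
  have e1 : (fun r => quadMap a b α β γ c d κ μ ν r 1) = polyFun 2 (quadCoef c d κ μ ν) := rfl
  rw [pullSection_eq, e0, e1, h1, h2, h3, h4, h6, k1, k2, k3, k4, k6, quadMap_zero]

/-- The calibrated quantities see a change of variables only through its 2-jet, so quadratic maps
suffice for calibration. -/
theorem F_quadMap (hT : SmoothSectionNear T 0) (hj : a * d - b * c ≠ 0) :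
    F1 (pullSection T (quadMap a b α β γ c d κ μ ν)) 0
      = (a * d - b * c) * (a * F1 T 0 + c * F2 T 0) ∧
    F2 (pullSection T (quadMap a b α β γ c d κ μ ν)) 0
      = (a * d - b * c) * (b * F1 T 0 + d * F2 T 0) ∧
    F3 (pullSection T (quadMap a b α β γ c d κ μ ν)) 0 = (a * d - b * c) ^ 5 * F3 T 0 ∧
    pd 0 (F1 (pullSection T (quadMap a b α β γ c d κ μ ν))) 0
      = (α * d + a * μ - (β * c + b * κ)) * (a * F1 T 0 + c * F2 T 0)
        + (a * d - b * c) * (α * F1 T 0 + a * (pd 0 (F1 T) 0 * a + pd 1 (F1 T) 0 * c)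
          + (κ * F2 T 0 + c * (pd 0 (F2 T) 0 * a + pd 1 (F2 T) 0 * c))) ∧
    pd 1 (F1 (pullSection T (quadMap a b α β γ c d κ μ ν))) 0
      = (β * d + a * ν - (γ * c + b * μ)) * (a * F1 T 0 + c * F2 T 0)
        + (a * d - b * c) * (β * F1 T 0 + a * (pd 0 (F1 T) 0 * b + pd 1 (F1 T) 0 * d)
          + (μ * F2 T 0 + c * (pd 0 (F2 T) 0 * b + pd 1 (F2 T) 0 * d))) ∧
    pd 0 (F2 (pullSection T (quadMap a b α β γ c d κ μ ν))) 0
      = (α * d + a * μ - (β * c + b * κ)) * (b * F1 T 0 + d * F2 T 0)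
        + (a * d - b * c) * (β * F1 T 0 + b * (pd 0 (F1 T) 0 * a + pd 1 (F1 T) 0 * c)
          + (μ * F2 T 0 + d * (pd 0 (F2 T) 0 * a + pd 1 (F2 T) 0 * c))) ∧
    pd 1 (F2 (pullSection T (quadMap a b α β γ c d κ μ ν))) 0
      = (β * d + a * ν - (γ * c + b * μ)) * (b * F1 T 0 + d * F2 T 0)
        + (a * d - b * c) * (γ * F1 T 0 + b * (pd 0 (F1 T) 0 * b + pd 1 (F1 T) 0 * d)
          + (ν * F2 T 0 + d * (pd 0 (F2 T) 0 * b + pd 1 (F2 T) 0 * d))) := by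
  obtain ⟨h1, h2, h3, h4, h5, h6⟩ := pd_polyFun_quadCoef a b α β γ
  obtain ⟨k1, k2, k3, k4, k5, k6⟩ := pd_polyFun_quadCoef c d κ μ ν
  have e0 : (fun r => quadMap a b α β γ c d κ μ ν r 0) = polyFun 2 (quadCoef a b α β γ) := rfl
  have e1 : (fun r => quadMap a b α β γ c d κ μ ν r 1) = polyFun 2 (quadCoef c d κ μ ν) := rfl
  have hg := quadMap_smooth a b α β γ c d κ μ ν 0
  have hS : SmoothSectionNear T (quadMap a b α β γ c d κ μ ν 0) := by rwa [quadMap_zero]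
  have hj' : jac (quadMap a b α β γ c d κ μ ν) 0 ≠ 0 := by rwa [jac_quadMap]
  have l := F_pullSection hS hg hj'
  have l3 := F3_pullSection hS hg hj'
  have l4 := pd_F1_pullSection hS hg hj' 0
  have l5 := pd_F1_pullSection hS hg hj' 1
  have l6 := pd_F2_pullSection hS hg hj' 0
  have l7 := pd_F2_pullSection hS hg hj' 1
  rw [pd_jac hg] at l4 l5 l6 l7
  simp only [e0, e1, h1, h2, h3, h4, h5, h6, k1, k2, k3, k4, k5, k6, quadMap_zero, jac_quadMap]
    at l l3 l4 l5 l6 l7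
  exact ⟨l.1, l.2, l3, l4, l5, l6, l7⟩

end quadratic

/-! ### Existence of the normal form -/

section existence

variable {E : Type*} [NormedAddCommGroup E] [NormedSpace ℝ E]

theorem contDiffAt_quadCoef {a b α β γ : E → ℝ} {θ : E} (ha : ContDiffAt ℝ ∞ a θ)
    (hb : ContDiffAt ℝ ∞ b θ) (hα : ContDiffAt ℝ ∞ α θ) (hβ : ContDiffAt ℝ ∞ β θ)
    (hγ : ContDiffAt ℝ ∞ γ θ) (i j : ℕ) :
    ContDiffAt ℝ ∞ (fun θ => quadCoef (a θ) (b θ) (α θ) (β θ) (γ θ) i j) θ := by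
  rcases i with _ | _ | _ | i <;> rcases j with _ | _ | _ | j <;>
    first | exact contDiffAt_const | assumption

/-- A smooth family of sections `T` over `M` can be transformed to a smooth family with the
property `P`. -/
def Normalizable (M : Set E) (T : E → Base → Fib) (P : (Base → Fib) → Prop) : Prop :=
  ∃ T' : E → Base → Fib, ∀ θ ∈ M,
    SmoothSectionFamilyAt T' θ ∧ PointEquiv (T θ) 0 (T' θ) 0 ∧ P (T' θ)

theorem Normalizable.trans {M : Set E} {T : E → Base → Fib} {P Q : (Base → Fib) → Prop}
    (h : Normalizable M T P)
    (h' : ∀ T' : E → Base → Fib, (∀ θ ∈ M, SmoothSectionFamilyAt T' θ ∧ P (T' θ)) →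
      Normalizable M T' Q) : Normalizable M T Q := by
  obtain ⟨T', hT'⟩ := h
  obtain ⟨T'', hT''⟩ := h' T' fun θ hθ => ⟨(hT' θ hθ).1, (hT' θ hθ).2.2⟩
  exact ⟨T'', fun θ hθ => ⟨(hT'' θ hθ).1, (hT' θ hθ).2.1.trans (hT'' θ hθ).2.1, (hT'' θ hθ).2.2⟩⟩

theorem normalizable_quadMap {M : Set E} {T : E → Base → Fib}
    (hT : ∀ θ ∈ M, SmoothSectionFamilyAt T θ) {a b α β γ c d κ μ ν : E → ℝ}
    (ha : ∀ θ ∈ M, ContDiffAt ℝ ∞ a θ) (hb : ∀ θ ∈ M, ContDiffAt ℝ ∞ b θ)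
    (hα : ∀ θ ∈ M, ContDiffAt ℝ ∞ α θ) (hβ : ∀ θ ∈ M, ContDiffAt ℝ ∞ β θ)
    (hγ : ∀ θ ∈ M, ContDiffAt ℝ ∞ γ θ) (hc : ∀ θ ∈ M, ContDiffAt ℝ ∞ c θ)
    (hd : ∀ θ ∈ M, ContDiffAt ℝ ∞ d θ) (hκ : ∀ θ ∈ M, ContDiffAt ℝ ∞ κ θ)
    (hμ : ∀ θ ∈ M, ContDiffAt ℝ ∞ μ θ) (hν : ∀ θ ∈ M, ContDiffAt ℝ ∞ ν θ)
    (hj : ∀ θ ∈ M, a θ * d θ - b θ * c θ ≠ 0) {P : (Base → Fib) → Prop}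
    (hP : ∀ θ ∈ M, P (pullSection (T θ) (quadMap (a θ) (b θ) (α θ) (β θ) (γ θ) (c θ) (d θ) (κ θ)
      (μ θ) (ν θ)))) : Normalizable M T P := by
  refine ⟨fun θ => pullSection (T θ) (quadMap (a θ) (b θ) (α θ) (β θ) (γ θ) (c θ) (d θ) (κ θ)
    (μ θ) (ν θ)), fun θ hθ => ?_⟩
  have := (hT θ hθ).pullSection (n := 2) (by norm_num)
    (contDiffAt_quadCoef (ha θ hθ) (hb θ hθ) (hα θ hθ) (hβ θ hθ) (hγ θ hθ))
    (contDiffAt_quadCoef (hc θ hθ) (hd θ hθ) (hκ θ hθ) (hμ θ hθ) (hν θ hθ)) rfl rfl (hj θ hθ)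
  exact ⟨this.1, this.2, hP θ hθ⟩

/-- A smooth function on the nonzero reals with `δ(F)⁵ F = 1`. -/
noncomputable def invFifthRoot (F : ℝ) : ℝ := F * (F ^ 2) ^ (-(3 / 5) : ℝ)

/-- The factor `(F²)^(-3/5)` has fifth power `F⁻⁶`. Taking the real power of `F²` rather than of `F`
covers both signs and keeps the function smooth away from zero. -/
theorem invFifthRoot_pow {F : ℝ} (hF : F ≠ 0) : invFifthRoot F ^ 5 * F = 1 := by
  have h2 : 0 < F ^ 2 := by positivity
  have h : ((F ^ 2) ^ (-(3 / 5) : ℝ)) ^ 5 = ((F ^ 2) ^ 3)⁻¹ := by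
    have e : (-(3 / 5) : ℝ) * (5 : ℕ) = -((3 : ℕ) : ℝ) := by norm_num
    rw [← Real.rpow_natCast _ 5, ← Real.rpow_mul h2.le, e, Real.rpow_neg h2.le, Real.rpow_natCast]
  rw [invFifthRoot, mul_pow, h]
  field_simp

theorem contDiffAt_invFifthRoot {F : ℝ} (hF : F ≠ 0) : ContDiffAt ℝ ∞ invFifthRoot F := by
  have h2 : F ^ 2 ≠ 0 := by positivity
  exact contDiffAt_id.mul ((contDiffAt_id.pow 2).rpow_const_of_ne h2)

/-- Every term of `F3` contains `F1` or `F2`, so these do not vanish together. With `δ⁵ F3 = 1`, the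
second column of the linear map is chosen in the kernel of the covector `(F1, F2)`, and the first is
a multiple of that covector scaled to give determinant `δ` and new value `F1 = 1`. -/
theorem normalizable_linear {M : Set E} {T : E → Base → Fib}
    (hT : ∀ θ ∈ M, SmoothSectionFamilyAt T θ) (h3 : ∀ θ ∈ M, F3 (T θ) 0 ≠ 0) :
    Normalizable M T fun T => F1 T 0 = 1 ∧ F2 T 0 = 0 ∧ F3 T 0 = 1 := by
  let δ (θ : E) : ℝ := invFifthRoot (F3 (T θ) 0)
  let l (θ : E) : ℝ := F1 (T θ) 0
  let m (θ : E) : ℝ := F2 (T θ) 0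
  have hδ : ∀ θ ∈ M, ContDiffAt ℝ ∞ δ θ := fun θ hθ =>
    ContDiffAt.comp θ (contDiffAt_invFifthRoot (h3 θ hθ)) (hT θ hθ).F3.eval
  have hl : ∀ θ ∈ M, ContDiffAt ℝ ∞ l θ := fun θ hθ => (hT θ hθ).F1.eval
  have hm : ∀ θ ∈ M, ContDiffAt ℝ ∞ m θ := fun θ hθ => (hT θ hθ).F2.eval
  have δ5 : ∀ θ ∈ M, δ θ ^ 5 * F3 (T θ) 0 = 1 := fun θ hθ => invFifthRoot_pow (h3 θ hθ)
  have δ0 : ∀ θ ∈ M, δ θ ≠ 0 := fun θ hθ h => by simpa [h] using δ5 θ hθ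
  have r0 : ∀ θ ∈ M, l θ ^ 2 + m θ ^ 2 ≠ 0 := fun θ hθ h => by
    have e1 : F1 (T θ) 0 = 0 := by
      have : l θ = 0 := by nlinarith [sq_nonneg (l θ), sq_nonneg (m θ)]
      exact this
    have e2 : F2 (T θ) 0 = 0 := by
      have : m θ = 0 := by nlinarith [sq_nonneg (l θ), sq_nonneg (m θ)]
      exact this
    exact h3 θ hθ (by simp [F3, e1, e2])
  have hr : ∀ θ ∈ M, ContDiffAt ℝ ∞ (fun θ => δ θ * (l θ ^ 2 + m θ ^ 2)) θ := fun θ hθ =>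
    (hδ θ hθ).mul (((hl θ hθ).pow 2).add ((hm θ hθ).pow 2))
  have hD : ∀ θ ∈ M, l θ / (δ θ * (l θ ^ 2 + m θ ^ 2)) * (δ θ ^ 2 * l θ)
      - -(δ θ ^ 2 * m θ) * (m θ / (δ θ * (l θ ^ 2 + m θ ^ 2))) = δ θ := fun θ hθ => by
    have := δ0 θ hθ
    have := r0 θ hθ
    field_simp
    ring
  have z (θ : E) : ContDiffAt ℝ ∞ (fun _ : E => (0 : ℝ)) θ := contDiffAt_const
  refine normalizable_quadMap hT (a := fun θ => l θ / (δ θ * (l θ ^ 2 + m θ ^ 2)))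
    (b := fun θ => -(δ θ ^ 2 * m θ)) (c := fun θ => m θ / (δ θ * (l θ ^ 2 + m θ ^ 2)))
    (d := fun θ => δ θ ^ 2 * l θ)
    (fun θ hθ => (hl θ hθ).div (hr θ hθ) (mul_ne_zero (δ0 θ hθ) (r0 θ hθ)))
    (fun θ hθ => (((hδ θ hθ).pow 2).mul (hm θ hθ)).neg) (fun θ _ => z θ) (fun θ _ => z θ)
    (fun θ _ => z θ) (fun θ hθ => (hm θ hθ).div (hr θ hθ) (mul_ne_zero (δ0 θ hθ) (r0 θ hθ)))
    (fun θ hθ => ((hδ θ hθ).pow 2).mul (hl θ hθ)) (fun θ _ => z θ) (fun θ _ => z θ)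
    (fun θ _ => z θ) (fun θ hθ => by rw [hD θ hθ]; exact δ0 θ hθ) fun θ hθ => ?_
  obtain ⟨f1, f2, f3, -⟩ := F_quadMap (l θ / (δ θ * (l θ ^ 2 + m θ ^ 2))) (-(δ θ ^ 2 * m θ)) 0 0 0
    (m θ / (δ θ * (l θ ^ 2 + m θ ^ 2))) (δ θ ^ 2 * l θ) 0 0 0 (hT θ hθ).smooth
    (by rw [hD θ hθ]; exact δ0 θ hθ)
  rw [hD θ hθ] at f1 f2 f3
  have d0 := δ0 θ hθ
  have s0 := r0 θ hθ
  refine ⟨f1.trans ?_, f2.trans ?_, f3.trans (δ5 θ hθ)⟩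
  · change δ θ * (_ * l θ + _ * m θ) = 1
    field_simp
  · change δ θ * (_ * l θ + _ * m θ) = 0
    ring

theorem reduced_one {T : Base → Fib} (h : ∀ i, T 0 i = 0) : Reduced 1 T := by
  intro i a b hab _
  obtain ⟨rfl, rfl⟩ : a = 0 ∧ b = 0 := by omega
  exact h i

/-- The inhomogeneous term of the fibre action lets second derivatives cancel all four values of the
section. Identity linear part preserves `F1`, `F2`, `F3`. The coefficients `β` and `μ` are still
disposable and are set to zero here. -/
theorem normalizable_quadratic {M : Set E} {T : E → Base → Fib}
    (hT : ∀ θ ∈ M, SmoothSectionFamilyAt T θ ∧ F1 (T θ) 0 = 1 ∧ F2 (T θ) 0 = 0 ∧ F3 (T θ) 0 = 1) :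
    Normalizable M T fun T => F1 T 0 = 1 ∧ F2 T 0 = 0 ∧ F3 T 0 = 1 ∧ Reduced 1 T := by
  have k (c : ℝ) (θ : E) : ContDiffAt ℝ ∞ (fun _ : E => c) θ := contDiffAt_const
  have hu (i : Fin 4) : ∀ θ ∈ M, ContDiffAt ℝ ∞ (fun θ => T θ 0 i) θ := fun θ hθ =>
    ((hT θ hθ).1.family i).eval
  refine normalizable_quadMap (fun θ hθ => (hT θ hθ).1) (a := fun _ => 1) (b := fun _ => 0)
    (α := fun θ => -T θ 0 1) (β := fun _ => 0) (γ := fun θ => -T θ 0 3) (c := fun _ => 0)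
    (d := fun _ => 1) (κ := fun θ => T θ 0 0) (μ := fun _ => 0) (ν := fun θ => T θ 0 2)
    (fun θ _ => k 1 θ) (fun θ _ => k 0 θ) (fun θ hθ => (hu 1 θ hθ).neg) (fun θ _ => k 0 θ)
    (fun θ hθ => (hu 3 θ hθ).neg) (fun θ _ => k 0 θ) (fun θ _ => k 1 θ) (hu 0)
    (fun θ _ => k 0 θ) (hu 2) (fun θ _ => by norm_num) fun θ hθ => ?_
  obtain ⟨hs, f1, f2, f3⟩ := hT θ hθ
  obtain ⟨e1, e2, e3, -⟩ := F_quadMap 1 0 (-T θ 0 1) 0 (-T θ 0 3) 0 1 (T θ 0 0) 0 (T θ 0 2)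
    hs.smooth (by norm_num)
  refine ⟨by rw [e1, f1, f2]; norm_num, by rw [e2, f1, f2]; norm_num, by rw [e3, f3]; norm_num,
    reduced_one fun i => ?_⟩
  rw [pullSection_quadMap]
  fin_cases i <;> simp [coeffs]

/-- A shear with parameter `c` changes both `∂F1/∂y` and `∂F2/∂x` by `-c`, so `∂F1/∂y - 4 ∂F2/∂x`
changes by `3c` and can be made zero. This combination is the one unaffected by the projective
quadratic terms used afterwards. -/
theorem normalizable_shear {M : Set E} {T : E → Base → Fib}
    (hT : ∀ θ ∈ M, SmoothSectionFamilyAt T θ ∧ F1 (T θ) 0 = 1 ∧ F2 (T θ) 0 = 0 ∧ F3 (T θ) 0 = 1 ∧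
      Reduced 1 (T θ)) :
    Normalizable M T fun T => F1 T 0 = 1 ∧ F2 T 0 = 0 ∧ pd 1 (F2 T) 0 = -1 ∧
      pd 1 (F1 T) 0 = 4 * pd 0 (F2 T) 0 ∧ Reduced 1 T := by
  have k (c : ℝ) (θ : E) : ContDiffAt ℝ ∞ (fun _ : E => c) θ := contDiffAt_const
  refine normalizable_quadMap (fun θ hθ => (hT θ hθ).1) (a := fun _ => 1) (b := fun _ => 0)
    (α := fun _ => 0) (β := fun _ => 0) (γ := fun _ => 0)
    (c := fun θ => (4 * pd 0 (F2 (T θ)) 0 - pd 1 (F1 (T θ)) 0) / 3)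
    (d := fun _ => 1) (κ := fun _ => 0) (μ := fun _ => 0) (ν := fun _ => 0)
    (fun θ _ => k 1 θ) (fun θ _ => k 0 θ) (fun θ _ => k 0 θ) (fun θ _ => k 0 θ) (fun θ _ => k 0 θ)
    (fun θ hθ => (((k 4 θ).mul ((hT θ hθ).1.F2.pd 0).eval).sub
      ((hT θ hθ).1.F1.pd 1).eval).div_const 3)
    (fun θ _ => k 1 θ) (fun θ _ => k 0 θ) (fun θ _ => k 0 θ) (fun θ _ => k 0 θ)
    (fun θ _ => by norm_num) fun θ hθ => ?_
  obtain ⟨hs, f1, f2, f3, h0⟩ := hT θ hθ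
  -- When the section vanishes and `(F1, F2) = (1, 0)`, `F3` equals `-∂F2/∂y`.
  have fy : pd 1 (F2 (T θ)) 0 = -1 := by
    rw [F3, f1, f2, h0.value, h0.value, h0.value, h0.value] at f3
    linarith
  obtain ⟨e1, e2, -, -, e5, e6, e7⟩ := F_quadMap 1 0 0 0 0
    ((4 * pd 0 (F2 (T θ)) 0 - pd 1 (F1 (T θ)) 0) / 3) 1 0 0 0 hs.smooth (by norm_num)
  rw [f1, f2] at e1 e2
  rw [f1, f2, fy] at e5 e6 e7
  refine ⟨by rw [e1]; ring, by rw [e2]; ring, by rw [e7]; ring, by rw [e5, e6]; ring,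
    reduced_one fun i => ?_⟩
  rw [pullSection_quadMap]
  fin_cases i <;> simp [coeffs, h0.value]

/-- The quadratic parts with `α = 2μ`, `ν = 2β`, `γ = κ = 0` keep the section zero. They add `5μ` to
`∂F1/∂x`, `β` to `∂F2/∂x` and `4β` to `∂F1/∂y`; the last two derivatives vanish together thanks to
the relation prepared by the shear. -/
theorem normalizable_projective {M : Set E} {T : E → Base → Fib}
    (hT : ∀ θ ∈ M, SmoothSectionFamilyAt T θ ∧ F1 (T θ) 0 = 1 ∧ F2 (T θ) 0 = 0 ∧
      pd 1 (F2 (T θ)) 0 = -1 ∧ pd 1 (F1 (T θ)) 0 = 4 * pd 0 (F2 (T θ)) 0 ∧ Reduced 1 (T θ)) :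
    Normalizable M T fun T => Calibrated T ∧ Reduced 1 T := by
  have k (c : ℝ) (θ : E) : ContDiffAt ℝ ∞ (fun _ : E => c) θ := contDiffAt_const
  have hs : ∀ θ ∈ M, ContDiffAt ℝ ∞ (fun θ => -(pd 0 (F1 (T θ)) 0 / 5)) θ := fun θ hθ =>
    (((hT θ hθ).1.F1.pd 0).eval.div_const 5).neg
  have ht : ∀ θ ∈ M, ContDiffAt ℝ ∞ (fun θ => -pd 0 (F2 (T θ)) 0) θ := fun θ hθ =>
    ((hT θ hθ).1.F2.pd 0).eval.neg
  refine normalizable_quadMap (fun θ hθ => (hT θ hθ).1) (a := fun _ => 1) (b := fun _ => 0)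
    (α := fun θ => 2 * -(pd 0 (F1 (T θ)) 0 / 5)) (β := fun θ => -pd 0 (F2 (T θ)) 0)
    (γ := fun _ => 0) (c := fun _ => 0)
    (d := fun _ => 1) (κ := fun _ => 0) (μ := fun θ => -(pd 0 (F1 (T θ)) 0 / 5))
    (ν := fun θ => 2 * -pd 0 (F2 (T θ)) 0)
    (fun θ _ => k 1 θ) (fun θ _ => k 0 θ) (fun θ hθ => (k 2 θ).mul (hs θ hθ)) ht (fun θ _ => k 0 θ)
    (fun θ _ => k 0 θ) (fun θ _ => k 1 θ) (fun θ _ => k 0 θ) hs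
    (fun θ hθ => (k 2 θ).mul (ht θ hθ)) (fun θ _ => by norm_num) fun θ hθ => ?_
  obtain ⟨hs, f1, f2, fy, fxy, h0⟩ := hT θ hθ
  obtain ⟨e1, e2, -, e4, e5, e6, e7⟩ := F_quadMap 1 0 (2 * -(pd 0 (F1 (T θ)) 0 / 5))
    (-pd 0 (F2 (T θ)) 0) 0 0 1 0 (-(pd 0 (F1 (T θ)) 0 / 5)) (2 * -pd 0 (F2 (T θ)) 0) hs.smooth
    (by norm_num)
  rw [f1, f2] at e1 e2
  rw [f1, f2, fy] at e4 e5 e6 e7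
  rw [fxy] at e5
  refine ⟨⟨by rw [e1]; ring, by rw [e2]; ring, by rw [e4]; ring, by rw [e5]; ring,
    by rw [e6]; ring, by rw [e7]; ring⟩, reduced_one fun i => ?_⟩
  rw [pullSection_quadMap]
  fin_cases i <;> simp [coeffs, h0.value]

end existence

/-! ### Reduction of the higher order coordinates -/

/-- Taylor coefficients of order `m + 2` of the first component of the change of variables which
reduces the coordinates of order `m` of a section with the Taylor coefficients `D`. -/
noncomputable def reducingCoef₀ (m : ℕ) (D : Fin 4 → ℕ → ℕ → ℝ) (a b : ℕ) : ℝ :=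
  if 2 ≤ b then -D 3 a (b - 2)
  else if b = 1 then
    if m = 1 then (D 1 0 1 - 2 * D 2 1 0) / 3
    else 2 * D 0 (m - 2) 2 - D 1 (m - 1) 1
  else 2 * D 0 (m - 1) 1 - D 1 m 0

/-- Taylor coefficients of order `m + 2` of the second component of the change of variables which
reduces the coordinates of order `m` of a section with the Taylor coefficients `D`. -/
noncomputable def reducingCoef₁ (m : ℕ) (D : Fin 4 → ℕ → ℕ → ℝ) (a b : ℕ) : ℝ :=
  if 2 ≤ a then D 0 (a - 2) b
  else if a = 1 then
    if m = 1 then D 2 1 0 + 2 * ((D 1 0 1 - 2 * D 2 1 0) / 3)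
    else D 2 1 (m - 1) - 2 * D 3 2 (m - 2)
  else D 2 0 m - 2 * D 3 1 (m - 1)

/-- Taylor coefficients of the coordinate `xⁱ` plus a homogeneous polynomial of degree `n`. -/
noncomputable def tangentCoef (i : Fin 2) (n : ℕ) (c : ℕ → ℕ → ℝ) (a b : ℕ) : ℝ :=
  if a + b = n then c a b else if (i = 0 ∧ a = 1 ∧ b = 0) ∨ (i = 1 ∧ a = 0 ∧ b = 1) then 1 else 0

theorem coord_eq_mono (i : Fin 2) :
    (fun x : Base => x i) = if i = 0 then mono 1 0 else mono 0 1 := by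
  funext x
  fin_cases i <;> simp [mono]

theorem partials_coord_zero (i : Fin 2) (a b : ℕ) : partials a b (fun x => x i) 0
    = if (i = 0 ∧ a = 1 ∧ b = 0) ∨ (i = 1 ∧ a = 0 ∧ b = 1) then 1 else 0 := by
  rw [coord_eq_mono]
  fin_cases i <;> simp [partials_mono]

theorem polyFun_tangentCoef (i : Fin 2) (m : ℕ) (c : ℕ → ℕ → ℝ) :
    VanishesAt (m + 2) (fun x => polyFun (m + 2) (tangentCoef i (m + 2) c) x - x i) 0 := by
  refine vanishesAt_sub (polyFun_smooth _ _ 0) (.coord i 0) fun a b hab => ?_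
  rw [partials_polyFun (by omega) (by omega), tangentCoef, if_neg (by omega), partials_coord_zero]

theorem partials_polyFun_tangentCoef (i : Fin 2) (m : ℕ) (c : ℕ → ℕ → ℝ) {a b : ℕ}
    (hab : a + b = m + 2) : partials a b (polyFun (m + 2) (tangentCoef i (m + 2) c)) 0 = c a b := by
  rw [partials_polyFun (by omega) (by omega), tangentCoef, if_pos hab]

/-- Calibration involves only 2-jets of changes of variables, so the later reductions, which start
with cubic terms, do not disturb it. -/
theorem calibrated_of_tangent {T : Base → Fib} {g : Base → Base} (hT : SmoothSectionNear T 0)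
    (h : Calibrated T) (g0 : g 0 = 0) (hg : ∀ i, VanishesAt 3 (fun x => g x i - x i) 0) :
    Calibrated (pullSection T g) := by
  have hs := smoothMapNear_of_tangent hg
  have hS : SmoothSectionNear T (g 0) := by rwa [g0]
  have d1 (i j : Fin 2) : pd j (fun x => g x i) 0 = if i = j then 1 else 0 :=
    (agreeAt_pd_of_tangent (m := 1) hg i j).partials_eq (a := 0) (b := 0) (by norm_num)
  have d2 (i j : Fin 2) : pd 0 (pd j fun x => g x i) 0 = 0 ∧ pd 1 (pd j fun x => g x i) 0 = 0 := by
    have k := agreeAt_pd_of_tangent (m := 1) hg i j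
    have k0 := k.partials_eq (a := 1) (b := 0) (by norm_num)
    have k1 := k.partials_eq (a := 0) (b := 1) (by norm_num)
    simp only [partials, Function.iterate_zero, Function.iterate_one, id, pd_const] at k0 k1
    exact ⟨k0, k1⟩
  have hj : jac g 0 = 1 := jac_of_tangent (m := 1) hg
  have hj' : jac g 0 ≠ 0 := by rw [hj]; exact one_ne_zero
  have l := F_pullSection hS hs hj'
  have l0 := pd_F1_pullSection hS hs hj' 0
  have l1 := pd_F1_pullSection hS hs hj' 1
  have l2 := pd_F2_pullSection hS hs hj' 0
  have l3 := pd_F2_pullSection hS hs hj' 1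
  rw [pd_jac hs] at l0 l1 l2 l3
  simp only [d1, (d2 _ _).1, (d2 _ _).2, hj, g0, h.F1, h.F2, h.F1x, h.F1y, h.F2x, h.F2y] at l l0 l1 l2 l3
  constructor
  · rw [l.1]; norm_num
  · rw [l.2]; norm_num
  · rw [l0]; norm_num
  · rw [l1]; norm_num
  · rw [l2]; norm_num
  · rw [l3]; norm_num

/-- The change of variables which reduces the coordinates of order `m`. -/
noncomputable def reducingMap (m : ℕ) (D : Fin 4 → ℕ → ℕ → ℝ) : Base → Base :=
  polyMap (m + 2) (tangentCoef 0 (m + 2) (reducingCoef₀ m D))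
    (tangentCoef 1 (m + 2) (reducingCoef₁ m D))

theorem reducingMap_tangent (m : ℕ) (D : Fin 4 → ℕ → ℕ → ℝ) :
    ∀ i, VanishesAt (m + 2) (fun x => reducingMap m D x i - x i) 0 := by
  intro i
  fin_cases i
  exacts [polyFun_tangentCoef 0 m _, polyFun_tangentCoef 1 m _]

theorem reducingMap_zero (m : ℕ) (D : Fin 4 → ℕ → ℕ → ℝ) : reducingMap m D 0 = 0 :=
  polyMap_zero (by simp [tangentCoef]) (by simp [tangentCoef])

/-- The reducing coefficients solve the translation equations for the non-free coordinates of order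
`m`; coordinates of lower order are unchanged, as no lower Taylor coefficients of the map are
altered. -/
theorem reduced_pullSection {T : Base → Fib} {m : ℕ} (hm : 1 ≤ m) (hT : SmoothSectionNear T 0)
    (h : Reduced m T) :
    Reduced (m + 1) (pullSection T (reducingMap m fun i a b => partials a b (fun x => T x i) 0)) := by
  intro i a b hab hi
  set D : Fin 4 → ℕ → ℕ → ℝ := fun i a b => partials a b (fun x => T x i) 0 with hD
  have ht := reducingMap_tangent m D
  obtain ⟨e0, e1, e2, e3⟩ := partials_pullSection_of_tangent (reducingMap_zero m D) hT ht
    (a := a) (b := b) (by omega)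
  have hDi (i : Fin 4) : partials a b (fun x => T x i) 0 = D i a b := rfl
  rcases Nat.lt_or_ge (a + b) m with hlt | hge
  · have z (i : Fin 2) {c d : ℕ} (h2 : 2 ≤ c + d) (hcd : c + d < m + 2) :
        partials c d (fun x => reducingMap m D x i) 0 = 0 := partials_of_tangent ht i h2 hcd
    simp only [z _ (show 2 ≤ a + 2 + b by omega) (by omega),
      z _ (show 2 ≤ a + 1 + (b + 1) by omega) (by omega),
      z _ (show 2 ≤ a + (b + 2) by omega) (by omega), sub_zero, mul_zero, add_zero] at e0 e1 e2 e3
    have h0 := h i a b hlt hi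
    fin_cases i
    exacts [e0.trans h0, e1.trans h0, e2.trans h0, e3.trans h0]
  · have hm' : a + b = m := by omega
    have z0 {c d : ℕ} (hcd : c + d = m + 2) :
        partials c d (fun x => reducingMap m D x 0) 0 = reducingCoef₀ m D c d :=
      partials_polyFun_tangentCoef 0 m _ hcd
    have z1 {c d : ℕ} (hcd : c + d = m + 2) :
        partials c d (fun x => reducingMap m D x 1) 0 = reducingCoef₁ m D c d :=
      partials_polyFun_tangentCoef 1 m _ hcd
    rw [z1 (by omega), hDi] at e0
    rw [z0 (by omega), z1 (by omega), hDi] at e1 e2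
    rw [z0 (by omega), hDi] at e3
    fin_cases i
    · refine e0.trans ?_
      simp [reducingCoef₁]
    · refine e1.trans ?_
      have hb : b < 2 := by simpa [IsFree] using hi
      interval_cases b
      · obtain ⟨l, rfl⟩ : ∃ l, m = l + 1 := ⟨m - 1, by omega⟩
        obtain rfl : a = l + 1 := by omega
        simp [reducingCoef₀, reducingCoef₁]
      -- Order one is exceptional: the two mixed coefficients are coupled, and solving the system
      -- produces the denominator `3`.
      · rcases eq_or_ne m 1 with rfl | hm1
        · obtain rfl : a = 0 := by omega
          simp [reducingCoef₀, reducingCoef₁]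
          ring
        · obtain ⟨l, rfl⟩ : ∃ l, m = l + 2 := ⟨m - 2, by omega⟩
          obtain rfl : a = l + 1 := by omega
          simp [reducingCoef₀, reducingCoef₁]
    · refine e2.trans ?_
      have ha : a < 2 := by simpa [IsFree] using hi
      interval_cases a
      · obtain ⟨l, rfl⟩ : ∃ l, m = l + 1 := ⟨m - 1, by omega⟩
        obtain rfl : b = l + 1 := by omega
        simp [reducingCoef₀, reducingCoef₁]
        ring
      · rcases eq_or_ne m 1 with rfl | hm1
        · obtain rfl : b = 0 := by omega
          simp [reducingCoef₀, reducingCoef₁]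
        · obtain ⟨l, rfl⟩ : ∃ l, m = l + 2 := ⟨m - 2, by omega⟩
          obtain rfl : b = l + 1 := by omega
          simp [reducingCoef₀, reducingCoef₁]
          ring
    · refine e3.trans ?_
      simp [reducingCoef₀]

section existence

variable {E : Type*} [NormedAddCommGroup E] [NormedSpace ℝ E]

theorem normalizable_reducing {M : Set E} {T : E → Base → Fib} {m : ℕ} (hm : 1 ≤ m)
    (hT : ∀ θ ∈ M, SmoothSectionFamilyAt T θ ∧ Calibrated (T θ) ∧ Reduced m (T θ)) :
    Normalizable M T fun T => Calibrated T ∧ Reduced (m + 1) T := by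
  let D (θ : E) : Fin 4 → ℕ → ℕ → ℝ := fun i a b => partials a b (fun x => T θ x i) 0
  refine ⟨fun θ => pullSection (T θ) (reducingMap m (D θ)), fun θ hθ => ?_⟩
  obtain ⟨hs, hc, hr⟩ := hT θ hθ
  have hD (i : Fin 4) (a b : ℕ) : ContDiffAt ℝ ∞ (fun θ => D θ i a b) θ :=
    ((hs.family i).partials a b).eval
  have h0 (a b : ℕ) : ContDiffAt ℝ ∞ (fun θ => reducingCoef₀ m (D θ) a b) θ := by
    unfold reducingCoef₀
    split_ifs <;> fun_prop
  have h1 (a b : ℕ) : ContDiffAt ℝ ∞ (fun θ => reducingCoef₁ m (D θ) a b) θ := by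
    unfold reducingCoef₁
    split_ifs <;> fun_prop
  have ht (i : Fin 2) {c : E → ℕ → ℕ → ℝ} (hc : ∀ a b, ContDiffAt ℝ ∞ (fun θ => c θ a b) θ)
      (a b : ℕ) : ContDiffAt ℝ ∞ (fun θ => tangentCoef i (m + 2) (c θ) a b) θ := by
    unfold tangentCoef
    split_ifs
    exacts [hc a b, contDiffAt_const, contDiffAt_const]
  have := hs.pullSection (n := m + 2) (by omega) (ht 0 h0) (ht 1 h1) (by simp [tangentCoef])
    (by simp [tangentCoef]) (by simp [tangentCoef])
  exact ⟨this.1, this.2, calibrated_of_tangent hs.smooth hc (reducingMap_zero m _)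
    fun i => (reducingMap_tangent m (D θ) i).mono (by omega), reduced_pullSection hm hs.smooth hr⟩

/-- A smooth family of sections with nonvanishing `F3` has a smooth normal form. -/
theorem normalizable_calibrated_reduced {M : Set E} {T : E → Base → Fib}
    (hT : ∀ θ ∈ M, SmoothSectionFamilyAt T θ) (h3 : ∀ θ ∈ M, F3 (T θ) 0 ≠ 0) (n : ℕ) :
    Normalizable M T fun T => Calibrated T ∧ Reduced (n + 1) T := by
  induction n with
  | zero =>
    exact (((normalizable_linear hT h3).trans fun _ h => normalizable_quadratic h).trans
      fun _ h => normalizable_shear h).trans fun _ h => normalizable_projective h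
  | succ n ih => exact ih.trans fun _ h => normalizable_reducing (by omega) h

end existence

/-! ### Dependence on jets -/

/-- The second order jet of `F1` in terms of the partial derivatives of the section. -/
def F1TwoJet (u : Fin 4 → ℕ → ℕ → TwoJet) : TwoJet :=
  let t (n : ℝ) := TwoJet.const n
  (((((((((t 3).mul (u 0 0 2)).sub ((t 2).mul (u 1 1 1))).add (u 2 2 0)).add
    (((t 3).mul (u 3 0 0)).mul (u 0 1 0))).sub (((t 3).mul (u 2 0 0)).mul (u 0 0 1))).add
    (((t 2).mul (u 1 0 0)).mul (u 1 0 1))).sub ((u 1 0 0).mul (u 2 1 0))).sub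
    (((t 3).mul (u 0 0 0)).mul (u 2 0 1))).add (((t 6).mul (u 0 0 0)).mul (u 3 1 0))

/-- The second order jet of `F2` in terms of the partial derivatives of the section. -/
def F2TwoJet (u : Fin 4 → ℕ → ℕ → TwoJet) : TwoJet :=
  let t (n : ℝ) := TwoJet.const n
  ((((((((u 1 0 2).sub ((t 2).mul (u 2 1 1))).add ((t 3).mul (u 3 2 0))).sub
    (((t 3).mul (u 0 0 0)).mul (u 3 0 1))).add (((t 3).mul (u 1 0 0)).mul (u 3 1 0))).sub
    (((t 2).mul (u 2 0 0)).mul (u 2 1 0))).add ((u 2 0 0).mul (u 1 0 1))).add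
    (((t 3).mul (u 3 0 0)).mul (u 1 1 0))).sub (((t 6).mul (u 3 0 0)).mul (u 0 0 1))

/-- The two-jet of the partial derivative `(a, b)` of a function with partial derivatives `D`. -/
def shiftJet (D : ℕ → ℕ → ℝ) (a b : ℕ) : TwoJet :=
  ⟨D a b, D (a + 1) b, D a (b + 1), D (a + 2) b, D (a + 1) (b + 1), D a (b + 2)⟩

theorem hasTwoJet_F {S : Base → Fib} {p : Base} (hS : SmoothSectionNear S p) :
    HasTwoJet (F1 S) p (F1TwoJet fun i => shiftJet fun a b => partials a b (fun x => S x i) p) ∧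
    HasTwoJet (F2 S) p (F2TwoJet fun i => shiftJet fun a b => partials a b (fun x => S x i) p) := by
  have u (i : Fin 4) (a b : ℕ) : HasTwoJet (partials a b fun x => S x i) p
    (shiftJet (fun a b => partials a b (fun x => S x i) p) a b) := .partials (hS i) a b
  have t (n : ℝ) := HasTwoJet.const n p
  constructor
  · exact ((((((((((t 3).mul (u 0 0 2)).sub ((t 2).mul (u 1 1 1))).add (u 2 2 0)).add
      (((t 3).mul (u 3 0 0)).mul (u 0 1 0))).sub (((t 3).mul (u 2 0 0)).mul (u 0 0 1))).add
      (((t 2).mul (u 1 0 0)).mul (u 1 0 1))).sub ((u 1 0 0).mul (u 2 1 0))).sub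
      (((t 3).mul (u 0 0 0)).mul (u 2 0 1))).add (((t 6).mul (u 0 0 0)).mul (u 3 1 0)))
  · exact (((((((((u 1 0 2).sub ((t 2).mul (u 2 1 1))).add ((t 3).mul (u 3 2 0))).sub
      (((t 3).mul (u 0 0 0)).mul (u 3 0 1))).add (((t 3).mul (u 1 0 0)).mul (u 3 1 0))).sub
      (((t 2).mul (u 2 0 0)).mul (u 2 1 0))).add ((u 2 0 0).mul (u 1 0 1))).add
      (((t 3).mul (u 3 0 0)).mul (u 1 1 0))).sub (((t 6).mul (u 3 0 0)).mul (u 0 0 1)))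

/-- The sections `S` at `p` and `T` at `q` have the same partial derivatives up to order `k`. -/
def SameJet (k : ℕ) (S : Base → Fib) (p : Base) (T : Base → Fib) (q : Base) : Prop :=
  ∀ i a b, a + b ≤ k → partials a b (fun x => S x i) p = partials a b (fun x => T x i) q

theorem SameJet.symm {k : ℕ} {S T : Base → Fib} {p q : Base} (h : SameJet k S p T q) :
    SameJet k T q S p := fun i a b hab => (h i a b hab).symm

theorem SameJet.trans {k : ℕ} {S T U : Base → Fib} {p q r : Base} (h : SameJet k S p T q)
    (h' : SameJet k T q U r) : SameJet k S p U r :=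
  fun i a b hab => (h i a b hab).trans (h' i a b hab)

theorem SameJet.mono {k l : ℕ} {S T : Base → Fib} {p q : Base} (h : SameJet k S p T q)
    (hl : l ≤ k) : SameJet l S p T q := fun i a b hab => h i a b (by omega)

theorem SameJet.of_eventuallyEq {S T : Base → Fib} {p : Base} (e : S =ᶠ[𝓝 p] T) (k : ℕ) :
    SameJet k S p T p := fun i _ _ _ => partials_congr (e.fun_comp fun u => u i) _ _

section invariants

variable {S T : Base → Fib} {p q : Base}

theorem SameJet.F_eq (h : SameJet 3 S p T q) (hS : SmoothSectionNear S p)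
    (hT : SmoothSectionNear T q) : F1 S p = F1 T q ∧ F2 S p = F2 T q ∧
      pd 0 (F1 S) p = pd 0 (F1 T) q ∧ pd 1 (F1 S) p = pd 1 (F1 T) q ∧
      pd 0 (F2 S) p = pd 0 (F2 T) q ∧ pd 1 (F2 S) p = pd 1 (F2 T) q := by
  obtain ⟨a1, a2⟩ := hasTwoJet_F hS
  obtain ⟨b1, b2⟩ := hasTwoJet_F hT
  have h00 (i : Fin 4) := h i 0 0 (by norm_num)
  have h10 (i : Fin 4) := h i 1 0 (by norm_num)
  have h01 (i : Fin 4) := h i 0 1 (by norm_num)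
  have h20 (i : Fin 4) := h i 2 0 (by norm_num)
  have h11 (i : Fin 4) := h i 1 1 (by norm_num)
  have h02 (i : Fin 4) := h i 0 2 (by norm_num)
  have h30 (i : Fin 4) := h i 3 0 (by norm_num)
  have h21 (i : Fin 4) := h i 2 1 (by norm_num)
  have h12 (i : Fin 4) := h i 1 2 (by norm_num)
  have h03 (i : Fin 4) := h i 0 3 (by norm_num)
  rw [a1.v, a2.v, a1.x, a1.y, a2.x, a2.y, b1.v, b2.v, b1.x, b1.y, b2.x, b2.y]
  simp only [F1TwoJet, F2TwoJet, shiftJet, TwoJet.add, TwoJet.sub, TwoJet.mul, TwoJet.const,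
    Nat.reduceAdd, h00, h10, h01, h20, h11, h02, h30, h21, h12, h03, and_self]

theorem SameJet.F3_eq (h : SameJet 3 S p T q) (hS : SmoothSectionNear S p)
    (hT : SmoothSectionNear T q) : F3 S p = F3 T q := by
  obtain ⟨h1, h2, h3, h4, h5, h6⟩ := h.F_eq hS hT
  have h0 (i : Fin 4) : S p i = T q i := h i 0 0 (by norm_num)
  simp only [F3, h1, h2, h3, h4, h5, h6, h0]

theorem Calibrated.of_sameJet (c : Calibrated T) (h : SameJet 3 S 0 T 0)
    (hS : SmoothSectionNear S 0) (hT : SmoothSectionNear T 0) : Calibrated S := by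
  obtain ⟨h1, h2, h3, h4, h5, h6⟩ := h.F_eq hS hT
  exact ⟨h1.trans c.F1, h2.trans c.F2, h3.trans c.F1x, h4.trans c.F1y, h5.trans c.F2x,
    h6.trans c.F2y⟩

theorem Reduced.of_sameJet {k : ℕ} (r : Reduced (k + 1) T) (h : SameJet k S 0 T 0) :
    Reduced (k + 1) S := fun i a b hab hi => (h i a b (by omega)).trans (r i a b hab hi)

/-- A reduced section vanishes to order two, so the quadratic terms of `F1` and `F2` contribute
nothing to their 1-jets. What remains is linear in the free coordinates of orders two and three. -/
theorem Reduced.F_eq (r : Reduced 4 S) (hS : SmoothSectionNear S 0) :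
    F1 S 0 = partials 2 0 (fun x => S x 2) 0 ∧ F2 S 0 = partials 0 2 (fun x => S x 1) 0 ∧
    pd 0 (F1 S) 0 = partials 3 0 (fun x => S x 2) 0 ∧
    pd 1 (F1 S) 0 = partials 2 1 (fun x => S x 2) 0 - 2 * partials 1 2 (fun x => S x 1) 0 ∧
    pd 0 (F2 S) 0 = partials 1 2 (fun x => S x 1) 0 - 2 * partials 2 1 (fun x => S x 2) 0 ∧
    pd 1 (F2 S) 0 = partials 0 3 (fun x => S x 1) 0 := by
  obtain ⟨a1, a2⟩ := hasTwoJet_F hS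
  rw [a1.v, a2.v, a1.x, a1.y, a2.x, a2.y]
  have h00 (i : Fin 4) := r i 0 0 (by norm_num) (by simp [IsFree])
  have h10 (i : Fin 4) := r i 1 0 (by norm_num) (by simp [IsFree])
  have h01 (i : Fin 4) := r i 0 1 (by norm_num) (by simp [IsFree])
  have h11 (i : Fin 4) := r i 1 1 (by norm_num) (by simp [IsFree])
  have h0 (a b : ℕ) (h : a + b < 4) := r 0 a b h (by simp [IsFree])
  have h3 (a b : ℕ) (h : a + b < 4) := r 3 a b h (by simp [IsFree])
  have h1 (a b : ℕ) (h : a + b < 4) (h' : b < 2) := r 1 a b h (by simp [IsFree, h'])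
  have h2 (a b : ℕ) (h : a + b < 4) (h' : a < 2) := r 2 a b h (by simp [IsFree, h'])
  simp only [F1TwoJet, F2TwoJet, shiftJet, TwoJet.add, TwoJet.sub, TwoJet.mul, TwoJet.const,
    Nat.reduceAdd, h00, h10, h01, h11, h0 0 2 (by norm_num), h0 1 2 (by norm_num),
    h0 0 3 (by norm_num), h3 2 0 (by norm_num), h3 3 0 (by norm_num), h3 2 1 (by norm_num),
    h1 2 1 (by norm_num) (by norm_num), h2 1 2 (by norm_num) (by norm_num), mul_zero, zero_mul,
    add_zero, zero_add, sub_zero, zero_sub, true_and]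
  exact ⟨by ring, trivial⟩

end invariants

/-- The jet of a pullback depends only on the jet of the section. -/
theorem SameJet.pullSection {k : ℕ} {S T : Base → Fib} {g : Base → Base} {q : Base}
    (h : SameJet k S (g q) T (g q)) (hS : SmoothSectionNear S (g q))
    (hT : SmoothSectionNear T (g q)) (hg : SmoothMapNear g q) (hj : jac g q ≠ 0) :
    SameJet k (pullSection S g) q (pullSection T g) q := by
  have hu (i : Fin 4) : AgreeAt (k + 1) q (fun x => S (g x) i) (fun x => T (g x) i) :=
    ⟨(hS i).comp hg, (hT i).comp hg,
      VanishesAt.comp (vanishesAt_sub (hS i) (hT i) fun a b hab => h i a b (by omega)) hg⟩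
  have h1 (i j : Fin 2) := AgreeAt.refl (k + 1) ((hg i).pd j)
  have h2 (i j l : Fin 2) := AgreeAt.refl (k + 1) (((hg i).pd j).pd l)
  have hc (c : ℝ) := AgreeAt.refl (k + 1) (SmoothNear.const c q)
  have hd : AgreeAt (k + 1) q (fun x => 1 / jac g x) (fun x => 1 / jac g x) :=
    .refl _ ((SmoothNear.const 1 q).div hg.jac hj)
  have hS' := hS.pullSection hg hj
  have hT' := hT.pullSection hg hj
  suffices ∀ i, AgreeAt (k + 1) q (fun x => CubicODE.pullSection S g x i)
      (fun x => CubicODE.pullSection T g x i) from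
    fun i a b hab => (this i).partials_eq (by omega)
  have red {n n' : Base → ℝ} (hn : AgreeAt (k + 1) q n n') :
      AgreeAt (k + 1) q (fun x => n x / jac g x) (fun x => n' x / jac g x) := by
    simpa only [mul_one_div] using hn.mul hd
  intro i
  fin_cases i <;>
  · refine red ?_
    repeat first
      | exact hu _ | exact h1 _ _ | exact h2 _ _ _ | exact hc _
      | with_reducible apply AgreeAt.minus | with_reducible apply AgreeAt.add
      | with_reducible apply AgreeAt.mul | with_reducible apply AgreeAt.pow

/-! ### Translations and Taylor polynomials of jets -/

theorem partials_translate (a b : ℕ) (f : Base → ℝ) (p : Base) :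
    partials a b (fun x => f (x + p)) = fun x => partials a b f (x + p) := by
  have h (j : Fin 2) (f : Base → ℝ) : pd j (fun x => f (x + p)) = fun x => pd j f (x + p) := by
    funext x
    simp only [pd, fderiv_comp_add_right]
  have h1 : partials 0 b (fun x => f (x + p)) = fun x => partials 0 b f (x + p) := by
    induction b generalizing f with
    | zero => rfl
    | succ b ih => rw [← partials_pd_one, h, ih]; rfl
  induction a with
  | zero => exact h1
  | succ a ih => rw [partials_succ_left, ih, h, partials_succ_left]

theorem sameJet_translate (k : ℕ) (S : Base → Fib) (p q : Base) :
    SameJet k (fun x => S (x + p)) q S (q + p) := fun i a b _ =>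
  congrFun (partials_translate a b (fun x => S x i) p) q

theorem pointEquiv_translate (S : Base → Fib) (p : Base) :
    PointEquiv S p (fun x => S (x + p)) 0 := by
  refine ⟨affineMap p 0 1 0 0 1, affineMap_smooth _ _ _ _ _ _ _, affineMap_self _ _ _ _ _ _,
    by rw [jac_affineMap]; norm_num, .of_forall fun x => ?_⟩
  have e : affineMap p 0 1 0 0 1 x = x + p := by
    funext i
    fin_cases i <;> simp [affineMap, add_comm]
  rw [pullSection_affineMap, e]
  funext i
  fin_cases i <;> simp [coeffs]

/-- The partial derivatives encoded by a jet. -/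
noncomputable def jetCoef {k : ℕ} (θ : JetSpace k) (i : Fin 4) (a b : ℕ) : ℝ :=
  if h : a + b ≤ k then θ.2 ⟨(⟨a, by omega⟩, ⟨b, by omega⟩), h⟩ i else 0

/-- The polynomial section with the given jet, translated to the origin. -/
noncomputable def jetSection {k : ℕ} (θ : JetSpace k) : Base → Fib :=
  fun x i => polyFun k (jetCoef θ i) x

section jets

variable {k : ℕ}

theorem polyFun_contDiff (n : ℕ) (c : ℕ → ℕ → ℝ) : ContDiff ℝ ∞ (polyFun n c) :=
  ContDiff.sum fun _ _ => contDiff_const.mul (mono_contDiff _ _)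

theorem jetSection_contDiff (θ : JetSpace k) : ContDiff ℝ ∞ (jetSection θ) :=
  contDiff_pi.2 fun i => polyFun_contDiff k (jetCoef θ i)

theorem jetSection_smooth (θ : JetSpace k) (p : Base) : SmoothSectionNear (jetSection θ) p :=
  .of_contDiff (jetSection_contDiff θ) p

theorem partials_jetSection (θ : JetSpace k) (i : Fin 4) {a b : ℕ} (hab : a + b ≤ k) :
    partials a b (fun x => jetSection θ x i) 0 = jetCoef θ i a b :=
  partials_polyFun (by omega) (by omega)

theorem contDiff_jetCoef (i : Fin 4) (a b : ℕ) :
    ContDiff ℝ ∞ (fun θ : JetSpace k => jetCoef θ i a b) := by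
  unfold jetCoef
  split_ifs with h
  · have h1 : ContDiff ℝ ∞ (fun θ : JetSpace k => θ.2) := contDiff_snd
    exact contDiff_pi.1 (contDiff_pi.1 h1 ⟨(⟨a, by omega⟩, ⟨b, by omega⟩), h⟩) i
  · exact contDiff_const

theorem jetSection_family (θ : JetSpace k) : SmoothSectionFamilyAt jetSection θ :=
  ⟨fun i => smoothFamilyAt_polyFun fun a b => (contDiff_jetCoef i a b).contDiffAt,
    jetSection_smooth θ 0⟩

theorem sameJet_jetSection (S : Base → Fib) (p : Base) : SameJet k (jetSection (jet k S p)) 0 S p :=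
  fun i a b hab => by
    rw [partials_jetSection _ _ hab, jetCoef, dif_pos hab]
    rfl

theorem jet_eq_of_sameJet {S T : Base → Fib} {p : Base} (h : SameJet k S p T p) :
    jet k S p = jet k T p :=
  Prod.ext rfl (funext fun σ => funext fun i => h i σ.1.1 σ.1.2 σ.2)

theorem jet_eq_of_sameJet_jetSection {θ : JetSpace k} {S : Base → Fib}
    (h : SameJet k S θ.1 (jetSection θ) 0) : jet k S θ.1 = θ := by
  refine Prod.ext rfl (funext fun σ => funext fun i => ?_)
  have := h i σ.1.1 σ.1.2 σ.2
  rw [partials_jetSection _ _ σ.2, jetCoef, dif_pos σ.2] at this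
  exact this

/-- For `k ≥ 3` the generic part is given by the inequality `F3 ≠ 0`. -/
theorem mem_genericPart_iff (hk : 3 ≤ k) (θ : JetSpace k) :
    θ ∈ genericPart k ↔ F3 (jetSection θ) 0 ≠ 0 := by
  constructor
  · rintro ⟨S, p, hS, h3, rfl⟩
    rwa [((sameJet_jetSection S p).mono hk).F3_eq (jetSection_smooth _ 0) (.of_contDiff hS p)]
  · intro h
    -- The polynomial representative lives at the origin; shifting it realizes the jet over its own
    -- base point.
    have hc : ContDiff ℝ ∞ fun x => jetSection θ (x + -θ.1) :=
      (jetSection_contDiff θ).comp (contDiff_id.add contDiff_const)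
    have hj : SameJet k (fun x => jetSection θ (x + -θ.1)) θ.1 (jetSection θ) 0 := by
      have := sameJet_translate k (jetSection θ) (-θ.1) θ.1
      rwa [add_neg_cancel] at this
    refine ⟨_, θ.1, hc, ?_, jet_eq_of_sameJet_jetSection hj⟩
    rwa [(hj.mono hk).F3_eq (.of_contDiff hc _) (jetSection_smooth θ 0)]

theorem isOpen_genericPart (hk : 3 ≤ k) : IsOpen (genericPart k) := by
  have h : genericPart k = {θ | F3 (jetSection θ) 0 ≠ 0} :=
    Set.ext fun θ => mem_genericPart_iff hk θ
  rw [h]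
  exact isOpen_ne_fun (continuous_iff_continuousAt.2 fun θ =>
    (jetSection_family θ).F3.eval.continuousAt) continuous_const

end jets

/-! ### The free coordinates of order at least four -/

/-- `e` enumerates the free coordinates of orders from `4` to `k`. -/
structure EnumeratesFree {N : ℕ} (k : ℕ) (e : Fin N → Fin 4 × ℕ × ℕ) : Prop where
  injective : Function.Injective e
  exists_iff : ∀ i a b, (∃ j, e j = (i, a, b)) ↔ IsFree i a b ∧ 4 ≤ a + b ∧ a + b ≤ k

theorem enumeratesFree_three : EnumeratesFree 3 (Fin.elim0 : Fin 0 → Fin 4 × ℕ × ℕ) :=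
  ⟨fun j => j.elim0, fun i a b => ⟨fun ⟨j, _⟩ => j.elim0, fun h => by omega⟩⟩

/-- In order `m` there are `2(m-1)` free coordinates: a choice between components `1` and `2`, and
an exponent `t` with `2 ≤ t ≤ m`, of `y` or `x` respectively. -/
theorem exists_enumeratesFree {k : ℕ} (hk : 3 ≤ k) :
    ∃ e : Fin (k ^ 2 - k - 6) → Fin 4 × ℕ × ℕ, EnumeratesFree k e := by
  let s : Finset (Σ _ : ℕ, Fin 2 × ℕ) :=
    (Finset.Icc 4 k).sigma fun m => Finset.univ ×ˢ Finset.Icc 2 m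
  let f : (Σ _ : ℕ, Fin 2 × ℕ) → Fin 4 × ℕ × ℕ := fun x =>
    if x.2.1 = 0 then (1, x.1 - x.2.2, x.2.2) else (2, x.2.2, x.1 - x.2.2)
  have mem (m : ℕ) (i : Fin 2) (t : ℕ) :
      (⟨m, i, t⟩ : Σ _ : ℕ, Fin 2 × ℕ) ∈ s ↔ (4 ≤ m ∧ m ≤ k) ∧ 2 ≤ t ∧ t ≤ m := by
    simp [s]
  have hf : Set.InjOn f s := by
    rintro ⟨m, i, t⟩ hx ⟨m', i', t'⟩ hy h
    rw [Finset.mem_coe, mem] at hx hy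
    fin_cases i <;> fin_cases i' <;> simp [f] at h ⊢ <;> omega
  have hs : s.card = k ^ 2 - k - 6 := by
    -- With `k = n + 3` the count is `n² + 5n`, so the truncated subtraction in `k ^ 2 - k - 6`
    -- loses nothing.
    obtain ⟨n, rfl⟩ := Nat.exists_eq_add_of_le' hk
    have h1 : s.card = ∑ m ∈ Finset.Icc 4 (n + 3), 2 * (m - 1) := by
      simp [s, Finset.card_sigma]
    have h2 (n : ℕ) : ∑ m ∈ Finset.Icc 4 (n + 3), 2 * (m - 1) = n ^ 2 + 5 * n := by
      induction n with
      | zero => rfl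
      | succ n ih =>
        rw [show n + 1 + 3 = n + 3 + 1 by ring, Finset.sum_Icc_succ_top (by omega), ih,
          Nat.add_sub_cancel]
        ring
    have h3 : (n + 3) ^ 2 = n ^ 2 + 5 * n + (n + 3) + 6 := by ring
    rw [h1, h2]
    omega
  let E := (s.image f).equivFinOfCardEq ((Finset.card_image_of_injOn hf).trans hs)
  refine ⟨fun j => E.symm j, fun j l h => E.symm.injective (Subtype.ext h), fun i a b => ?_⟩
  have h1 : (∃ j, (E.symm j : Fin 4 × ℕ × ℕ) = (i, a, b)) ↔ (i, a, b) ∈ s.image f :=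
    ⟨fun ⟨j, h⟩ => h ▸ (E.symm j).2, fun h => ⟨E ⟨_, h⟩, by rw [E.symm_apply_apply]⟩⟩
  rw [h1, Finset.mem_image]
  constructor
  · rintro ⟨⟨m, i', t⟩, hm, h⟩
    rw [mem] at hm
    fin_cases i' <;> simp only [f, Fin.zero_eta, Fin.mk_one, if_true, one_ne_zero, if_false,
      Prod.mk.injEq] at h <;> obtain ⟨rfl, rfl, rfl⟩ := h
    · exact ⟨.inl ⟨rfl, hm.2.1⟩, by omega, by omega⟩
    · exact ⟨.inr ⟨rfl, hm.2.1⟩, by omega, by omega⟩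
  · rintro ⟨⟨rfl, hb⟩ | ⟨rfl, ha⟩, h4, hk'⟩
    · exact ⟨⟨a + b, 0, b⟩, (mem _ _ _).2 ⟨⟨h4, hk'⟩, hb, by omega⟩, by simp [f]⟩
    · exact ⟨⟨a + b, 1, a⟩, (mem _ _ _).2 ⟨⟨h4, hk'⟩, ha, by omega⟩, by simp [f]⟩

/-! ### Normal forms of jets -/

/-- The partial derivatives of order at most three of a calibrated reduced section. -/
def baseCoef (i : Fin 4) (a b : ℕ) : ℝ :=
  if (i, a, b) = (2, 2, 0) then 1 else if (i, a, b) = (1, 0, 3) then -1 else 0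

/-- The six free coordinates of orders two and three are recovered from the six calibrated values;
the mixed pair satisfies two independent homogeneous equations and vanishes. Hence no invariants
arise below order four. -/
theorem Calibrated.partials_eq_baseCoef {T : Base → Fib} (c : Calibrated T) (r : Reduced 4 T)
    (hT : SmoothSectionNear T 0) (i : Fin 4) {a b : ℕ} (hab : a + b ≤ 3) :
    partials a b (fun x => T x i) 0 = baseCoef i a b := by
  obtain ⟨h1, h2, h3, h4, h5, h6⟩ := r.F_eq hT
  rw [c.F1] at h1
  rw [c.F2] at h2
  rw [c.F1x] at h3
  rw [c.F1y] at h4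
  rw [c.F2x] at h5
  rw [c.F2y] at h6
  by_cases hi : IsFree i a b
  · rcases hi with ⟨rfl, hb⟩ | ⟨rfl, ha⟩
    · obtain ⟨rfl, rfl⟩ | ⟨rfl, rfl⟩ | ⟨rfl, rfl⟩ :
        a = 0 ∧ b = 2 ∨ a = 1 ∧ b = 2 ∨ a = 0 ∧ b = 3 := by omega
      · simp [baseCoef, ← h2]
      · simp only [baseCoef]; norm_num; linarith
      · simp [baseCoef, ← h6]
    · obtain ⟨rfl, rfl⟩ | ⟨rfl, rfl⟩ | ⟨rfl, rfl⟩ :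
        a = 2 ∧ b = 0 ∨ a = 2 ∧ b = 1 ∨ a = 3 ∧ b = 0 := by omega
      · simp [baseCoef, ← h1]
      · simp only [baseCoef]; norm_num; linarith
      · simp [baseCoef, ← h3]
  · rw [r i a b (by omega) hi, baseCoef, if_neg, if_neg]
    · rintro h
      simp only [Prod.mk.injEq] at h
      exact hi (.inl ⟨h.1, by omega⟩)
    · rintro h
      simp only [Prod.mk.injEq] at h
      exact hi (.inr ⟨h.1, by omega⟩)

/-- The partial derivatives of the calibrated reduced section with free coordinates `c`. -/
noncomputable def normalCoef {N : ℕ} (e : Fin N → Fin 4 × ℕ × ℕ) (c : Fin N → ℝ) (i : Fin 4)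
    (a b : ℕ) : ℝ :=
  baseCoef i a b + ∑ j, if e j = (i, a, b) then c j else 0

/-- The calibrated reduced polynomial section with free coordinates `c`. -/
noncomputable def normalSection {N : ℕ} (k : ℕ) (e : Fin N → Fin 4 × ℕ × ℕ) (c : Fin N → ℝ) :
    Base → Fib :=
  fun x i => polyFun k (normalCoef e c i) x

/-- `J` sends a generic jet to a section which is equivalent to the jet, calibrated and reduced;
it depends smoothly on the jet. -/
def IsNormalForm {k : ℕ} (J : JetSpace k → Base → Fib) : Prop :=
  ∀ θ ∈ genericPart k, SmoothSectionFamilyAt J θ ∧ PointEquiv (jetSection θ) 0 (J θ) 0 ∧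
    Calibrated (J θ) ∧ Reduced (k + 1) (J θ)

theorem exists_isNormalForm {k : ℕ} (hk : 3 ≤ k) :
    ∃ J : JetSpace k → Base → Fib, IsNormalForm J :=
  normalizable_calibrated_reduced (fun θ _ => jetSection_family θ)
    (fun θ => (mem_genericPart_iff hk θ).1) k

section normalSection

variable {N k : ℕ} {e : Fin N → Fin 4 × ℕ × ℕ}

theorem partials_normalSection (c : Fin N → ℝ) (i : Fin 4) {a b : ℕ} (hab : a + b ≤ k) :
    partials a b (fun x => normalSection k e c x i) 0 = normalCoef e c i a b :=
  partials_polyFun (by omega) (by omega)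

theorem normalSection_contDiff (c : Fin N → ℝ) : ContDiff ℝ ∞ (normalSection k e c) :=
  contDiff_pi.2 fun i => polyFun_contDiff k (normalCoef e c i)

theorem normalSection_smooth (c : Fin N → ℝ) (p : Base) :
    SmoothSectionNear (normalSection k e c) p := .of_contDiff (normalSection_contDiff c) p

theorem contDiff_normalCoef (i : Fin 4) (a b : ℕ) :
    ContDiff ℝ ∞ fun c : Fin N → ℝ => normalCoef e c i a b := by
  refine contDiff_const.add (ContDiff.sum fun j _ => ?_)
  split_ifs
  · exact contDiff_apply ℝ ℝ j
  · exact contDiff_const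

theorem normalSection_family (c : Fin N → ℝ) : SmoothSectionFamilyAt (normalSection k e) c :=
  ⟨fun i => smoothFamilyAt_polyFun fun a b => (contDiff_normalCoef i a b).contDiffAt,
    normalSection_smooth c 0⟩

theorem normalCoef_of_forall_ne {c : Fin N → ℝ} {i : Fin 4} {a b : ℕ}
    (h : ¬∃ j, e j = (i, a, b)) : normalCoef e c i a b = baseCoef i a b := by
  rw [normalCoef, Finset.sum_eq_zero, add_zero]
  exact fun j _ => if_neg fun hj => h ⟨j, hj⟩

theorem EnumeratesFree.normalCoef_eq (he : EnumeratesFree k e) (c : Fin N → ℝ) {j : Fin N}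
    {i : Fin 4} {a b : ℕ} (h : e j = (i, a, b)) : normalCoef e c i a b = c j := by
  have h4 := ((he.exists_iff i a b).1 ⟨j, h⟩).2.1
  rw [normalCoef, baseCoef, if_neg, if_neg, zero_add, Finset.sum_eq_single j, if_pos h]
  · exact fun l _ hl => if_neg fun h' => hl (he.injective (h'.trans h.symm))
  · simp
  all_goals
    intro h'
    simp only [Prod.mk.injEq] at h'
    omega

theorem EnumeratesFree.reduced (he : EnumeratesFree k e) (c : Fin N → ℝ) :
    Reduced (k + 1) (normalSection k e c) := by
  intro i a b hab hi
  rw [partials_normalSection _ _ (by omega), normalCoef_of_forall_ne, baseCoef, if_neg, if_neg]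
  · rintro h
    simp only [Prod.mk.injEq] at h
    exact hi (.inl ⟨h.1, by omega⟩)
  · rintro h
    simp only [Prod.mk.injEq] at h
    exact hi (.inr ⟨h.1, by omega⟩)
  · rw [he.exists_iff]
    exact fun h => hi h.1

theorem EnumeratesFree.calibrated (he : EnumeratesFree k e) (hk : 3 ≤ k) (c : Fin N → ℝ) :
    Calibrated (normalSection k e c) := by
  have h (i : Fin 4) {a b : ℕ} (hab : a + b ≤ 3) :
      partials a b (fun x => normalSection k e c x i) 0 = baseCoef i a b := by
    rw [partials_normalSection _ _ (by omega), normalCoef_of_forall_ne]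
    rw [he.exists_iff]
    omega
  obtain ⟨h1, h2, h3, h4, h5, h6⟩ :=
    ((he.reduced c).mono (by omega : 4 ≤ k + 1)).F_eq (normalSection_smooth c 0)
  rw [h 2 (by norm_num)] at h1 h3 h4
  rw [h 1 (by norm_num)] at h2 h5 h6 h4
  rw [h 2 (by norm_num)] at h5
  constructor
  · rw [h1]; simp [baseCoef]
  · rw [h2]; simp [baseCoef]
  · rw [h3]; simp [baseCoef]
  · rw [h4]; simp [baseCoef]
  · rw [h5]; simp [baseCoef]
  · rw [h6]; simp [baseCoef]

theorem EnumeratesFree.F3_normalSection (he : EnumeratesFree k e) (hk : 3 ≤ k) (c : Fin N → ℝ) :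
    F3 (normalSection k e c) 0 = 1 :=
  (he.calibrated hk c).F3_eq ((he.reduced c).mono (by omega))

/-- The free coordinates of a section. -/
noncomputable def freeCoord (e : Fin N → Fin 4 × ℕ × ℕ) (T : Base → Fib) (j : Fin N) : ℝ :=
  partials (e j).2.1 (e j).2.2 (fun x => T x (e j).1) 0

theorem EnumeratesFree.order_le (he : EnumeratesFree k e) (j : Fin N) :
    (e j).2.1 + (e j).2.2 ≤ k := ((he.exists_iff _ _ _).1 ⟨j, rfl⟩).2.2

theorem EnumeratesFree.freeCoord_eq (he : EnumeratesFree k e) {S T : Base → Fib}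
    (h : SameJet k S 0 T 0) : freeCoord e S = freeCoord e T :=
  funext fun j => h _ _ _ (he.order_le j)

theorem EnumeratesFree.freeCoord_normalSection (he : EnumeratesFree k e) (c : Fin N → ℝ) :
    freeCoord e (normalSection k e c) = c := funext fun j =>
  (partials_normalSection c _ (he.order_le j)).trans (he.normalCoef_eq c rfl)

/-- Orders up to three are fixed by calibration, higher non-free coordinates by reduction, and the
rest are matched by the parameters: the cross-section contains every jet in normal form. -/
theorem EnumeratesFree.sameJet (he : EnumeratesFree k e) (hk : 3 ≤ k) {T : Base → Fib}
    (hT : SmoothSectionNear T 0) (c : Calibrated T) (r : Reduced (k + 1) T) :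
    SameJet k T 0 (normalSection k e (freeCoord e T)) 0 := by
  intro i a b hab
  by_cases h3 : a + b ≤ 3
  · rw [c.partials_eq_baseCoef (r.mono (by omega)) hT i h3,
      (he.calibrated hk _).partials_eq_baseCoef ((he.reduced _).mono (by omega))
        (normalSection_smooth _ 0) i h3]
  · by_cases hi : IsFree i a b
    · obtain ⟨j, hj⟩ := (he.exists_iff i a b).2 ⟨hi, by omega, hab⟩
      rw [partials_normalSection _ _ hab, he.normalCoef_eq _ hj, freeCoord, hj]
    · rw [r i a b (by omega) hi, he.reduced _ i a b (by omega) hi]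

end normalSection

namespace IsNormalForm

variable {k : ℕ} {J : JetSpace k → Base → Fib} {θ : JetSpace k}

/-- A section representing the translated jet has a calibrated and reduced form, and its jet is the
normal form of the jet. -/
theorem exists_pointEquiv (hJ : IsNormalForm J) (hk : 3 ≤ k) (hθ : θ ∈ genericPart k)
    {U : Base → Fib} (hU : SmoothSectionNear U 0) (h : SameJet k U 0 (jetSection θ) 0) :
    ∃ V, PointEquiv U 0 V 0 ∧ Calibrated V ∧ Reduced (k + 1) V ∧ SameJet k V 0 (J θ) 0 := by
  obtain ⟨hs, ⟨g, hg, g0, hj, eg⟩, c, r⟩ := hJ θ hθ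
  have hV : SmoothSectionNear (pullSection U g) 0 :=
    SmoothSectionNear.pullSection (by rwa [g0]) hg hj
  -- The map normalizing the polynomial representative is applied to `U` itself. The result agrees
  -- with `J θ` only to order `k`, which still carries the calibration because `k ≥ 3`.
  have hVJ : SameJet k (pullSection U g) 0 (J θ) 0 :=
    (SameJet.pullSection (by rwa [g0]) (by rwa [g0]) (jetSection_smooth θ _) hg hj).trans
      (.of_eventuallyEq eg.symm k)
  exact ⟨_, ⟨g, hg, g0, hj, Filter.EventuallyEq.rfl⟩, c.of_sameJet (hVJ.mono hk) hV hs.smooth,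
    r.of_sameJet hVJ, hVJ⟩

/-- Any calibrated and reduced form of a section representing the translated jet has the jet of the
normal form. -/
theorem sameJet (hJ : IsNormalForm J) (hk : 3 ≤ k) (hθ : θ ∈ genericPart k)
    {U T : Base → Fib} (hU : SmoothSectionNear U 0) (h : SameJet k U 0 (jetSection θ) 0)
    (e : PointEquiv U 0 T 0) (c : Calibrated T) (r : Reduced (k + 1) T) :
    SameJet k T 0 (J θ) 0 := by
  obtain ⟨V, eV, cV, rV, hV⟩ := hJ.exists_pointEquiv hk hθ hU h
  refine SameJet.trans (fun i a b hab => ?_) hV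
  exact (PointEquiv.partials_eq (e.symm.trans eV) (e.smooth hU) r rV c cV i hab).symm

variable {S : Base → Fib} {p : Base}

theorem sameJet_translated (S : Base → Fib) (p : Base) :
    SameJet k (fun x => S (x + p)) 0 (jetSection (jet k S p)) 0 := by
  have h := sameJet_translate k S p 0
  rw [zero_add] at h
  exact h.trans (sameJet_jetSection S p).symm

theorem exists_pointEquiv_jet (hJ : IsNormalForm J) (hk : 3 ≤ k) (hS : SmoothSectionNear S p)
    (hθ : jet k S p ∈ genericPart k) :
    ∃ V, PointEquiv S p V 0 ∧ Calibrated V ∧ Reduced (k + 1) V ∧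
      SameJet k V 0 (J (jet k S p)) 0 := by
  have e := pointEquiv_translate S p
  obtain ⟨V, eV, h⟩ := hJ.exists_pointEquiv hk hθ (e.smooth hS) (sameJet_translated S p)
  exact ⟨V, e.trans eV, h⟩

theorem sameJet_jet (hJ : IsNormalForm J) (hk : 3 ≤ k) (hS : SmoothSectionNear S p)
    (hθ : jet k S p ∈ genericPart k) {T : Base → Fib} (e : PointEquiv S p T 0) (c : Calibrated T)
    (r : Reduced (k + 1) T) : SameJet k T 0 (J (jet k S p)) 0 :=
  have e' := pointEquiv_translate S p
  hJ.sameJet hk hθ (e'.smooth hS) (sameJet_translated S p) (e'.symm.trans e) c r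

end IsNormalForm

/-! ### Scalar differential invariants -/

section invariants

variable {N k : ℕ} {e : Fin N → Fin 4 × ℕ × ℕ} {J : JetSpace k → Base → Fib}

/-- The invariants: the free coordinates of the normal form. -/
noncomputable def invariant (e : Fin N → Fin 4 × ℕ × ℕ) (J : JetSpace k → Base → Fib) (j : Fin N)
    (θ : genericPart k) : ℝ := freeCoord e (J θ) j

/-- A normal form of the original section is also one of the transformed section, and uniqueness
identifies the `k`-jets of the two. -/
theorem isInvariant_invariant (he : EnumeratesFree k e) (hJ : IsNormalForm J) (hk : 3 ≤ k)
    (j : Fin N) : IsInvariant (invariant e J j) := by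
  intro f S p hS hp h h'
  have hS' := SmoothSectionNear.of_contDiff hS p
  obtain ⟨V, eV, c, r, hV⟩ := hJ.exists_pointEquiv_jet hk hS' h
  have ef := pointEquiv_pushSection f S hp
  have hV' := hJ.sameJet_jet hk (ef.smooth hS') h' (ef.symm.trans eV) c r
  exact congrFun (he.freeCoord_eq (hV'.symm.trans hV)) j

theorem extendJet_congr {I : genericPart k → ℝ} {f : JetSpace k → ℝ}
    (h : ∀ θ : genericPart k, I θ = f θ) : Set.EqOn (extendJet I) f (genericPart k) :=
  fun θ hθ => (extendJet_apply I ⟨θ, hθ⟩).trans (h ⟨θ, hθ⟩)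

theorem isSmooth_invariant (hJ : IsNormalForm J) (j : Fin N) : IsSmooth (invariant e J j) := by
  refine ContDiffOn.congr (f := fun θ => freeCoord e (J θ) j) (fun θ hθ => ?_)
    (extendJet_congr fun _ => rfl)
  exact ((((hJ θ hθ).1.family (e j).1).partials _ _).eval).contDiffWithinAt

theorem invariant_mem (he : EnumeratesFree k e) (hJ : IsNormalForm J) (hk : 3 ≤ k) (j : Fin N) :
    invariant e J j ∈ scalarInvariants k :=
  ⟨isSmooth_invariant hJ j, isInvariant_invariant he hJ hk j⟩

theorem EnumeratesFree.jet_mem (he : EnumeratesFree k e) (hk : 3 ≤ k) (l : ℕ) (c : Fin N → ℝ) :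
    jet l (normalSection k e c) 0 ∈ genericPart l :=
  ⟨_, 0, normalSection_contDiff c, by rw [he.F3_normalSection hk]; exact one_ne_zero, rfl⟩

/-- An invariant of order at most `k` is determined by its values on the sections in normal
form. -/
theorem IsInvariant.eq_normalSection (he : EnumeratesFree k e) (hJ : IsNormalForm J) (hk : 3 ≤ k)
    {l : ℕ} (hl : l ≤ k) {I : genericPart l → ℝ} (hI : IsInvariant I) {S : Base → Fib} {p : Base}
    (hS : ContDiff ℝ ∞ S) (h3 : F3 S p ≠ 0) :
    I ⟨jet l S p, S, p, hS, h3, rfl⟩ = I ⟨jet l (normalSection k e fun j =>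
      invariant e J j ⟨jet k S p, S, p, hS, h3, rfl⟩) 0, he.jet_mem hk l _⟩ := by
  have hS' := SmoothSectionNear.of_contDiff hS p
  obtain ⟨V, eV, c, r, hV⟩ := hJ.exists_pointEquiv_jet hk hS' ⟨S, p, hS, h3, rfl⟩
  have hn := he.sameJet hk (eV.smooth hS') c r
  rw [he.freeCoord_eq hV] at hn
  -- Invariance is formulated for actual point transformations, so the germ of the normalizing map
  -- is realized by one.
  obtain ⟨f, hp, hf, ef⟩ := eV.exists_pushSection
  have hj : jet l (pushSection f S) (f.toOPH p) = jet l (normalSection k e fun j =>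
      invariant e J j ⟨jet k S p, S, p, hS, h3, rfl⟩) 0 := by
    rw [hf]
    exact jet_eq_of_sameJet ((SameJet.of_eventuallyEq ef.symm l).trans (hn.mono hl))
  have hm : jet l (pushSection f S) (f.toOPH p) ∈ genericPart l := hj ▸ he.jet_mem hk l _
  rw [← hI f S p hS hp ⟨S, p, hS, h3, rfl⟩ hm]
  exact congrArg I (Subtype.ext hj)

/-- In order three the normal form has no parameters, so every generic 3-jet is equivalent to a
single one; projecting to `l`-jets covers all `l ≤ 3`. -/
theorem scalarInvariants_eq_bot {l : ℕ} (hl : l ≤ 3) : scalarInvariants l = ⊥ := by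
  obtain ⟨J, hJ⟩ := exists_isNormalForm le_rfl
  have he := enumeratesFree_three
  refine eq_bot_iff.2 fun I hI => Algebra.mem_bot.2
    ⟨I ⟨jet l (normalSection 3 Fin.elim0 Fin.elim0) 0, he.jet_mem le_rfl l _⟩, ?_⟩
  funext ⟨θ, S, p, hS, h3, h⟩
  subst h
  rw [hI.2.eq_normalSection he hJ le_rfl hl hS h3]
  exact congrArg I (Subtype.ext (congrArg (fun c => jet l (normalSection 3 Fin.elim0 c) 0)
    (Subsingleton.elim _ _)))

theorem contDiff_jet_normalSection (e : Fin N → Fin 4 × ℕ × ℕ) :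
    ContDiff ℝ ∞ fun c : Fin N → ℝ => jet k (normalSection k e c) 0 := by
  refine contDiff_const.prodMk (contDiff_pi.2 fun σ => contDiff_pi.2 fun i => ?_)
  have h := contDiff_normalCoef (e := e) i σ.1.1 σ.1.2
  rwa [← funext fun c => partials_normalSection (e := e) c i σ.2] at h

/-- The function `φ` is the restriction of the invariant to the cross-section. It is smooth on all
of `ℝ^N` because every choice of the free coordinates gives a generic jet. -/
theorem generates_invariant (he : EnumeratesFree k e) (hJ : IsNormalForm J) (hk : 3 ≤ k) :
    Generates (invariant e J) := by
  refine ⟨invariant_mem he hJ hk, fun I => ⟨fun hI => ?_, ?_⟩⟩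
  · refine ⟨fun c => extendJet I (jet k (normalSection k e c) 0), ?_, ?_⟩
    · exact contDiffOn_univ.1 (hI.1.comp (contDiff_jet_normalSection e).contDiffOn
        fun c _ => he.jet_mem hk k c)
    · rintro ⟨θ, S, p, hS, h3, rfl⟩
      rw [hI.2.eq_normalSection he hJ hk le_rfl hS h3]
      exact (extendJet_apply I ⟨_, he.jet_mem hk k _⟩).symm
  · rintro ⟨φ, hφ, hI⟩
    refine ⟨ContDiffOn.congr (f := fun θ => φ fun j => extendJet (invariant e J j) θ)
      (hφ.comp_contDiffOn (contDiffOn_pi.2 fun j => isSmooth_invariant hJ j))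
      (extendJet_congr fun θ => ?_), fun f S p hS hp h h' => ?_⟩
    · simp only [hI, extendJet_apply]
    · rw [hI, hI]
      exact congrArg φ (funext fun j => isInvariant_invariant he hJ hk j f S p hS hp h h')

/-- The jet over `p` with the partial derivatives of the section `U` at the origin. -/
noncomputable def jetOver (k : ℕ) (p : Base) (U : Base → Fib) : JetSpace k := (p, (jet k U 0).2)

theorem sameJet_jetOver (p : Base) (U : Base → Fib) :
    SameJet k U 0 (jetSection (jetOver k p U)) 0 := (sameJet_jetSection U 0).symm

/-- The cross-section is moved by the inverse of the map normalizing `θ`, giving a smooth map `γ`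
from `ℝ^N` through `θ` along which the invariants are the coordinates of `ℝ^N`. Their differentials
at `θ` are therefore independent. -/
theorem functionallyIndependent_invariant (he : EnumeratesFree k e) (hJ : IsNormalForm J)
    (hk : 3 ≤ k) : FunctionallyIndependent (invariant e J) := by
  rintro ⟨θ, hθ⟩
  obtain ⟨hs, hE, c, r⟩ := hJ θ hθ
  obtain ⟨g, hg, g0, hj, eg⟩ := hE.symm
  let c₀ := freeCoord e (J θ)
  let γ : (Fin N → ℝ) → JetSpace k := fun c => jetOver k θ.1 (pullSection (normalSection k e c) g)
  have hU (c : Fin N → ℝ) : SmoothSectionFamilyAt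
      (fun c => pullSection (normalSection k e c) g) c :=
    (normalSection_family c).pullSection_map (fun i => .of_fun (hg i).contDiffAt) hg g0 hj
  have hγ : ContDiff ℝ ∞ γ := contDiff_const.prodMk <| contDiff_pi.2 fun σ => contDiff_pi.2
    fun i => contDiff_iff_contDiffAt.2 fun c => (((hU c).family i).partials σ.1.1 σ.1.2).eval
  have mem (c : Fin N → ℝ) : γ c ∈ genericPart k := by
    -- On the moved cross-section `F3` is the fifth power of the Jacobian of the fixed map `g`, so
    -- `γ` never leaves the generic part.
    rw [mem_genericPart_iff hk, ← ((sameJet_jetOver _ _).mono hk).F3_eq (hU c).smooth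
      (jetSection_smooth _ 0), F3_pullSection (normalSection_smooth c _) hg hj, g0,
      he.F3_normalSection hk, mul_one]
    exact pow_ne_zero 5 hj
  have inv (c : Fin N → ℝ) (j : Fin N) : extendJet (invariant e J j) (γ c) = c j := by
    rw [extendJet_apply _ ⟨γ c, mem c⟩]
    have hE : PointEquiv (normalSection k e c) 0 (pullSection (normalSection k e c) g) 0 :=
      ⟨g, hg, g0, hj, Filter.EventuallyEq.rfl⟩
    have h := hJ.sameJet hk (mem c) (hU c).smooth (sameJet_jetOver _ _) hE.symm
      (he.calibrated hk c) (he.reduced c)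
    exact congrFun ((he.freeCoord_eq h).symm.trans (he.freeCoord_normalSection c)) j
  have γ₀ : γ c₀ = θ := by
    have h : SameJet k (pullSection (normalSection k e c₀) g) 0 (jetSection θ) 0 :=
      (SameJet.pullSection (by rw [g0]; exact (he.sameJet hk hs.smooth c r).symm)
        (normalSection_smooth _ _) (by rw [g0]; exact hs.smooth) hg hj).trans
        (.of_eventuallyEq eg.symm k)
    refine Prod.ext rfl (funext fun σ => funext fun i => ?_)
    have h1 := h i σ.1.1 σ.1.2 σ.2
    rw [partials_jetSection _ _ σ.2, jetCoef, dif_pos σ.2] at h1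
    exact h1
  rw [Fintype.linearIndependent_iff]
  intro a ha i
  have hd (j : Fin N) : HasFDerivAt (extendJet (invariant e J j))
      (fderiv ℝ (extendJet (invariant e J j)) θ) (γ c₀) := by
    rw [γ₀]
    exact (((isSmooth_invariant hJ j).contDiffAt
      ((isOpen_genericPart hk).mem_nhds hθ)).differentiableAt (by simp)).hasFDerivAt
  have hγ' := (hγ.differentiable (by simp) c₀).hasFDerivAt
  have hc (j : Fin N) : fderiv ℝ (extendJet (invariant e J j)) θ
      (fderiv ℝ γ c₀ (Pi.single i 1)) = (Pi.single i 1 : Fin N → ℝ) j := by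
    have h1 := (hd j).comp c₀ hγ'
    have h2 : HasFDerivAt (extendJet (invariant e J j) ∘ γ)
        (ContinuousLinearMap.proj (R := ℝ) (φ := fun _ : Fin N => ℝ) j) c₀ :=
      (hasFDerivAt_apply j c₀).congr_of_eventuallyEq (.of_forall fun c => inv c j)
    exact DFunLike.congr_fun (h1.unique h2) (Pi.single i 1)
  -- Evaluating a linear relation on the image of the `i`-th basis vector under the derivative of
  -- `γ` isolates the `i`-th coefficient.
  have h := DFunLike.congr_fun ha (fderiv ℝ γ c₀ (Pi.single i 1))
  simpa [sum_apply, hc, Pi.single_apply] using h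

theorem generatedByIndependent (hk : 3 ≤ k) : GeneratedByIndependent k (k ^ 2 - k - 6) := by
  obtain ⟨e, he⟩ := exists_enumeratesFree hk
  obtain ⟨J, hJ⟩ := exists_isNormalForm hk
  exact ⟨invariant e J, functionallyIndependent_invariant he hJ hk, generates_invariant he hJ hk⟩

end invariants

end CubicODE

theorem mainTheorem9 :
    (∀ k : ℕ, k ≤ 3 → CubicODE.scalarInvariants k = ⊥) ∧
    (∀ k : ℕ, 4 ≤ k → CubicODE.GeneratedByIndependent k (k ^ 2 - k - 6)) ∧
    CubicODE.GeneratedByIndependent 4 6 ∧ CubicODE.GeneratedByIndependent 5 14 :=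
  ⟨fun _ hk => CubicODE.scalarInvariants_eq_bot hk,
    fun _ hk => CubicODE.generatedByIndependent (by omega),
    CubicODE.generatedByIndependent (k := 4) (by norm_num),
    CubicODE.generatedByIndependent (k := 5) (by norm_num)⟩
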